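/- Let $M$ be a compact connected smooth manifold and let $\pi\colon\tilde M\to M$ be a connected smooth double cover with nontrivial deck transformation $\tau$ (for example, $M$ non-orientable and $\tilde M$ its oriented cover). Let $G$ be a (finite-dimensional, real) Lie group with centre $Z(G)$ (for example a connected complex semisimple Lie group). Choose $\tilde x_0\in\tilde M$, put $x_0=\pi(\tilde x_0)$, $\Gamma=\pi_1(M,x_0)$, and regard $\tilde\Gamma=\pi_1(\tilde M,\tilde x_0)$ as a subgroup of $\Gamma$ by means of $\pi_*$; products in these groups are concatenations from left to right. Fix $c\in\Gamma\setminus\tilde\Gamma$ and write $\mathrm{Ad}_g h=ghg^{-1}$. For every $z\in Z(G)$ there is a bijection between the following two sets. (1) Isomorphism classes of triples $(Q,\tau_Q,A)$, where $Q\to\tilde M$ is a smooth principal $G$-bundle, $\tau_Q\colon Q\to Q$ is a smooth $G$-bundle map that lifts $\tau$ and satisfies $\tau_Q^2=z$ (that is, $\tau_Q(\tau_Q(q))=q\cdot z$ for all $q\in Q$), and $A$ is a $\tau_Q$-invariant flat connection on $Q$. An isomorphism $(Q,\tau_Q,A)\to(Q',\tau_{Q'},A')$ is a $G$-equivariant diffeomorphism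 $f\colon Q\to Q'$ over $\mathrm{id}_{\tilde M}$ with $f\circ\tau_Q=\tau_{Q'}\circ f$ and $f^*A'=A$. (2) Equivalence classes, under simultaneous conjugation by elements of $G$, of pairs $(\phi,g)$ with $\phi\in\mathrm{Hom}(\tilde\Gamma,G)$ and $g\in G$ such that $\phi\circ\mathrm{Ad}_c|_{\tilde\Gamma}=\mathrm{Ad}_g\circ\phi$ and $g^2\phi(c^2)^{-1}=z$. The bijection is given by holonomy: the class of $(Q,\tau_Q,A)$ corresponds to the class of $(\phi,g)$ if and only if there is a point $q_0$ in the fibre $Q_{\tilde x_0}$ such that $A$-parallel transport takes $q_0$ to $q_0\,\phi([\alpha])^{-1}$ along every piecewise smooth loop $\alpha$ at $\tilde x_0$, and takes $q_0$ to $\tau_Q(q_0)\,g^{-1}$ along every piecewise smooth path $\beta$ from $\tilde x_0$ to $\tau(\tilde x_0)$ with $[\pi\circ\beta]=c$. -/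

import Mathlib

open scoped Manifold ContDiff Topology

universe v w

noncomputable section

/-- The model with corners of the total space of a principal bundle whose base is modelled on `E`
and whose structure group is modelled on `F`. -/
abbrev bundleModel (E F : Type*) [NormedAddCommGroup E] [NormedSpace ℝ E]
    [NormedAddCommGroup F] [NormedSpace ℝ F] :
    ModelWithCorners ℝ (E × F) (ModelProd E F) :=
  𝓘(ℝ, E).prod 𝓘(ℝ, F)

/-! ### Fundamental groups and double covers -/

/-- The group of homotopy classes of loops at `x`, where the product `a * b` is represented by the
concatenation "first `a`, then `b`".  (The multiplication of Mathlib's `FundamentalGroup` is in the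
opposite order.) -/
abbrev LoopGroup (X : Type*) [TopologicalSpace X] (x : X) : Type _ := (FundamentalGroup X x)ᵐᵒᵖ

/-- The class of a loop. -/
def loopClass {X : Type*} [TopologicalSpace X] {x : X} (α : Path x x) : LoopGroup X x :=
  MulOpposite.op (FundamentalGroup.fromPath (Path.Homotopic.Quotient.mk α))

/-- `π : N → M` is a smooth two-sheeted covering, and `τ` is its nontrivial deck transformation. -/
structure IsDoubleCover (E : Type*) [NormedAddCommGroup E] [NormedSpace ℝ E]
    {M : Type*} [TopologicalSpace M] [ChartedSpace E M]
    {N : Type*} [TopologicalSpace N] [ChartedSpace E N]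
    (π : N → M) (τ : N → N) : Prop where
  isCoveringMap : IsCoveringMap π
  isLocalDiffeomorph : IsLocalDiffeomorph 𝓘(ℝ, E) 𝓘(ℝ, E) ∞ π
  surjective : Function.Surjective π
  contMDiff_deck : ContMDiff 𝓘(ℝ, E) 𝓘(ℝ, E) ∞ τ
  deck_ne : ∀ x, τ x ≠ x
  fibre : ∀ x y, π x = π y ↔ y = x ∨ y = τ x

namespace IsDoubleCover

variable {E : Type*} [NormedAddCommGroup E] [NormedSpace ℝ E]
  {M : Type*} [TopologicalSpace M] [ChartedSpace E M]
  {N : Type*} [TopologicalSpace N] [ChartedSpace E N] {π : N → M} {τ : N → N}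

/-- The homomorphism `π_* : π₁(N, x) → π₁(M, π x)`. -/
def onLoops (h : IsDoubleCover E π τ) (x : N) : LoopGroup N x →* LoopGroup M (π x) :=
  MonoidHom.op (FundamentalGroup.map ⟨π, h.isCoveringMap.continuous⟩ x)

theorem proj_deck (h : IsDoubleCover E π τ) (x : N) : π (τ x) = π x :=
  ((h.fibre x (τ x)).2 (Or.inr rfl)).symm

/-- The loop `π ∘ β` in `M` obtained from a path `β` in `N` from `x` to `τ x`. -/
def projLoop (h : IsDoubleCover E π τ) {x : N} (β : Path x (τ x)) : Path (π x) (π x) :=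
  (β.map h.isCoveringMap.continuous).cast rfl (h.proj_deck x).symm

end IsDoubleCover

/-! ### Principal bundles -/

/-- A smooth principal `G`-bundle over `N`: a smooth manifold with a smooth right action of `G` and
a smooth `G`-invariant projection to `N` that is locally, in a smooth and `G`-equivariant way, the
product `U × G → U`. -/
structure PrincipalBundle (E F : Type*) [NormedAddCommGroup E] [NormedSpace ℝ E]
    [NormedAddCommGroup F] [NormedSpace ℝ F]
    (N : Type v) [TopologicalSpace N] [ChartedSpace E N]
    (G : Type w) [TopologicalSpace G] [ChartedSpace F G] [Group G] where
  Total : Type (max v w)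
  [topologicalSpace : TopologicalSpace Total]
  [chartedSpace : ChartedSpace (ModelProd E F) Total]
  [isManifold : IsManifold (bundleModel E F) ∞ Total]
  proj : Total → N
  act : Total → G → Total
  act_one : ∀ q, act q 1 = q
  act_mul : ∀ q g h, act q (g * h) = act (act q g) h
  proj_act : ∀ q g, proj (act q g) = proj q
  contMDiff_proj : ContMDiff (bundleModel E F) 𝓘(ℝ, E) ∞ proj
  contMDiff_act : ContMDiff ((bundleModel E F).prod 𝓘(ℝ, F)) (bundleModel E F) ∞
    (fun p : Total × G ↦ act p.1 p.2)
  locallyTrivial : ∀ x : N, ∃ (U : Set N) (e : OpenPartialHomeomorph Total (N × G)),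
    IsOpen U ∧ x ∈ U ∧ e.source = proj ⁻¹' U ∧ e.target = U ×ˢ Set.univ ∧
    ContMDiffOn (bundleModel E F) (𝓘(ℝ, E).prod 𝓘(ℝ, F)) ∞ e e.source ∧
    ContMDiffOn (𝓘(ℝ, E).prod 𝓘(ℝ, F)) (bundleModel E F) ∞ e.symm e.target ∧
    (∀ q ∈ e.source, (e q).1 = proj q) ∧
    (∀ q ∈ e.source, ∀ g, (e (act q g)).2 = (e q).2 * g)

attribute [instance] PrincipalBundle.topologicalSpace PrincipalBundle.chartedSpace
  PrincipalBundle.isManifold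

/-- The adjoint action `Ad_g` on the Lie algebra of `G`: the derivative at `1` of
`h ↦ g * h * g⁻¹`. -/
def adjointAction (F : Type*) [NormedAddCommGroup F] [NormedSpace ℝ F]
    {G : Type*} [TopologicalSpace G] [ChartedSpace F G] [Group G] (g : G)
    (ξ : GroupLieAlgebra 𝓘(ℝ, F) G) : GroupLieAlgebra 𝓘(ℝ, F) G :=
  mfderiv 𝓘(ℝ, F) 𝓘(ℝ, F) (fun h : G ↦ g * h * g⁻¹) 1 ξ

/-! ### Connections -/

section Connections

variable {E F : Type*} [NormedAddCommGroup E] [NormedSpace ℝ E]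
  [NormedAddCommGroup F] [NormedSpace ℝ F]
  {N : Type v} [TopologicalSpace N] [ChartedSpace E N]
  {G : Type w} [TopologicalSpace G] [ChartedSpace F G] [Group G]

/-- A connection on a principal bundle, given by its connection form: a smooth `Lie(G)`-valued
1-form on the total space that reproduces the generators of the fundamental vector fields and is
equivariant under `G`. -/
structure PrincipalConnection (P : PrincipalBundle E F N G) where
  form : ∀ q : P.Total, TangentSpace (bundleModel E F) q →L[ℝ] GroupLieAlgebra 𝓘(ℝ, F) G
  contMDiff_form : ContMDiff (M' := F) (bundleModel E F).tangent 𝓘(ℝ, F) ∞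
    (fun X : TangentBundle (bundleModel E F) P.Total ↦ form X.1 X.2)
  form_vertical : ∀ (q : P.Total) (ξ : GroupLieAlgebra 𝓘(ℝ, F) G),
    form (P.act q 1) (mfderiv 𝓘(ℝ, F) (bundleModel E F) (fun g : G ↦ P.act q g) 1 ξ) = ξ
  form_act : ∀ (q : P.Total) (g : G) (X : TangentSpace (bundleModel E F) q),
    form (P.act q g) (mfderiv (bundleModel E F) (bundleModel E F) (fun p ↦ P.act p g) q X) =
      adjointAction F g⁻¹ (form q X)

namespace PrincipalConnection

variable {P : PrincipalBundle E F N G} (A : PrincipalConnection P)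

/-- The curvature `F_A` vanishes.  The curvature is the horizontal 2-form whose value on horizontal
vector fields `V`, `W` is `dA(V, W) = V (A W) - W (A V) - A [V, W] = - A [V, W]`. -/
def IsFlat : Prop :=
  ∀ (q : P.Total) (V W : ∀ p : P.Total, TangentSpace (bundleModel E F) p),
    ContMDiffAt (bundleModel E F) (bundleModel E F).tangent ∞
      (fun p ↦ (⟨p, V p⟩ : TangentBundle (bundleModel E F) P.Total)) q →
    ContMDiffAt (bundleModel E F) (bundleModel E F).tangent ∞
      (fun p ↦ (⟨p, W p⟩ : TangentBundle (bundleModel E F) P.Total)) q →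
    (∀ᶠ p in 𝓝 q, A.form p (V p) = 0) → (∀ᶠ p in 𝓝 q, A.form p (W p) = 0) →
    A.form q (VectorField.mlieBracket (bundleModel E F) V W q) = 0

/-- A path in the total space is horizontal if, off finitely many times, it is smooth and its
velocity is annihilated by the connection form. -/
def IsHorizontal {q q' : P.Total} (γ : Path q q') : Prop :=
  ∃ S : Set ℝ, S.Finite ∧ ∀ t ∈ Set.Ioo (0 : ℝ) 1 \ S,
    ContMDiffAt 𝓘(ℝ, ℝ) (bundleModel E F) ∞ γ.extend t ∧
    A.form (γ.extend t)
      (mfderiv 𝓘(ℝ, ℝ) (bundleModel E F) γ.extend t (1 : ℝ)) = 0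

/-- `q'` is the parallel transport of `q` along the path `α`: some horizontal path from `q` to `q'`
lies over `α`. -/
def IsTransport {x y : N} (α : Path x y) (q q' : P.Total) : Prop :=
  ∃ γ : Path q q', A.IsHorizontal γ ∧ ∀ t, P.proj (γ t) = α t

end PrincipalConnection

/-! ### Flat bundles with a lift of the deck transformation -/

/-- The data `(Q, τ_Q, A)`: a principal `G`-bundle `Q` over `N`, a `G`-bundle map `τ_Q` of `Q` that
lifts `τ` and has square (the right action of) `z`, and a `τ_Q`-invariant flat connection `A`. -/
structure FlatTwistedBundle (E F : Type*) [NormedAddCommGroup E] [NormedSpace ℝ E]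
    [NormedAddCommGroup F] [NormedSpace ℝ F]
    {N : Type v} [TopologicalSpace N] [ChartedSpace E N] (τ : N → N)
    {G : Type w} [TopologicalSpace G] [ChartedSpace F G] [Group G] (z : G) where
  bundle : PrincipalBundle E F N G
  lift : bundle.Total → bundle.Total
  contMDiff_lift : ContMDiff (bundleModel E F) (bundleModel E F) ∞ lift
  lift_act : ∀ q g, lift (bundle.act q g) = bundle.act (lift q) g
  proj_lift : ∀ q, bundle.proj (lift q) = τ (bundle.proj q)
  lift_lift : ∀ q, lift (lift q) = bundle.act q z
  conn : PrincipalConnection bundle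
  flat : conn.IsFlat
  invariant : ∀ (q : bundle.Total) (X : TangentSpace (bundleModel E F) q),
    conn.form (lift q) (mfderiv (bundleModel E F) (bundleModel E F) lift q X) = conn.form q X

namespace FlatTwistedBundle

variable {τ : N → N} {z : G}

/-- Isomorphism of triples `(Q, τ_Q, A)`: a `G`-equivariant diffeomorphism over the identity of `N`
that intertwines the lifts of `τ` and pulls back one connection to the other. -/
def Iso (D D' : FlatTwistedBundle E F τ z) : Prop :=
  ∃ f : Diffeomorph (bundleModel E F) (bundleModel E F) D.bundle.Total D'.bundle.Total ∞,
    (∀ q, D'.bundle.proj (f q) = D.bundle.proj q) ∧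
    (∀ q g, f (D.bundle.act q g) = D'.bundle.act (f q) g) ∧
    (∀ q, f (D.lift q) = D'.lift (f q)) ∧
    (∀ (q : D.bundle.Total) (X : TangentSpace (bundleModel E F) q),
      D'.conn.form (f q) (mfderiv (bundleModel E F) (bundleModel E F) f q X) = D.conn.form q X)

theorem Iso.refl (D : FlatTwistedBundle E F τ z) : Iso D D := by
  refine ⟨Diffeomorph.refl _ _ _, fun _ ↦ rfl, fun _ _ ↦ rfl, fun _ ↦ rfl, fun q X ↦ ?_⟩
  have h : mfderiv (bundleModel E F) (bundleModel E F)
      (Diffeomorph.refl (bundleModel E F) D.bundle.Total ∞) q X = X := by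
    rw [Diffeomorph.coe_refl, mfderiv_id]; rfl
  exact congrArg (D.conn.form q) h

theorem Iso.symm {D D' : FlatTwistedBundle E F τ z} (h : Iso D D') : Iso D' D := by
  obtain ⟨f, h1, h2, h3, h4⟩ := h
  refine ⟨f.symm, fun q ↦ ?_, fun q g ↦ ?_, fun q ↦ ?_, fun q X ↦ ?_⟩
  · rw [← h1, f.apply_symm_apply]
  · apply f.injective
    change f _ = f _
    rw [h2, f.apply_symm_apply, f.apply_symm_apply]
  · apply f.injective
    change f _ = f _
    rw [h3, f.apply_symm_apply, f.apply_symm_apply]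
  · obtain ⟨p, rfl⟩ : ∃ p, f p = q := f.surjective q
    have key : mfderiv (bundleModel E F) (bundleModel E F) f (f.symm (f p))
        (mfderiv (bundleModel E F) (bundleModel E F) f.symm (f p) X) = X := by
      have hc := mfderiv_comp (I := bundleModel E F) (I' := bundleModel E F)
        (I'' := bundleModel E F) (f p)
        (f.contMDiff.mdifferentiable (by simp) (f.symm (f p)))
        (f.symm.contMDiff.mdifferentiable (by simp) (f p))
      have hid : (f ∘ f.symm) = id := by ext y; simp
      rw [hid, mfderiv_id] at hc
      exact (DFunLike.congr_fun hc X).symm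
    have hp : f.symm (f p) = p := f.symm_apply_apply p
    have := h4 (f.symm (f p)) (mfderiv (bundleModel E F) (bundleModel E F) f.symm (f p) X)
    refine this.symm.trans ?_
    have aux : ∀ (r r' : D'.bundle.Total) (_ : r = r') (Y : E × F),
        D'.conn.form r Y = D'.conn.form r' Y := by rintro r _ rfl Y; rfl
    exact (aux _ _ (by rw [hp]) _).trans (congrArg (D'.conn.form (f p)) key)

theorem Iso.trans {D D' D'' : FlatTwistedBundle E F τ z} (h : Iso D D') (h' : Iso D' D'') :
    Iso D D'' := by
  obtain ⟨f, h1, h2, h3, h4⟩ := h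
  obtain ⟨f', h1', h2', h3', h4'⟩ := h'
  refine ⟨f.trans f', fun q ↦ ?_, fun q g ↦ ?_, fun q ↦ ?_, fun q X ↦ ?_⟩
  · exact (h1' _).trans (h1 _)
  · exact (congrArg f' (h2 q g)).trans (h2' _ _)
  · exact (congrArg f' (h3 q)).trans (h3' _)
  · have hc := mfderiv_comp (I := bundleModel E F) (I' := bundleModel E F)
      (I'' := bundleModel E F) q
      (f'.contMDiff.mdifferentiable (by simp) (f q)) (f.contMDiff.mdifferentiable (by simp) q)
    have hc' := DFunLike.congr_fun hc X
    exact (congrArg (D''.conn.form (f' (f q))) hc').trans ((h4' (f q) _).trans (h4 q X))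

/-- Isomorphism as an equivalence relation. -/
def isoSetoid (E F : Type*) [NormedAddCommGroup E] [NormedSpace ℝ E]
    [NormedAddCommGroup F] [NormedSpace ℝ F]
    {N : Type v} [TopologicalSpace N] [ChartedSpace E N] (τ : N → N)
    {G : Type w} [TopologicalSpace G] [ChartedSpace F G] [Group G] (z : G) :
    Setoid (FlatTwistedBundle E F τ z) where
  r := Iso
  iseqv := ⟨Iso.refl, Iso.symm, Iso.trans⟩

end FlatTwistedBundle

end Connections

/-! ### Pairs `(φ, g)` -/

/-- Pairs `(φ, g)` of a homomorphism `φ` to `G` from a group `Γ'`, regarded as a subgroup of `Γ` by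
means of `ι`, and an element `g` of `G` such that `φ ∘ Ad_c = Ad_g ∘ φ` and `g² φ(c²)⁻¹ = z`. -/
structure TwistedPair {Γ' Γ : Type*} [Group Γ'] [Group Γ] (ι : Γ' →* Γ) (c : Γ)
    {G : Type*} [Group G] (z : G) where
  hom : Γ' →* G
  elt : G
  hom_conj : ∀ a : Γ', ∃ b : Γ', ι b = c * ι a * c⁻¹ ∧ hom b = elt * hom a * elt⁻¹
  elt_sq : ∃ b : Γ', ι b = c ^ 2 ∧ elt ^ 2 * (hom b)⁻¹ = z

/-- Simultaneous conjugation of `φ` and `g` by an element of `G`, as an equivalence relation. -/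
def TwistedPair.conjSetoid {Γ' Γ : Type*} [Group Γ'] [Group Γ] (ι : Γ' →* Γ) (c : Γ)
    {G : Type*} [Group G] (z : G) : Setoid (TwistedPair ι c z) where
  r p p' := ∃ h : G, (∀ a, p'.hom a = h * p.hom a * h⁻¹) ∧ p'.elt = h * p.elt * h⁻¹
  iseqv := by
    refine ⟨fun p ↦ ⟨1, by simp, by simp⟩, ?_, ?_⟩
    · rintro p p' ⟨h, h1, h2⟩
      exact ⟨h⁻¹, fun a ↦ by rw [h1]; group, by rw [h2]; group⟩
    · rintro p p' p'' ⟨h, h1, h2⟩ ⟨k, k1, k2⟩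
      exact ⟨k * h, fun a ↦ by rw [k1, h1]; group, by rw [k2, h2]; group⟩

/-- `(φ, g)` is the holonomy of `(Q, τ_Q, A)` with respect to the point `q₀` of `Q` over `x`:
parallel transport along a loop `α` at `x` takes `q₀` to `q₀ φ([α])⁻¹`, and parallel transport along
a path `β` from `x` to `τ x` with `[π ∘ β] = c` takes `q₀` to `τ_Q(q₀) g⁻¹`. -/
def IsHolonomy {E F : Type*} [NormedAddCommGroup E] [NormedSpace ℝ E]
    [NormedAddCommGroup F] [NormedSpace ℝ F]
    {M : Type*} [TopologicalSpace M] [ChartedSpace E M]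
    {N : Type v} [TopologicalSpace N] [ChartedSpace E N]
    {π : N → M} {τ : N → N} (hπ : IsDoubleCover E π τ) {x : N} {c : LoopGroup M (π x)}
    {G : Type w} [TopologicalSpace G] [ChartedSpace F G] [Group G] {z : G}
    (D : FlatTwistedBundle E F τ z) (q₀ : D.bundle.Total)
    (p : TwistedPair (hπ.onLoops x) c z) : Prop :=
  D.bundle.proj q₀ = x ∧
  (∀ (α : Path x x) (q : D.bundle.Total), D.conn.IsTransport α q₀ q →
    q = D.bundle.act q₀ (p.hom (loopClass α))⁻¹) ∧
  (∀ (β : Path x (τ x)) (q : D.bundle.Total), loopClass (hπ.projLoop β) = c →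
    D.conn.IsTransport β q₀ q → q = D.bundle.act (D.lift q₀) p.elt⁻¹)

end

/-!
# Flat bundles twisted by a deck transformation and their holonomy

The proof makes "parallel transport depends only on the homotopy class of the path" into a statement
about covering spaces, and then reads off the bijection from the behaviour of parallel transport
under the group action, the lift of the deck transformation and isomorphisms.

**From flat connections to monodromy.** In adapted local coordinates a section is horizontal if it
solves a total differential equation `Ds(x) = L(x, s(x))`, and vanishing of the curvature is the
integrability condition of that equation. By the Frobenius theorem
(`exists_hasFDerivAt_of_integrable`) it can be solved with any initial value, so there is a flat
local section through every point (`PrincipalConnection.IsFlat.hasFlatSections`). Two flat sections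
differ by a locally constant element of `G`. Hence, if the total space is given the topology
generated by the images of flat sections, the projection becomes a covering map
(`PrincipalConnection.HasFlatSections.isCoveringMap`), and a horizontal path is the same as a lift
of its projection to this covering, up to regularity. Parallel transport along a path is thus the
monodromy along its homotopy class
(`PrincipalConnection.HasFlatSections.eq_transport_of_isTransport`), and every homotopy class
contains paths along which horizontal lifts exist
(`PrincipalConnection.HasFlatSections.exists_isTransport`); merely continuous paths in the class
need not have any.

**The pair of a bundle.** Let `x₀` be the base point. Since `c` does not come from a loop in the
double cover, it lifts to exactly one homotopy class `b` of paths from `x₀` to `τ x₀`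
(`IsDoubleCover.exists_projClass_eq`, `IsDoubleCover.projClass_injective`). Therefore `(φ, g)` is
the holonomy at `q₀` if and only if the monodromy takes `q₀` to `q₀ φ(a)⁻¹` along each class of
loops `a` and to `τ_Q(q₀) g⁻¹` along `b` (`FlatTwistedBundle.isHolonomy_iff`). These equations
define `φ` and `g`; the relations `φ ∘ Ad_c = Ad_g ∘ φ` and `g² φ(c²)⁻¹ = z` follow by transporting
`q₀` along `a' · b = b · τ(a)`, where `a'` represents `c a c⁻¹`, and along the loop `b · τ(b)`,
which represents `c²` (`FlatTwistedBundle.exists_isHolonomy`). Another point `q₀ h` of the fibre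
gives a conjugate pair, and all conjugates arise. If two bundles have the same holonomy, matching
the monodromies of the two base points gives a well-defined map of total spaces, which is an
isomorphism (`FlatTwistedBundle.iso_of_isHolonomy`).

**The bundle of a pair.** Conversely, `φ` gives a locally constant cocycle. For each point `i`
choose a ball-like neighbourhood `U i`, and a class of paths from `x₀` to each point `y` of `U i`
that changes with `y` by paths inside `U i` (`RadialPaths`). The values of `φ` on the loops formed
by two such paths to the same point are locally constant, hence are the transition functions of a
smooth principal bundle (`FlatCocycle`), on which the Maurer–Cartan forms of the trivializations fit
together to a flat connection (`FlatCocycle.isFlat_conn`). A point of this bundle is represented by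
a class of paths from `x₀` together with an element of `G`, and the deck transformation is lifted by
`(σ, h) ↦ (b · τ(σ), g h)`; the two relations on `(φ, g)` say that this is well defined and has
square `z`. The holonomy is the given pair (`FlatTwistedBundle.exists_isHolonomy_eq`), so the
correspondence of classes is a bijection (`Quotient.exists_equiv_of_rel`).
-/

section

/-! ### The Frobenius theorem for total differential equations -/

open Set Metric in
/-- A smooth map is bounded together with its derivative near a point, with a quadratic bound for
the remainder of its first order expansion. -/
theorem exists_closedBall_taylor_bound {X Y : Type*} [NormedAddCommGroup X] [NormedSpace ℝ X]
    [NormedAddCommGroup Y] [NormedSpace ℝ Y] {f : X → Y} {Ω : Set X} (hΩ : IsOpen Ω)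
    (hf : ContDiffOn ℝ ∞ f Ω) {p₀ : X} (hp₀ : p₀ ∈ Ω) :
    ∃ ρ > (0 : ℝ), ∃ C ≥ (1 : ℝ), closedBall p₀ ρ ⊆ Ω ∧ (∀ p ∈ closedBall p₀ ρ, ‖f p‖ ≤ C) ∧
      (∀ p ∈ closedBall p₀ ρ, ‖fderiv ℝ f p‖ ≤ C) ∧
      (∀ p ∈ closedBall p₀ ρ, ∀ q ∈ closedBall p₀ ρ,
        ‖f q - f p - fderiv ℝ f p (q - p)‖ ≤ C * ‖q - p‖ ^ 2) := by
  have hfa : ContDiffAt ℝ ∞ f p₀ := hf.contDiffAt (hΩ.mem_nhds hp₀)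
  have hf' : ContDiffAt ℝ 1 (fderiv ℝ f) p₀ :=
    (contDiffAt_infty.1 hfa 2).fderiv_right (by norm_num)
  obtain ⟨K, t, ht, hK⟩ := hf'.exists_lipschitzOnWith
  have h1 : ∀ᶠ p in 𝓝 p₀, ‖f p‖ < ‖f p₀‖ + 1 :=
    hfa.continuousAt.norm.eventually (gt_mem_nhds (by simp))
  have h2 : ∀ᶠ p in 𝓝 p₀, ‖fderiv ℝ f p‖ < ‖fderiv ℝ f p₀‖ + 1 :=
    hf'.continuousAt.norm.eventually (gt_mem_nhds (by simp))
  obtain ⟨ρ, hρ, hsub⟩ := Metric.nhds_basis_closedBall.mem_iff.1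
    (Filter.inter_mem (Filter.inter_mem ht (hΩ.mem_nhds hp₀)) (Filter.inter_mem h1 h2))
  refine ⟨ρ, hρ, 1 + (‖f p₀‖ + 1) + (‖fderiv ℝ f p₀‖ + 1) + K, ?_, fun p hp ↦ (hsub hp).1.2,
    fun p hp ↦ ?_, fun p hp ↦ ?_, fun p hp q hq ↦ ?_⟩
  · have : (0 : ℝ) ≤ K := K.2
    linarith [norm_nonneg (f p₀), norm_nonneg (fderiv ℝ f p₀)]
  · have h : ‖f p‖ < ‖f p₀‖ + 1 := (hsub hp).2.1
    have : (0 : ℝ) ≤ K := K.2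
    linarith [norm_nonneg (f p₀), norm_nonneg (fderiv ℝ f p₀)]
  · have h : ‖fderiv ℝ f p‖ < ‖fderiv ℝ f p₀‖ + 1 := (hsub hp).2.2
    have : (0 : ℝ) ≤ K := K.2
    linarith [norm_nonneg (f p₀), norm_nonneg (fderiv ℝ f p₀)]
  · have hconv : Convex ℝ (closedBall p₀ ρ ∩ closedBall p ‖q - p‖) :=
      (convex_closedBall _ _).inter (convex_closedBall _ _)
    have hb := hconv.norm_image_sub_le_of_norm_hasFDerivWithin_le' (f := f) (f' := fderiv ℝ f)
      (φ := fderiv ℝ f p) (C := K * ‖q - p‖) (x := p) (y := q) (fun z hz ↦ ?_) (fun z hz ↦ ?_)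
      ⟨hp, by simp⟩ ⟨hq, by simp [dist_eq_norm]⟩
    · refine hb.trans ?_
      have h0 : (K : ℝ) ≤ 1 + (‖f p₀‖ + 1) + (‖fderiv ℝ f p₀‖ + 1) + K := by
        linarith [norm_nonneg (f p₀), norm_nonneg (fderiv ℝ f p₀)]
      calc (K : ℝ) * ‖q - p‖ * ‖q - p‖ = K * ‖q - p‖ ^ 2 := by ring
        _ ≤ _ := by gcongr
    · have hz' : z ∈ Ω := (hsub hz.1).1.2
      exact ((hf.contDiffAt (hΩ.mem_nhds hz')).differentiableAt
        (by simp)).hasFDerivAt.hasFDerivWithinAt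
    · have := hK.dist_le_mul z (hsub hz.1).1.1 p (hsub hp).1.1
      rw [dist_eq_norm] at this
      refine this.trans ?_
      gcongr
      simpa using hz.2

variable {E F : Type*} [NormedAddCommGroup E] [NormedSpace ℝ E]
  [NormedAddCommGroup F] [NormedSpace ℝ F]

open Set Metric NNReal in
/-- Solutions along rays of the total differential equation `dy = L(x, y)`: for short `v`, the
ordinary differential equation of the ray `t ↦ x₀ + t v` has a solution on all of `[0, 1]`. -/
theorem exists_radial_solution [CompleteSpace F] {L : E × F → E →L[ℝ] F} {x₀ : E} {y₀ : F}
    {ρ C : ℝ} (hρ : 0 < ρ) (hC : 1 ≤ C)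
    (hb : ∀ p ∈ closedBall (x₀, y₀) ρ, ‖L p‖ ≤ C)
    (hlip : LipschitzOnWith C.toNNReal L (closedBall (x₀, y₀) ρ)) (v : E)
    (hv : ‖v‖ ≤ ρ / (3 * C)) :
    ∃ Y : ℝ → F, Y 0 = y₀ ∧ (∀ t ∈ Icc (0 : ℝ) 1, ‖Y t - y₀‖ ≤ ρ / 3) ∧
      ∀ t ∈ Icc (0 : ℝ) 1, HasDerivWithinAt Y (L (x₀ + t • v, Y t) v) (Icc 0 1) t := by
  have hC0 : 0 < C := by linarith
  have hCv : C * ‖v‖ ≤ ρ / 3 := by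
    calc C * ‖v‖ ≤ C * (ρ / (3 * C)) := by gcongr
      _ = ρ / 3 := by field_simp
  have hvρ : ‖v‖ ≤ ρ := by nlinarith [norm_nonneg v]
  have hmem : ∀ t ∈ Icc (0 : ℝ) 1, ∀ y ∈ closedBall y₀ ρ,
      (x₀ + t • v, y) ∈ closedBall (x₀, y₀) ρ := by
    intro t ht y hy
    rw [← closedBall_prod_same]
    refine ⟨?_, hy⟩
    simp only [mem_closedBall, dist_self_add_left, norm_smul, Real.norm_eq_abs, abs_of_nonneg ht.1]
    nlinarith [norm_nonneg v, ht.2]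
  have hsub : closedBall y₀ (ρ / 3) ⊆ closedBall y₀ ρ := closedBall_subset_closedBall (by linarith)
  have hpl : IsPicardLindelof (fun t y ↦ L (x₀ + t • v, y) v)
      (⟨0, by simp⟩ : Icc (0 : ℝ) 1) y₀ (ρ / 3).toNNReal 0 (C * ‖v‖).toNNReal
      (C * ‖v‖).toNNReal := by
    have hρ3 : ((ρ / 3).toNNReal : ℝ) = ρ / 3 := Real.coe_toNNReal _ (by positivity)
    have hcv : ((C * ‖v‖).toNNReal : ℝ) = C * ‖v‖ := Real.coe_toNNReal _ (by positivity)
    refine ⟨fun t ht ↦ ?_, fun y hy ↦ ?_, fun t ht y hy ↦ ?_, ?_⟩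
    · rw [hρ3]
      refine LipschitzOnWith.of_dist_le_mul fun y hy y' hy' ↦ ?_
      have h1 := hlip.dist_le_mul _ (hmem t ht y (hsub hy)) _ (hmem t ht y' (hsub hy'))
      rw [Real.coe_toNNReal _ hC0.le, Prod.dist_eq, dist_self, max_eq_right dist_nonneg,
        dist_eq_norm] at h1
      rw [hcv, dist_eq_norm, ← sub_apply]
      calc _ ≤ ‖L (x₀ + t • v, y) - L (x₀ + t • v, y')‖ * ‖v‖ :=
            ContinuousLinearMap.le_opNorm _ _
        _ ≤ C * dist y y' * ‖v‖ := by gcongr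
        _ = _ := by ring
    · rw [hρ3] at hy
      have hL : ContinuousOn (fun t : ℝ ↦ L (x₀ + t • v, y)) (Icc 0 1) :=
        hlip.continuousOn.comp (by fun_prop) (fun t ht ↦ hmem t ht y (hsub hy))
      exact hL.clm_apply continuousOn_const
    · rw [hρ3] at hy
      rw [hcv]
      refine (ContinuousLinearMap.le_opNorm _ _).trans ?_
      gcongr
      exact hb _ (hmem t ht y (hsub hy))
    · simpa [hρ3, hcv] using hCv
  obtain ⟨α, hα⟩ := ODE.FunSpace.exists_isFixedPt_next hpl (mem_closedBall_self le_rfl)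
  refine ⟨α.compProj, ?_, fun t ht ↦ ?_, fun t ht ↦ ?_⟩
  · have : α.compProj ((⟨0, by simp⟩ : Icc (0 : ℝ) 1) : ℝ) = y₀ := by
      rw [ODE.FunSpace.compProj_val, ← hα, ODE.FunSpace.next_apply₀]
    exact this
  · have := α.compProj_mem_closedBall hpl.mul_max_le (t := t)
    rw [Real.coe_toNNReal _ (by positivity)] at this
    simpa [dist_eq_norm] using this
  · apply ODE.hasDerivWithinAt_picard_Icc (t₀ := 0) (by simp) hpl.continuousOn_uncurry
      α.continuous_compProj.continuousOn (fun _ ht' ↦ α.compProj_mem_closedBall hpl.mul_max_le)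
      y₀ ht |>.congr_of_mem _ ht
    intro t' ht'
    nth_rw 1 [← hα]
    rw [ODE.FunSpace.compProj_of_mem ht', ODE.FunSpace.next_apply]

open Set Metric NNReal in
/-- The radial solutions of an integrable equation `dy = L(x, y)` depend differentiably on the ray:
`t ↦ Y_v(t) + t L(x₀ + t v, Y_v(t)) w` solves the equation of the ray `v + w` up to an error of
second order in `w`, by the integrability condition, so that Grönwall's inequality applies. -/
theorem radial_solution_sub_le {L : E × F → E →L[ℝ] F} {x₀ : E} {y₀ : F}
    {Ω : Set (E × F)} (hΩ : IsOpen Ω) (hL : ContDiffOn ℝ ∞ L Ω)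
    (hint : ∀ p ∈ Ω, ∀ v w : E, fderiv ℝ L p (v, L p v) w = fderiv ℝ L p (w, L p w) v)
    {ρ C : ℝ} (hρ : 0 < ρ) (hC : 1 ≤ C) (hsub : closedBall (x₀, y₀) ρ ⊆ Ω)
    (hb : ∀ p ∈ closedBall (x₀, y₀) ρ, ‖L p‖ ≤ C)
    (hb' : ∀ p ∈ closedBall (x₀, y₀) ρ, ‖fderiv ℝ L p‖ ≤ C)
    (hb'' : ∀ p ∈ closedBall (x₀, y₀) ρ, ∀ q ∈ closedBall (x₀, y₀) ρ,
        ‖L q - L p - fderiv ℝ L p (q - p)‖ ≤ C * ‖q - p‖ ^ 2)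
    (hlip : LipschitzOnWith C.toNNReal L (closedBall (x₀, y₀) ρ)) (v w : E)
    (hv : ‖v‖ ≤ ρ / (3 * C)) (hvw : ‖v + w‖ ≤ ρ / (3 * C)) {Y Z : ℝ → F}
    (hY0 : Y 0 = y₀) (hYm : ∀ t ∈ Icc (0 : ℝ) 1, ‖Y t - y₀‖ ≤ ρ / 3)
    (hY : ∀ t ∈ Icc (0 : ℝ) 1, HasDerivWithinAt Y (L (x₀ + t • v, Y t) v) (Icc 0 1) t)
    (hZ0 : Z 0 = y₀) (hZm : ∀ t ∈ Icc (0 : ℝ) 1, ‖Z t - y₀‖ ≤ ρ / 3)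
    (hZ : ∀ t ∈ Icc (0 : ℝ) 1,
      HasDerivWithinAt Z (L (x₀ + t • (v + w), Z t) (v + w)) (Icc 0 1) t) :
    ‖Z 1 - (Y 1 + L (x₀ + v, Y 1) w)‖ ≤
      gronwallBound 0 (C * ρ) ((C ^ 2 + C ^ 3 * ρ) * ‖w‖ ^ 2) 1 := by
  have hC0 : 0 < C := by linarith
  have hr : C * (ρ / (3 * C)) = ρ / 3 := by field_simp
  have hr' : ρ / (3 * C) ≤ ρ / 3 := by
    have : 0 < ρ / (3 * C) := by positivity
    nlinarith
  have hw : ‖w‖ ≤ 2 * (ρ / (3 * C)) := by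
    have : w = (v + w) - v := by abel
    calc ‖w‖ = ‖(v + w) - v‖ := by rw [← this]
      _ ≤ ‖v + w‖ + ‖v‖ := norm_sub_le _ _
      _ ≤ _ := by linarith
  have hmem : ∀ u : E, ‖u‖ ≤ ρ / (3 * C) → ∀ t ∈ Icc (0 : ℝ) 1, ∀ y : F, ‖y - y₀‖ ≤ ρ →
      (x₀ + t • u, y) ∈ closedBall (x₀, y₀) ρ := by
    intro u hu t ht y hy
    rw [← closedBall_prod_same]
    refine ⟨?_, by simpa [dist_eq_norm] using hy⟩
    simp only [mem_closedBall, dist_self_add_left, norm_smul, Real.norm_eq_abs, abs_of_nonneg ht.1]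
    nlinarith [norm_nonneg u, ht.2]
  have hpm : ∀ t ∈ Icc (0 : ℝ) 1, (x₀ + t • v, Y t) ∈ closedBall (x₀, y₀) ρ :=
    fun t ht ↦ hmem v hv t ht _ ((hYm t ht).trans (by linarith))
  -- the first-order prediction `G` for `Z`, and its derivative `G'`
  set G : ℝ → F := fun t ↦ Y t + t • L (x₀ + t • v, Y t) w with hG
  have hLw : ∀ t ∈ Icc (0 : ℝ) 1, ‖t • L (x₀ + t • v, Y t) w‖ ≤ C * ‖w‖ := by
    intro t ht
    rw [norm_smul, Real.norm_eq_abs, abs_of_nonneg ht.1]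
    calc t * ‖L (x₀ + t • v, Y t) w‖ ≤ 1 * (C * ‖w‖) := by
          gcongr
          · exact ht.2
          · exact (ContinuousLinearMap.le_opNorm _ _).trans (by gcongr; exact hb _ (hpm t ht))
      _ = _ := one_mul _
  have hGm : ∀ t ∈ Icc (0 : ℝ) 1, ‖G t - y₀‖ ≤ ρ := by
    intro t ht
    have : G t - y₀ = (Y t - y₀) + t • L (x₀ + t • v, Y t) w := by simp only [hG]; abel
    rw [this]
    refine (norm_add_le _ _).trans ?_
    have := hLw t ht
    have h2 : C * ‖w‖ ≤ 2 * (ρ / 3) := by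
      calc C * ‖w‖ ≤ C * (2 * (ρ / (3 * C))) := by gcongr
        _ = 2 * (ρ / 3) := by rw [← hr]; ring
    linarith [hYm t ht]
  set G' : ℝ → F := fun t ↦ L (x₀ + t • v, Y t) v +
    (t • (fderiv ℝ L (x₀ + t • v, Y t) (v, L (x₀ + t • v, Y t) v)) w +
      L (x₀ + t • v, Y t) w) with hG'
  have hGd : ∀ t ∈ Icc (0 : ℝ) 1, HasDerivWithinAt G (G' t) (Icc 0 1) t := by
    intro t ht
    have hLd : HasFDerivAt L (fderiv ℝ L (x₀ + t • v, Y t)) (x₀ + t • v, Y t) :=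
      ((hL.contDiffAt (hΩ.mem_nhds (hsub (hpm t ht)))).differentiableAt (by simp)).hasFDerivAt
    have hx : HasDerivWithinAt (fun s : ℝ ↦ x₀ + s • v) v (Icc 0 1) t := by
      simpa using ((hasDerivWithinAt_id t (Icc (0 : ℝ) 1)).smul_const v).const_add x₀
    have h1 := hLd.comp_hasDerivWithinAt t (hx.prodMk (hY t ht))
    have h2 : HasDerivWithinAt (fun s ↦ L (x₀ + s • v, Y s) w)
        ((fderiv ℝ L (x₀ + t • v, Y t) (v, L (x₀ + t • v, Y t) v)) w) (Icc 0 1) t := by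
      simpa using h1.clm_apply (hasDerivWithinAt_const t (Icc (0 : ℝ) 1) w)
    have h3 := (hY t ht).add ((hasDerivWithinAt_id t (Icc (0 : ℝ) 1)).smul h2)
    simpa [hG, hG', Function.comp_def] using! h3
  -- `G` solves the equation of the ray `v + w` up to second order in `w`; the two first-order terms
  -- `fderiv L (v, L v) w` and `fderiv L (w, L w) v` cancel by integrability
  have herr : ∀ t ∈ Icc (0 : ℝ) 1, ‖G' t - L (x₀ + t • (v + w), G t) (v + w)‖ ≤
      (C ^ 2 + C ^ 3 * ρ) * ‖w‖ ^ 2 := by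
    intro t ht
    set p : E × F := (x₀ + t • v, Y t) with hp
    set q : E × F := (x₀ + t • (v + w), G t) with hq
    have hqp : q - p = t • (w, L p w) := by
      ext
      · simp [hp, hq, smul_add]
      · simp [hp, hq, hG]
    have hqm : q ∈ closedBall (x₀, y₀) ρ := hmem _ hvw t ht _ (hGm t ht)
    have hn : ‖q - p‖ ≤ C * ‖w‖ := by
      rw [hqp, norm_smul, Real.norm_eq_abs, abs_of_nonneg ht.1, Prod.norm_def]
      have h1 : ‖L p w‖ ≤ C * ‖w‖ :=
        (ContinuousLinearMap.le_opNorm _ _).trans (by gcongr; exact hb _ (hpm t ht))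
      have h2 : ‖w‖ ≤ C * ‖w‖ := by nlinarith [norm_nonneg w]
      calc t * max ‖w‖ ‖L p w‖ ≤ 1 * (C * ‖w‖) := by
            gcongr
            · exact ht.2
            · exact max_le h2 h1
        _ = _ := one_mul _
    have hR := hb'' p (hpm t ht) q hqm
    set R : E →L[ℝ] F := L q - L p - fderiv ℝ L p (q - p) with hRdef
    have hdec : G' t - L q (v + w) = -(fderiv ℝ L p (q - p) w + R (v + w)) := by
      have hi := hint p (hsub (hpm t ht)) v w
      have e1 : fderiv ℝ L p (q - p) v = t • fderiv ℝ L p (v, L p v) w := by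
        rw [hqp, map_smul, smul_apply, hi]
      have e2 : R (v + w) = L q (v + w) - L p (v + w) - fderiv ℝ L p (q - p) (v + w) := by
        simp [hRdef]
      rw [e2, map_add (fderiv ℝ L p (q - p)), e1, map_add (L p)]
      simp only [hG']
      abel
    rw [hdec, norm_neg]
    have hw0 := norm_nonneg w
    have i1 : ‖fderiv ℝ L p (q - p) w‖ ≤ C ^ 2 * ‖w‖ ^ 2 := by
      calc ‖fderiv ℝ L p (q - p) w‖ ≤ ‖fderiv ℝ L p (q - p)‖ * ‖w‖ :=
            ContinuousLinearMap.le_opNorm _ _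
        _ ≤ (‖fderiv ℝ L p‖ * ‖q - p‖) * ‖w‖ := by
            gcongr; exact ContinuousLinearMap.le_opNorm _ _
        _ ≤ (C * (C * ‖w‖)) * ‖w‖ := by gcongr; exact hb' _ (hpm t ht)
        _ = _ := by ring
    have i2 : ‖R (v + w)‖ ≤ C ^ 3 * ρ * ‖w‖ ^ 2 := by
      calc ‖R (v + w)‖ ≤ ‖R‖ * ‖v + w‖ := ContinuousLinearMap.le_opNorm _ _
        _ ≤ (C * (C * ‖w‖) ^ 2) * ρ := by
            gcongr
            · exact hR.trans (by gcongr)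
            · linarith
        _ = _ := by ring
    calc _ ≤ _ := norm_add_le _ _
      _ ≤ _ := add_le_add i1 i2
      _ = _ := by ring
  have hici : ∀ {f : ℝ → F} {f' : F} {t : ℝ}, t ∈ Ico (0 : ℝ) 1 →
      HasDerivWithinAt f f' (Icc 0 1) t → HasDerivWithinAt f f' (Ici t) t := by
    intro f f' t ht h
    exact h.mono_of_mem_nhdsWithin (Icc_mem_nhdsGE_of_mem ht)
  have key := dist_le_of_approx_trajectories_ODE_of_mem (K := (C * ρ).toNNReal) (a := 0) (b := 1)
    (v := fun t y ↦ L (x₀ + t • (v + w), y) (v + w)) (s := fun _ ↦ closedBall y₀ ρ)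
    (f := Z) (g := G) (f' := fun t ↦ L (x₀ + t • (v + w), Z t) (v + w)) (g' := G')
    (εf := 0) (εg := (C ^ 2 + C ^ 3 * ρ) * ‖w‖ ^ 2) (δ := 0)
    (fun t ht ↦ ?_) (fun t ht ↦ (hZ t ht).continuousWithinAt)
    (fun t ht ↦ hici ht (hZ t (Ico_subset_Icc_self ht))) (fun t ht ↦ by simp)
    (fun t ht ↦ by
      simpa [dist_eq_norm] using (hZm t (Ico_subset_Icc_self ht)).trans (by linarith))
    (fun t ht ↦ (hGd t ht).continuousWithinAt)
    (fun t ht ↦ hici ht (hGd t (Ico_subset_Icc_self ht)))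
    (fun t ht ↦ by rw [dist_eq_norm]; exact herr t (Ico_subset_Icc_self ht))
    (fun t ht ↦ by simpa [dist_eq_norm] using hGm t (Ico_subset_Icc_self ht))
    (by simp [hZ0, hG, hY0]) 1 (by simp)
  · simpa [hG, dist_eq_norm, Real.coe_toNNReal _ (by positivity : 0 ≤ C * ρ)] using key
  · refine LipschitzOnWith.of_dist_le_mul fun y hy y' hy' ↦ ?_
    have ht' := Ico_subset_Icc_self ht
    have h1 := hlip.dist_le_mul _ (hmem _ hvw t ht' y (by simpa [dist_eq_norm] using hy)) _
      (hmem _ hvw t ht' y' (by simpa [dist_eq_norm] using hy'))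
    rw [Real.coe_toNNReal _ hC0.le, Prod.dist_eq, dist_self, max_eq_right dist_nonneg,
      dist_eq_norm] at h1
    rw [Real.coe_toNNReal _ (by positivity), dist_eq_norm, ← sub_apply]
    calc _ ≤ ‖L (x₀ + t • (v + w), y) - L (x₀ + t • (v + w), y')‖ * ‖v + w‖ :=
          ContinuousLinearMap.le_opNorm _ _
      _ ≤ C * dist y y' * ρ := by gcongr; linarith
      _ = _ := by ring

open Set Metric NNReal in
/-- **Frobenius theorem** for the total differential equation `dy = L(x, y)`: under the
integrability condition it has a solution through every point. The value of the solution at `x` is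
obtained by integrating along the ray from `x₀` to `x`. -/
theorem exists_hasFDerivAt_of_integrable [CompleteSpace F] {L : E × F → E →L[ℝ] F}
    {Ω : Set (E × F)} (hΩ : IsOpen Ω) (hL : ContDiffOn ℝ ∞ L Ω)
    (hint : ∀ p ∈ Ω, ∀ v w : E, fderiv ℝ L p (v, L p v) w = fderiv ℝ L p (w, L p w) v)
    {x₀ : E} {y₀ : F} (h₀ : (x₀, y₀) ∈ Ω) :
    ∃ r > (0 : ℝ), ∃ y : E → F, y x₀ = y₀ ∧ ContDiffOn ℝ ∞ y (ball x₀ r) ∧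
      ∀ x ∈ ball x₀ r, (x, y x) ∈ Ω ∧ HasFDerivAt y (L (x, y x)) x := by
  obtain ⟨ρ, hρ, C, hC, hsub, hb, hb', hb''⟩ := exists_closedBall_taylor_bound hΩ hL h₀
  have hC0 : 0 < C := by linarith
  have hlip : LipschitzOnWith C.toNNReal L (closedBall (x₀, y₀) ρ) := by
    refine (convex_closedBall _ _).lipschitzOnWith_of_nnnorm_fderiv_le (𝕜 := ℝ) (fun p hp ↦
      (hL.contDiffAt (hΩ.mem_nhds (hsub hp))).differentiableAt (by simp)) fun p hp ↦ ?_
    rw [← NNReal.coe_le_coe, Real.coe_toNNReal _ hC0.le]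
    exact hb' p hp
  -- rays of length at most `ρ / (3 C)` keep both the solutions and their first-order predictions
  -- inside the ball of radius `ρ`
  set r := ρ / (3 * C) with hr
  have hr0 : 0 < r := by positivity
  have hrρ : r ≤ ρ := by
    have : C * r = ρ / 3 := by rw [hr]; field_simp
    nlinarith
  have hex := fun (v : E) (hv : ‖v‖ ≤ r) ↦ exists_radial_solution hρ hC hb hlip v hv
  choose! Y hY0 hYm hY using hex
  have hball : ∀ x ∈ ball x₀ r, ‖x - x₀‖ ≤ r := fun x hx ↦ by
    rw [← dist_eq_norm]; exact (mem_ball.1 hx).le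
  have hder : ∀ x ∈ ball x₀ r, HasFDerivAt (fun x ↦ Y (x - x₀) 1) (L (x, Y (x - x₀) 1)) x := by
    intro x hx
    set c := gronwallBound 0 (C * ρ) 1 1 with hc
    have hcK : C * ρ ≠ 0 := by positivity
    have hlin : ∀ ε, gronwallBound 0 (C * ρ) ε 1 = c * ε := by
      intro ε
      rw [hc, gronwallBound_of_K_ne_0 hcK, gronwallBound_of_K_ne_0 hcK]
      ring
    rw [hasFDerivAt_iff_isLittleO_nhds_zero]
    have hbig : (fun w : E ↦ Y (x + w - x₀) 1 - Y (x - x₀) 1 - L (x, Y (x - x₀) 1) w) =O[𝓝 0]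
        fun w ↦ ‖w‖ ^ 2 := by
      refine Asymptotics.IsBigO.of_bound (c * (C ^ 2 + C ^ 3 * ρ)) ?_
      have hnear : ∀ᶠ w : E in 𝓝 0, x + w ∈ ball x₀ r :=
        ((by fun_prop : Continuous fun w : E ↦ x + w).tendsto' 0 x (by simp)).eventually
          (isOpen_ball.mem_nhds hx)
      filter_upwards [hnear] with w hw
      have e : x + w - x₀ = (x - x₀) + w := by abel
      have hv := hball x hx
      have hvw := hball _ hw
      rw [e] at hvw ⊢
      have h := radial_solution_sub_le hΩ hL hint hρ hC hsub hb hb' hb'' hlip (x - x₀) w hv hvw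
        (hY0 _ hv) (hYm _ hv) (hY _ hv) (hY0 _ hvw) (hYm _ hvw) (hY _ hvw)
      rw [hlin, add_sub_cancel] at h
      rw [sub_sub, norm_pow, norm_norm]
      refine h.trans (le_of_eq (by ring))
    exact hbig.trans_isLittleO
      (by simpa using! (Asymptotics.isLittleO_norm_pow_id (E' := E) one_lt_two))
  have hmem : ∀ x ∈ ball x₀ r, (x, Y (x - x₀) 1) ∈ Ω := fun x hx ↦ by
    refine hsub ?_
    rw [← closedBall_prod_same]
    refine ⟨?_, ?_⟩
    · rw [mem_closedBall]; exact (mem_ball.1 hx).le.trans hrρ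
    · rw [mem_closedBall, dist_eq_norm]
      exact (hYm _ (hball x hx) 1 (by simp)).trans (by linarith)
  refine ⟨r, hr0, fun x ↦ Y (x - x₀) 1, ?_, ?_, fun x hx ↦ ⟨hmem x hx, hder x hx⟩⟩
  · -- along the constant ray the right-hand side vanishes
    have h0 : ‖(0 : E)‖ ≤ r := by simpa using hr0.le
    have hc := constant_of_has_deriv_right_zero (f := Y 0) (a := 0) (b := 1)
      (fun t ht ↦ (hY 0 h0 t ht).continuousWithinAt)
      (fun t ht ↦ by
        have := (hY 0 h0 t (Ico_subset_Icc_self ht)).mono_of_mem_nhdsWithin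
          (Icc_mem_nhdsGE_of_mem ht)
        simpa using this) 1 (by simp)
    simp only [sub_self]
    rw [hc, hY0 0 h0]
  · -- the right-hand side is as smooth as the solution, which gains one derivative at each step
    rw [contDiffOn_infty]
    intro n
    induction n with
    | zero =>
      exact contDiffOn_zero.2 fun x hx ↦ (hder x hx).continuousAt.continuousWithinAt
    | succ n ih =>
      push_cast
      rw [contDiffOn_succ_iff_fderiv_of_isOpen isOpen_ball]
      refine ⟨fun x hx ↦ (hder x hx).differentiableAt.differentiableWithinAt, by simp, ?_⟩
      have h1 : ContDiffOn ℝ n (fun x ↦ L (x, Y (x - x₀) 1)) (ball x₀ r) :=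
        (hL.of_le (by exact_mod_cast le_top)).comp (contDiffOn_id.prodMk ih) hmem
      exact h1.congr fun x hx ↦ (hder x hx).fderiv

open Set in
/-- A continuous curve whose derivative vanishes off a finite set is constant. -/
theorem eq_of_hasDerivAt_zero_off_finite [CompleteSpace F] {f : ℝ → F} {a b : ℝ} (hab : a ≤ b)
    {S : Set ℝ} (hS : S.Finite) (hc : ContinuousOn f (Icc a b))
    (hd : ∀ t ∈ Ioo a b \ S, HasDerivAt f 0 t) : f a = f b := by
  have h := MeasureTheory.integral_eq_of_hasDerivAt_off_countable (f := f) (f' := fun _ ↦ 0)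
    (a := a) (b := b) hS.countable (by rwa [uIcc_of_le hab])
    (by rwa [min_eq_left hab, max_eq_right hab]) (by simp)
  simp only [intervalIntegral.integral_zero] at h
  exact (sub_eq_zero.1 h.symm).symm

end

section

/-! ### Ball-like sets and homotopy classes of paths -/

/-- An open set in a manifold that behaves like a ball: any two of its points are joined inside it
by a smooth path, and paths inside it with the same endpoints are homotopic. -/
structure IsBallLike (E : Type*) [NormedAddCommGroup E] [NormedSpace ℝ E]
    {N : Type*} [TopologicalSpace N] [ChartedSpace E N] (U : Set N) : Prop where
  isOpen : IsOpen U
  exists_path : ∀ y ∈ U, ∀ z ∈ U, ∃ γ : Path y z, (∀ t, γ t ∈ U) ∧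
    ∀ t ∈ Set.Ioo (0 : ℝ) 1, ContMDiffAt 𝓘(ℝ, ℝ) 𝓘(ℝ, E) ∞ γ.extend t
  homotopic : ∀ (y z : N) (γ γ' : Path y z), (∀ t, γ t ∈ U) → (∀ t, γ' t ∈ U) → γ.Homotopic γ'

section
variable {E : Type*} [NormedAddCommGroup E] [NormedSpace ℝ E]
    {N : Type*} [TopologicalSpace N] [ChartedSpace E N]

open Metric in
/-- Ball-like sets form a basis of neighbourhoods: the preimages of balls under charts are
ball-like, by linear interpolation in the chart. -/
theorem exists_isBallLike [IsManifold 𝓘(ℝ, E) ∞ N] {x : N} {W : Set N} (hW : W ∈ 𝓝 x) :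
    ∃ U : Set N, IsBallLike E U ∧ x ∈ U ∧ U ⊆ W := by
  set e := chartAt E x
  have hxs : x ∈ e.source := mem_chart_source E x
  have h1 : e.symm ⁻¹' W ∩ e.target ∈ 𝓝 (e x) := by
    refine Filter.inter_mem ?_ (e.open_target.mem_nhds (e.map_source hxs))
    exact (e.continuousAt_symm (e.map_source hxs)).preimage_mem_nhds (by rwa [e.left_inv hxs])
  obtain ⟨r, hr, hsub⟩ := Metric.nhds_basis_ball.mem_iff.1 h1
  have hUt : ∀ {y : E}, y ∈ ball (e x) r → y ∈ e.target := fun hy ↦ (hsub hy).2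
  have hconv : Convex ℝ (ball (e x) r) := convex_ball _ _
  have hseg : ∀ {a b : E} {s : ℝ}, a ∈ ball (e x) r → b ∈ ball (e x) r → 0 ≤ s → s ≤ 1 →
      a + s • (b - a) ∈ ball (e x) r := fun ha hb h0 h1 ↦
    hconv.add_smul_sub_mem ha hb ⟨h0, h1⟩
  have hback : ∀ {y : E}, y ∈ ball (e x) r → e.symm y ∈ e.source ∩ e ⁻¹' ball (e x) r := by
    intro y hy
    refine ⟨e.map_target (hUt hy), ?_⟩
    rw [Set.mem_preimage, e.right_inv (hUt hy)]
    exact hy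
  refine ⟨e.source ∩ e ⁻¹' ball (e x) r, ⟨e.isOpen_inter_preimage isOpen_ball, ?_, ?_⟩,
    ⟨hxs, mem_ball_self hr⟩, ?_⟩
  · intro y hy z hz
    have hc : Continuous fun t : unitInterval ↦ e y + (t : ℝ) • (e z - e y) := by fun_prop
    have hm : ∀ t : unitInterval, e y + (t : ℝ) • (e z - e y) ∈ ball (e x) r :=
      fun t ↦ hseg hy.2 hz.2 t.2.1 t.2.2
    refine ⟨⟨⟨fun t ↦ e.symm (e y + (t : ℝ) • (e z - e y)), ?_⟩, ?_, ?_⟩, fun t ↦ hback (hm t),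
      fun t ht ↦ ?_⟩
    · exact e.continuousOn_symm.comp_continuous hc fun t ↦ hUt (hm t)
    · simp [e.left_inv hy.1]
    · simp [e.left_inv hz.1]
    · have hloc : ContMDiffAt 𝓘(ℝ, ℝ) 𝓘(ℝ, E) ∞
          (fun t : ℝ ↦ e.symm (e y + t • (e z - e y))) t := by
        have h2 : ContMDiffAt 𝓘(ℝ, ℝ) 𝓘(ℝ, E) ∞ (fun t : ℝ ↦ e y + t • (e z - e y)) t :=
          (by fun_prop : ContDiff ℝ ∞ (fun t : ℝ ↦ e y + t • (e z - e y))).contMDiff t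
        have h3 : ContMDiffAt 𝓘(ℝ, E) 𝓘(ℝ, E) ∞ e.symm (e y + t • (e z - e y)) :=
          (contMDiffOn_chart_symm (I := 𝓘(ℝ, E)) (n := ∞) (x := x)).contMDiffAt
            (e.open_target.mem_nhds (hUt (hseg hy.2 hz.2 ht.1.le ht.2.le)))
        exact h3.comp t h2
      refine hloc.congr_of_eventuallyEq ?_
      filter_upwards [Ioo_mem_nhds ht.1 ht.2] with s hs
      rw [Path.extend_apply _ ⟨hs.1.le, hs.2.le⟩]
      rfl
  · intro y z γ γ' hγ hγ'
    have hm : ∀ p : unitInterval × unitInterval,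
        e (γ p.2) + (p.1 : ℝ) • (e (γ' p.2) - e (γ p.2)) ∈ ball (e x) r :=
      fun p ↦ hseg (hγ _).2 (hγ' _).2 p.1.2.1 p.1.2.2
    have hc1 : Continuous fun p : unitInterval × unitInterval ↦ e (γ p.2) :=
      e.continuousOn.comp_continuous (by fun_prop) fun p ↦ (hγ _).1
    have hc2 : Continuous fun p : unitInterval × unitInterval ↦ e (γ' p.2) :=
      e.continuousOn.comp_continuous (by fun_prop) fun p ↦ (hγ' _).1
    refine ⟨⟨⟨⟨fun p ↦ e.symm (e (γ p.2) + (p.1 : ℝ) • (e (γ' p.2) - e (γ p.2))), ?_⟩, ?_, ?_⟩,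
      ?_⟩⟩
    · exact e.continuousOn_symm.comp_continuous (hc1.add
        ((continuous_subtype_val.comp continuous_fst).smul (hc2.sub hc1))) fun p ↦ hUt (hm p)
    · intro t; simp [e.left_inv (hγ t).1]
    · intro t; simp [e.left_inv (hγ' t).1]
    · rintro t s (rfl | rfl)
      · simpa using e.left_inv (by simpa using (hγ 0).1)
      · simpa using e.left_inv (by simpa using (hγ 1).1)
  · rintro y ⟨hy, hy'⟩
    have := (hsub hy').1
    rwa [Set.mem_preimage, e.left_inv hy] at this

end

/-- A property of homotopy classes of paths that is stable under concatenation holds for all of them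
if it holds for the paths inside the members of an open cover. -/
theorem Path.Homotopic.Quotient.local_induction {X : Type*} [TopologicalSpace X]
    (P : ∀ x y : X, Path.Homotopic.Quotient x y → Prop)
    (htrans : ∀ (x y z : X) (a : Path.Homotopic.Quotient x y) (b : Path.Homotopic.Quotient y z),
      P x y a → P y z b → P x z (a.trans b))
    (hloc : ∀ x : X, ∃ U ∈ 𝓝 x, ∀ (y z : X) (γ : Path y z), (∀ t, γ t ∈ U) → P y z (.mk γ))
    {x y : X} (a : Path.Homotopic.Quotient x y) : P x y a := by
  obtain ⟨γ, rfl⟩ := Path.Homotopic.Quotient.mk_surjective a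
  choose U hU hUP using hloc
  -- subdivide the interval so that each piece of `γ` lies in one member of the cover
  obtain ⟨t, ht0, htm, ⟨n, hn⟩, ht⟩ := exists_monotone_Icc_subset_open_cover_unitInterval
    (c := fun z ↦ γ ⁻¹' interior (U z)) (fun z ↦ isOpen_interior.preimage γ.continuous)
    (fun s _ ↦ Set.mem_iUnion.2 ⟨γ s, mem_interior_iff_mem_nhds.2 (hU (γ s))⟩)
  have hstep : ∀ s s' z, s ≤ s' → Set.Icc s s' ⊆ γ ⁻¹' interior (U z) →
      P _ _ (.mk (γ.subpath s s')) := by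
    intro s s' z hs h
    refine hUP z _ _ _ fun u ↦ ?_
    have hu : γ.subpath s s' u ∈ γ '' Set.Icc s s' := by
      rw [← γ.range_subpath_of_le s s' hs]; exact ⟨u, rfl⟩
    obtain ⟨u', hu', e⟩ := hu
    rw [← e]
    exact interior_subset (h hu')
  have hind : ∀ m, P _ _ (.mk (γ.subpath (t 0) (t m))) := by
    intro m
    induction m with
    | zero =>
      obtain ⟨z, hz⟩ := ht 0
      exact hstep _ _ z le_rfl ((Set.Icc_subset_Icc_right (htm (Nat.zero_le 1))).trans hz)
    | succ m ih =>
      obtain ⟨z, hz⟩ := ht m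
      have h := htrans _ _ _ _ _ ih (hstep _ _ z (htm (Nat.le_succ m)) hz)
      rw [← Path.Homotopic.Quotient.mk_trans] at h
      rwa [Path.Homotopic.Quotient.eq.2
        ⟨Path.Homotopy.subpathTransSubpath γ (t 0) (t m) (t (m + 1))⟩] at h
  have h1 := hind n
  rw [ht0, hn n le_rfl, Path.subpath_zero_one] at h1
  have hcast : ∀ (x' y' : X) (hx : x' = x) (hy : y' = y), P x' y' (.mk (γ.cast hx hy)) →
      P x y (.mk γ) := by
    rintro _ _ rfl rfl h
    exact h
  exact hcast _ _ _ _ h1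

/-! ### Maps with vanishing derivative -/

section
variable {H₁ E₁ H₂ E₂ : Type*} [NormedAddCommGroup E₁] [NormedSpace ℝ E₁] [TopologicalSpace H₁]
  {I₁ : ModelWithCorners ℝ E₁ H₁} [I₁.Boundaryless]
  [NormedAddCommGroup E₂] [NormedSpace ℝ E₂] [TopologicalSpace H₂]
  {I₂ : ModelWithCorners ℝ E₂ H₂}
  {M₁ : Type*} [TopologicalSpace M₁] [ChartedSpace H₁ M₁] [IsManifold I₁ ∞ M₁]
  {M₂ : Type*} [TopologicalSpace M₂] [ChartedSpace H₂ M₂] [IsManifold I₂ ∞ M₂]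

open Metric in
/-- A map between manifolds with vanishing derivative is locally constant. -/
theorem eventually_eq_of_mfderiv_eq_zero {f : M₁ → M₂} {x : M₁}
    (h : ∀ᶠ y in 𝓝 x, MDifferentiableAt I₁ I₂ f y ∧ mfderiv I₁ I₂ f y = 0) :
    ∀ᶠ y in 𝓝 x, f y = f x := by
  have hf : ContinuousAt f x := h.self_of_nhds.1.continuousAt
  set e := extChartAt I₁ x
  set e' := extChartAt I₂ (f x)
  have hsrc : ∀ᶠ y in 𝓝 x, f y ∈ e'.source :=
    hf.preimage_mem_nhds (extChartAt_source_mem_nhds (I := I₂) (f x))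
  have hex : e.symm (e x) = x := extChartAt_to_inv x
  have hev : ∀ᶠ u in 𝓝 (e x), u ∈ e.target ∧ (MDifferentiableAt I₁ I₂ f (e.symm u) ∧
      mfderiv I₁ I₂ f (e.symm u) = 0) ∧ f (e.symm u) ∈ e'.source := by
    refine Filter.Eventually.and (extChartAt_target_mem_nhds x) ?_
    have hc := (continuousAt_extChartAt_symm (I := I₁) x).tendsto
    rw [extChartAt_to_inv] at hc
    exact hc.eventually (h.and hsrc)
  obtain ⟨r, hr, hball⟩ := Metric.eventually_nhds_iff_ball.1 hev
  have hder : ∀ u ∈ ball (e x) r, HasFDerivAt (fun u ↦ e' (f (e.symm u))) (0 : E₁ →L[ℝ] E₂) u := by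
    intro u hu
    obtain ⟨hut, ⟨hfd, hf0⟩, hfs⟩ := hball u hu
    have h1 : HasMFDerivAt 𝓘(ℝ, E₁) I₁ e.symm u (mfderiv 𝓘(ℝ, E₁) I₁ e.symm u) :=
      ((contMDiffOn_extChartAt_symm (I := I₁) (n := ∞) x).contMDiffAt
        ((isOpen_extChartAt_target x).mem_nhds hut) |>.mdifferentiableAt (by simp)).hasMFDerivAt
    have h2 : HasMFDerivAt I₁ I₂ f (e.symm u) 0 := by
      have := hfd.hasMFDerivAt
      rwa [hf0] at this
    have h3 : HasMFDerivAt I₂ 𝓘(ℝ, E₂) e' (f (e.symm u))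
        (mfderiv I₂ 𝓘(ℝ, E₂) e' (f (e.symm u))) :=
      ((contMDiffAt_extChartAt' (I := I₂) (n := ∞)
        (by rwa [extChartAt_source] at hfs)).mdifferentiableAt (by simp)).hasMFDerivAt
    have h4 : HasMFDerivAt 𝓘(ℝ, E₁) 𝓘(ℝ, E₂) (fun u ↦ e' (f (e.symm u))) u _ :=
      HasMFDerivAt.comp (g := e') (f := fun u ↦ f (e.symm u)) u h3
        (HasMFDerivAt.comp (g := f) (f := e.symm) u h2 h1)
    refine h4.hasFDerivAt.congr_fderiv ?_
    ext v
    exact map_zero (mfderiv I₂ 𝓘(ℝ, E₂) e' (f (e.symm u)))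
  have hconst : ∀ u ∈ ball (e x) r, e' (f (e.symm u)) = e' (f (e.symm (e x))) := by
    intro u hu
    exact (convex_ball (e x) r).is_const_of_fderivWithin_eq_zero (𝕜 := ℝ)
      (fun u hu ↦ (hder u hu).differentiableAt.differentiableWithinAt)
      (fun u hu ↦ by
        rw [fderivWithin_of_isOpen isOpen_ball hu]; exact (hder u hu).fderiv) hu (mem_ball_self hr)
  have hnear : ∀ᶠ y in 𝓝 x, e y ∈ ball (e x) r :=
    (continuousAt_extChartAt (I := I₁) x).preimage_mem_nhds (ball_mem_nhds _ hr)
  filter_upwards [hnear, extChartAt_source_mem_nhds (I := I₁) x, hsrc] with y hy hys hfy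
  have := hconst (e y) hy
  rw [hex, e.left_inv hys] at this
  exact e'.injOn hfy (mem_extChartAt_source _) this

/-- Along an interval that is mapped into one chart, a continuous curve whose velocity vanishes off
a finite set is constant. -/
theorem eq_of_mfderiv_eq_zero_off_finite [CompleteSpace E₂] {f : ℝ → M₂} {a b : ℝ} (hab : a ≤ b)
    {S : Set ℝ} (hS : S.Finite) (hc : ContinuousOn f (Set.Icc a b)) (p : M₂)
    (hp : ∀ t ∈ Set.Icc a b, f t ∈ (extChartAt I₂ p).source)
    (hd : ∀ t ∈ Set.Ioo a b \ S,
      MDifferentiableAt 𝓘(ℝ, ℝ) I₂ f t ∧ mfderiv 𝓘(ℝ, ℝ) I₂ f t = 0) : f a = f b := by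
  refine (extChartAt I₂ p).injOn (hp a ⟨le_rfl, hab⟩) (hp b ⟨hab, le_rfl⟩) ?_
  refine eq_of_hasDerivAt_zero_off_finite (f := fun t ↦ extChartAt I₂ p (f t)) hab hS
    ((continuousOn_extChartAt p).comp hc hp) fun t ht ↦ ?_
  obtain ⟨h1, h2⟩ := hd t ht
  have h3 := h1.hasMFDerivAt
  rw [h2] at h3
  have h4 : MDifferentiableAt I₂ 𝓘(ℝ, E₂) (extChartAt I₂ p) (f t) :=
    (contMDiffAt_extChartAt' (I := I₂) (n := ∞) (by
      have := hp t (Set.Ioo_subset_Icc_self ht.1)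
      rwa [extChartAt_source] at this)).mdifferentiableAt (by simp)
  have h5 : HasMFDerivAt 𝓘(ℝ, ℝ) 𝓘(ℝ, E₂) (fun t ↦ extChartAt I₂ p (f t)) t _ :=
    HasMFDerivAt.comp (g := extChartAt I₂ p) (f := f) t h4.hasMFDerivAt h3
  have h6 : HasFDerivAt (fun t ↦ extChartAt I₂ p (f t)) (0 : ℝ →L[ℝ] E₂) t := by
    refine h5.hasFDerivAt.congr_fderiv ?_
    ext
    exact map_zero (mfderiv I₂ 𝓘(ℝ, E₂) (extChartAt I₂ p) (f t))
  simpa using h6.hasDerivAt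
end

end

noncomputable section

/-! ### The Maurer–Cartan form and the adjoint action -/

/-- The chain rule in a form that does not mention the base point `f x` of the outer derivative:
the tangent spaces at `f x` and `y` are both the model space, so that no transport between them is
needed. -/
theorem mfderiv_comp_apply_of_apply_eq {E₁ E₂ E₃ H₁ H₂ H₃ : Type*}
    [NormedAddCommGroup E₁] [NormedSpace ℝ E₁] [TopologicalSpace H₁]
    [NormedAddCommGroup E₂] [NormedSpace ℝ E₂] [TopologicalSpace H₂]
    [NormedAddCommGroup E₃] [NormedSpace ℝ E₃] [TopologicalSpace H₃]
    {I₁ : ModelWithCorners ℝ E₁ H₁} {I₂ : ModelWithCorners ℝ E₂ H₂} {I₃ : ModelWithCorners ℝ E₃ H₃}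
    {M₁ M₂ M₃ : Type*} [TopologicalSpace M₁] [ChartedSpace H₁ M₁]
    [TopologicalSpace M₂] [ChartedSpace H₂ M₂] [TopologicalSpace M₃] [ChartedSpace H₃ M₃]
    {f : M₁ → M₂} {g : M₂ → M₃} {x : M₁} {y : M₂} (hy : f x = y)
    (hg : MDifferentiableAt I₂ I₃ g y) (hf : MDifferentiableAt I₁ I₂ f x) (X : E₁) :
    (mfderiv I₁ I₃ (fun z ↦ g (f z)) x X : E₃) = mfderiv I₂ I₃ g y (mfderiv I₁ I₂ f x X : E₂) := by
  subst hy
  exact DFunLike.congr_fun (mfderiv_comp x hg hf) X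

theorem adjointAction_zero {F : Type*} [NormedAddCommGroup F] [NormedSpace ℝ F]
    {G : Type*} [TopologicalSpace G] [ChartedSpace F G] [Group G] (g : G) :
    adjointAction F g (0 : GroupLieAlgebra 𝓘(ℝ, F) G) = 0 :=
  map_zero (mfderiv 𝓘(ℝ, F) 𝓘(ℝ, F) (fun h : G ↦ g * h * g⁻¹) 1)

section LieGroup
variable {F : Type*} [NormedAddCommGroup F] [NormedSpace ℝ F]
  {G : Type*} [TopologicalSpace G] [ChartedSpace F G] [Group G] [LieGroup 𝓘(ℝ, F) ∞ G]

theorem contMDiff_const_mul (c : G) : ContMDiff 𝓘(ℝ, F) 𝓘(ℝ, F) ∞ (fun h : G ↦ c * h) :=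
  contMDiff_mul_left

theorem mdifferentiableAt_const_mul (c g : G) :
    MDifferentiableAt 𝓘(ℝ, F) 𝓘(ℝ, F) (fun h : G ↦ c * h) g :=
  (contMDiff_const_mul c g).mdifferentiableAt (by simp)

variable (F) in
/-- The left Maurer–Cartan form `g⁻¹ dg` of a Lie group. -/
def maurerCartan (g : G) : TangentSpace 𝓘(ℝ, F) g →L[ℝ] GroupLieAlgebra 𝓘(ℝ, F) G :=
  mfderiv 𝓘(ℝ, F) 𝓘(ℝ, F) (fun h : G ↦ g⁻¹ * h) g

theorem maurerCartan_mfderiv_const_mul (c g : G) (ξ : TangentSpace 𝓘(ℝ, F) g) :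
    maurerCartan F (c * g) (mfderiv 𝓘(ℝ, F) 𝓘(ℝ, F) (fun h : G ↦ c * h) g ξ) =
      maurerCartan F g ξ := by
  have h := mfderiv_comp g (mdifferentiableAt_const_mul (F := F) (c * g)⁻¹ (c * g))
    (mdifferentiableAt_const_mul (F := F) c g)
  have e : (fun h : G ↦ (c * g)⁻¹ * h) ∘ (fun h : G ↦ c * h) = fun h ↦ g⁻¹ * h := by
    funext h; simp [mul_assoc]
  rw [e] at h
  exact (DFunLike.congr_fun h ξ).symm

theorem mfderiv_mul_maurerCartan (g : G) (ξ : TangentSpace 𝓘(ℝ, F) g) :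
    mfderiv 𝓘(ℝ, F) 𝓘(ℝ, F) (fun h : G ↦ g * h) 1 (maurerCartan F g ξ) = ξ := by
  have h := mfderiv_comp_apply_of_apply_eq (x := g) (y := 1) (by simp)
    (mdifferentiableAt_const_mul (F := F) g 1) (mdifferentiableAt_const_mul (F := F) g⁻¹ g) ξ
  have e : (fun h : G ↦ g * (g⁻¹ * h)) = id := by
    funext h; simp
  rw [e, mfderiv_id] at h
  exact h.symm

theorem maurerCartan_mfderiv_mul (g : G) (ξ : GroupLieAlgebra 𝓘(ℝ, F) G) :
    maurerCartan F g (mfderiv 𝓘(ℝ, F) 𝓘(ℝ, F) (fun h : G ↦ g * h) 1 ξ : F) = ξ := by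
  have h := mfderiv_comp_apply_of_apply_eq (x := (1 : G)) (y := g) (by simp)
    (mdifferentiableAt_const_mul (F := F) g⁻¹ g) (mdifferentiableAt_const_mul (F := F) g 1) ξ
  have e : (fun h : G ↦ g⁻¹ * (g * h)) = id := by
    funext h; simp
  rw [e, mfderiv_id] at h
  exact h.symm

theorem maurerCartan_eq_zero_iff (g : G) (ξ : TangentSpace 𝓘(ℝ, F) g) :
    maurerCartan F g ξ = 0 ↔ ξ = 0 := by
  refine ⟨fun h ↦ ?_, fun h ↦ by rw [h, map_zero]⟩
  have h1 := mfderiv_mul_maurerCartan g ξ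
  rw [h, map_zero] at h1
  exact h1.symm
end LieGroup

/-! ### Local sections and quotients of points of a principal bundle -/

namespace PrincipalBundle
variable {E F : Type*} [NormedAddCommGroup E] [NormedSpace ℝ E]
  [NormedAddCommGroup F] [NormedSpace ℝ F]
  {N : Type v} [TopologicalSpace N] [ChartedSpace E N]
  {G : Type w} [TopologicalSpace G] [ChartedSpace F G] [Group G]
  (P : PrincipalBundle E F N G)

/-- A local trivialization, as a local section `σ` together with the coordinate `κ` in `G` that it
determines by `q = σ(π(q)) κ(q)`. -/
theorem exists_localSection [LieGroup 𝓘(ℝ, F) ∞ G] (x : N) :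
    ∃ (U : Set N) (σ : N → P.Total) (κ : P.Total → G), IsOpen U ∧ x ∈ U ∧
      ContMDiffOn 𝓘(ℝ, E) (bundleModel E F) ∞ σ U ∧ (∀ y ∈ U, P.proj (σ y) = y) ∧
      ContMDiffOn (bundleModel E F) 𝓘(ℝ, F) ∞ κ (P.proj ⁻¹' U) ∧
      (∀ q, P.proj q ∈ U → P.act (σ (P.proj q)) (κ q) = q) ∧
      (∀ q g, P.proj q ∈ U → κ (P.act q g) = κ q * g) := by
  obtain ⟨U, e, hU, hx, hs, ht, he, he', he1, he2⟩ := P.locallyTrivial x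
  have hmem : ∀ y ∈ U, ∀ g : G, (y, g) ∈ e.target := fun y hy g ↦ by rw [ht]; exact ⟨hy, trivial⟩
  have hmem' : ∀ q, P.proj q ∈ U → q ∈ e.source := fun q hq ↦ by rw [hs]; exact hq
  have hproj : ∀ y ∈ U, P.proj (e.symm (y, 1)) = y := fun y hy ↦ by
    rw [← he1 _ (e.map_target (hmem y hy 1)), e.right_inv (hmem y hy 1)]
  refine ⟨U, fun y ↦ e.symm (y, 1), fun q ↦ (e q).2, hU, hx, ?_, hproj, ?_, fun q hq ↦ ?_,
    fun q g hq ↦ he2 q (hmem' q hq) g⟩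
  · exact he'.comp (contMDiffOn_id.prodMk contMDiffOn_const) fun y hy ↦ hmem y hy 1
  · rw [← hs]
    exact contMDiff_snd.comp_contMDiffOn he
  · have h1 : P.proj (P.act (e.symm (P.proj q, 1)) (e q).2) = P.proj q := by
      rw [P.proj_act, hproj _ hq]
    refine e.injOn (hmem' _ (by rw [h1]; exact hq)) (hmem' q hq) (Prod.ext ?_ ?_)
    · rw [he1 _ (hmem' _ (by rw [h1]; exact hq)), he1 _ (hmem' q hq), h1]
    · rw [he2 _ (e.map_target (hmem _ hq 1)), e.right_inv (hmem _ hq 1), one_mul]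

variable {P}

theorem act_right_injective [LieGroup 𝓘(ℝ, F) ∞ G] {q : P.Total} {g h : G}
    (e : P.act q g = P.act q h) : g = h := by
  obtain ⟨U, σ, κ, -, hx, -, -, -, -, hκ⟩ := P.exists_localSection (P.proj q)
  have := congrArg κ e
  rw [hκ q g hx, hκ q h hx] at this
  exact mul_left_cancel this

theorem exists_act_eq [LieGroup 𝓘(ℝ, F) ∞ G] {q q' : P.Total} (e : P.proj q = P.proj q') :
    ∃ g, P.act q g = q' := by
  obtain ⟨U, σ, κ, -, hx, -, -, -, hκ, -⟩ := P.exists_localSection (P.proj q)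
  refine ⟨(κ q)⁻¹ * κ q', ?_⟩
  have h1 := hκ q hx
  have h2 := hκ q' (e ▸ hx)
  rw [← e] at h2
  calc P.act q ((κ q)⁻¹ * κ q') = P.act (P.act (σ (P.proj q)) (κ q)) ((κ q)⁻¹ * κ q') := by rw [h1]
    _ = q' := by rw [← P.act_mul, mul_inv_cancel_left, h2]

theorem exists_proj_eq [LieGroup 𝓘(ℝ, F) ∞ G] (x : N) : ∃ q : P.Total, P.proj q = x := by
  obtain ⟨U, σ, κ, -, hx, -, hσ, -, -, -⟩ := P.exists_localSection x
  exact ⟨σ x, hσ x hx⟩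

open Classical in
/-- The element `g` with `q * g = q'`, for two points of one fibre; it is `1` for points of
different fibres. -/
def div (q q' : P.Total) : G := if h : ∃ g, P.act q g = q' then h.choose else 1

theorem act_div [LieGroup 𝓘(ℝ, F) ∞ G] {q q' : P.Total} (e : P.proj q = P.proj q') :
    P.act q (div q q') = q' := by
  have h := exists_act_eq e
  rw [div, dif_pos h]
  exact h.choose_spec

theorem div_eq [LieGroup 𝓘(ℝ, F) ∞ G] {q q' : P.Total} {g : G} (e : P.act q g = q') :
    div q q' = g :=
  act_right_injective ((act_div (by rw [← e, P.proj_act])).trans e.symm)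

theorem contMDiff_act_right (g : G) :
    ContMDiff (bundleModel E F) (bundleModel E F) ∞ (fun q : P.Total ↦ P.act q g) :=
  P.contMDiff_act.comp (contMDiff_id.prodMk contMDiff_const)

theorem contMDiff_act_left (q : P.Total) :
    ContMDiff 𝓘(ℝ, F) (bundleModel E F) ∞ (fun g : G ↦ P.act q g) :=
  P.contMDiff_act.comp (contMDiff_const.prodMk contMDiff_id)

section

variable {H₁ E₁ : Type*} [NormedAddCommGroup E₁] [NormedSpace ℝ E₁] [TopologicalSpace H₁]
  {I₁ : ModelWithCorners ℝ E₁ H₁} {M₁ : Type*} [TopologicalSpace M₁] [ChartedSpace H₁ M₁]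

theorem contMDiffAt_act {a : M₁ → P.Total} {k : M₁ → G} {m : M₁}
    (ha : ContMDiffAt I₁ (bundleModel E F) ∞ a m) (hk : ContMDiffAt I₁ 𝓘(ℝ, F) ∞ k m) :
    ContMDiffAt I₁ (bundleModel E F) ∞ (fun m ↦ P.act (a m) (k m)) m :=
  P.contMDiff_act.contMDiffAt.comp (g := fun p : P.Total × G ↦ P.act p.1 p.2)
    (f := fun m ↦ (a m, k m)) m (ha.prodMk hk)

theorem contMDiffAt_div [LieGroup 𝓘(ℝ, F) ∞ G] {a b : M₁ → P.Total} {m : M₁}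
    (ha : ContMDiffAt I₁ (bundleModel E F) ∞ a m) (hb : ContMDiffAt I₁ (bundleModel E F) ∞ b m)
    (hab : ∀ᶠ m' in 𝓝 m, P.proj (a m') = P.proj (b m')) :
    ContMDiffAt I₁ 𝓘(ℝ, F) ∞ (fun m ↦ div (a m) (b m)) m := by
  obtain ⟨U, σ, κ, hU, hx, -, -, hκs, hκ, hκ'⟩ := P.exists_localSection (P.proj (a m))
  have hV : IsOpen (P.proj ⁻¹' U) := hU.preimage P.contMDiff_proj.continuous
  have hb' : P.proj (b m) ∈ U := by rw [← hab.self_of_nhds]; exact hx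
  have h1 : ContMDiffAt I₁ 𝓘(ℝ, F) ∞ (fun m ↦ κ (a m)) m :=
    (hκs.contMDiffAt (hV.mem_nhds hx)).comp m ha
  have h2 : ContMDiffAt I₁ 𝓘(ℝ, F) ∞ (fun m ↦ κ (b m)) m :=
    (hκs.contMDiffAt (hV.mem_nhds hb')).comp m hb
  refine (h1.inv.mul h2).congr_of_eventuallyEq ?_
  filter_upwards [hab, ha.continuousAt.preimage_mem_nhds (hV.mem_nhds hx)] with m' hm' hm''
  have h3 := congrArg κ (act_div hm')
  rw [hκ' _ _ hm''] at h3
  change _ = (κ (a m'))⁻¹ * κ (b m')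
  rw [← h3, inv_mul_cancel_left]
end
end PrincipalBundle

/-! ### The connection form and the action of the group -/

namespace PrincipalConnection
open PrincipalBundle
variable {E F : Type*} [NormedAddCommGroup E] [NormedSpace ℝ E]
  [NormedAddCommGroup F] [NormedSpace ℝ F]
  {N : Type v} [TopologicalSpace N] [ChartedSpace E N]
  {G : Type w} [TopologicalSpace G] [ChartedSpace F G] [Group G]
  {P : PrincipalBundle E F N G} (A : PrincipalConnection P)

theorem form_congr {q q' : P.Total} (h : q = q') (X : E × F) :
    (A.form q X : F) = A.form q' X := by
  subst h; rfl

variable [LieGroup 𝓘(ℝ, F) ∞ G]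

/-- Along an orbit of the action, the connection form is the Maurer–Cartan form. -/
theorem form_mfderiv_act_left (q : P.Total) (k : G) (ξ : TangentSpace 𝓘(ℝ, F) k) :
    A.form (P.act q k) (mfderiv 𝓘(ℝ, F) (bundleModel E F) (fun g : G ↦ P.act q g) k ξ) =
      maurerCartan F k ξ := by
  have h' := mfderiv_comp_apply_of_apply_eq (x := k) (y := 1) (by simp)
    (((contMDiff_act_left (P.act q k)) 1).mdifferentiableAt (by simp))
    (mdifferentiableAt_const_mul (F := F) k⁻¹ k) ξ
  have e : (fun h : G ↦ P.act (P.act q k) (k⁻¹ * h)) = fun g ↦ P.act q g := by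
    funext h; simp [← P.act_mul]
  rw [e] at h'
  have h2 := A.form_vertical (P.act q k) (maurerCartan F k ξ)
  refine Eq.trans ?_ h2
  refine Eq.trans ?_ (A.form_congr (P.act_one _).symm _)
  exact congrArg (A.form (P.act q k)) h'

variable {H₁ E₁ : Type*} [NormedAddCommGroup E₁] [NormedSpace ℝ E₁] [TopologicalSpace H₁]
  {I₁ : ModelWithCorners ℝ E₁ H₁} {M₁ : Type*} [TopologicalSpace M₁] [ChartedSpace H₁ M₁]

/-- The Leibniz rule `A(d(a k)) = Ad_{k⁻¹} A(da) + k⁻¹ dk` for a connection form `A`. -/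
theorem form_mfderiv_act {a : M₁ → P.Total} {k : M₁ → G} {m : M₁}
    (ha : MDifferentiableAt I₁ (bundleModel E F) a m) (hk : MDifferentiableAt I₁ 𝓘(ℝ, F) k m)
    (X : TangentSpace I₁ m) :
    A.form (P.act (a m) (k m)) (mfderiv I₁ (bundleModel E F) (fun m ↦ P.act (a m) (k m)) m X) =
      adjointAction F (k m)⁻¹ (A.form (a m) (mfderiv I₁ (bundleModel E F) a m X)) +
        maurerCartan F (k m) (mfderiv I₁ 𝓘(ℝ, F) k m X) := by
  have hact : MDifferentiableAt ((bundleModel E F).prod 𝓘(ℝ, F)) (bundleModel E F)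
      (fun p : P.Total × G ↦ P.act p.1 p.2) (a m, k m) :=
    (P.contMDiff_act _).mdifferentiableAt (by simp)
  have h := mfderiv_comp m (g := fun p : P.Total × G ↦ P.act p.1 p.2) (f := fun m ↦ (a m, k m))
    hact (ha.prodMk hk)
  have h1 := DFunLike.congr_fun h X
  rw [mfderiv_prodMk ha hk] at h1
  have h2 := mfderiv_prod_eq_add_apply
    (v := ((mfderiv I₁ (bundleModel E F) a m X, mfderiv I₁ 𝓘(ℝ, F) k m X) : (E × F) × F)) hact
  have h3 := congrArg (A.form (P.act (a m) (k m))) (h1.trans h2)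
  refine h3.trans ?_
  refine (map_add (A.form (P.act (a m) (k m))) _ _).trans ?_
  exact congrArg₂ (· + ·) (A.form_act _ _ _) (A.form_mfderiv_act_left _ _ _)

end PrincipalConnection
end

noncomputable section

/-! ### Flat sections -/

namespace PrincipalConnection
open PrincipalBundle
variable {E F : Type*} [NormedAddCommGroup E] [NormedSpace ℝ E]
  [NormedAddCommGroup F] [NormedSpace ℝ F]
  {N : Type v} [TopologicalSpace N] [ChartedSpace E N]
  {G : Type w} [TopologicalSpace G] [ChartedSpace F G] [Group G]
  {P : PrincipalBundle E F N G} (A : PrincipalConnection P)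

/-- A smooth section over an open set that is horizontal for the connection. -/
structure IsFlatSection (U : Set N) (s : N → P.Total) : Prop where
  isOpen : IsOpen U
  contMDiffOn : ContMDiffOn 𝓘(ℝ, E) (bundleModel E F) ∞ s U
  proj_eq : ∀ y ∈ U, P.proj (s y) = y
  form_eq_zero : ∀ y ∈ U, ∀ v : TangentSpace 𝓘(ℝ, E) y,
    A.form (s y) (mfderiv 𝓘(ℝ, E) (bundleModel E F) s y v) = 0

/-- Through every point of the total space passes a flat local section. -/
def HasFlatSections : Prop :=
  ∀ q : P.Total, ∃ (U : Set N) (s : N → P.Total), A.IsFlatSection U s ∧ P.proj q ∈ U ∧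
    s (P.proj q) = q

variable {A}

namespace IsFlatSection
variable {U U' : Set N} {s s' : N → P.Total}

theorem contMDiffAt (h : A.IsFlatSection U s) {y : N} (hy : y ∈ U) :
    ContMDiffAt 𝓘(ℝ, E) (bundleModel E F) ∞ s y :=
  h.contMDiffOn.contMDiffAt (h.isOpen.mem_nhds hy)

theorem mdifferentiableAt (h : A.IsFlatSection U s) {y : N} (hy : y ∈ U) :
    MDifferentiableAt 𝓘(ℝ, E) (bundleModel E F) s y :=
  (h.contMDiffAt hy).mdifferentiableAt (by simp)

theorem mono (h : A.IsFlatSection U s) (hU' : IsOpen U') (hsub : U' ⊆ U) :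
    A.IsFlatSection U' s :=
  ⟨hU', h.contMDiffOn.mono hsub, fun y hy ↦ h.proj_eq y (hsub hy),
    fun y hy ↦ h.form_eq_zero y (hsub hy)⟩

variable [LieGroup 𝓘(ℝ, F) ∞ G]

theorem act (h : A.IsFlatSection U s) (g : G) : A.IsFlatSection U (fun y ↦ P.act (s y) g) := by
  refine ⟨h.isOpen, fun y hy ↦ ?_, fun y hy ↦ by rw [P.proj_act, h.proj_eq y hy],
    fun y hy v ↦ ?_⟩
  · exact (contMDiff_act_right g).contMDiffAt.comp_contMDiffWithinAt y (h.contMDiffOn y hy)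
  · have := A.form_mfderiv_act (h.mdifferentiableAt hy) (mdifferentiableAt_const (c := g)) v
    refine this.trans ?_
    rw [h.form_eq_zero y hy, adjointAction_zero, zero_add, mfderiv_const]
    exact map_zero (maurerCartan F g)

/-- In the trivialization given by a flat section, the connection is the Maurer–Cartan form. -/
theorem form_eq (h : A.IsFlatSection U s) {q : P.Total} (hq : P.proj q ∈ U)
    (X : TangentSpace (bundleModel E F) q) :
    A.form q X = maurerCartan F (div (s (P.proj q)) q)
      (mfderiv (bundleModel E F) 𝓘(ℝ, F) (fun p ↦ div (s (P.proj p)) p) q X) := by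
  have hnear : ∀ᶠ p in 𝓝 q, P.proj p ∈ U :=
    P.contMDiff_proj.continuous.continuousAt.preimage_mem_nhds (h.isOpen.mem_nhds hq)
  have hs : ContMDiffAt (bundleModel E F) (bundleModel E F) ∞ (fun p ↦ s (P.proj p)) q :=
    (h.contMDiffAt hq).comp q P.contMDiff_proj.contMDiffAt
  have hk : ContMDiffAt (bundleModel E F) 𝓘(ℝ, F) ∞ (fun p ↦ div (s (P.proj p)) p) q := by
    refine contMDiffAt_div hs contMDiffAt_id ?_
    filter_upwards [hnear] with p hp
    exact h.proj_eq _ hp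
  have h1 := A.form_mfderiv_act (hs.mdifferentiableAt (by simp)) (hk.mdifferentiableAt (by simp)) X
  have hid : (fun p ↦ P.act (s (P.proj p)) (div (s (P.proj p)) p)) =ᶠ[𝓝 q] id := by
    filter_upwards [hnear] with p hp
    exact act_div (h.proj_eq _ hp)
  have h2 : (mfderiv (bundleModel E F) (bundleModel E F)
      (fun p ↦ P.act (s (P.proj p)) (div (s (P.proj p)) p)) q X : E × F) = X := by
    have := hid.mfderiv_eq (I := bundleModel E F) (I' := bundleModel E F)
    rw [mfderiv_id] at this
    exact DFunLike.congr_fun this X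
  have h3 : A.form (s (P.proj q))
      (mfderiv (bundleModel E F) (bundleModel E F) (fun p ↦ s (P.proj p)) q X) = 0 := by
    have := mfderiv_comp_apply_of_apply_eq rfl (h.mdifferentiableAt hq)
      (P.contMDiff_proj.mdifferentiableAt (x := q) (by simp)) X
    exact (congrArg (A.form (s (P.proj q))) this).trans (h.form_eq_zero _ hq _)
  rw [h3, adjointAction_zero, zero_add] at h1
  rw [← h1]
  refine (A.form_congr (act_div (h.proj_eq _ hq)).symm X).trans ?_
  exact congrArg (A.form _) h2.symm

/-- The quotient of two flat sections has vanishing derivative, by the Leibniz rule for the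
connection form. -/
theorem mfderiv_div_eq_zero (h : A.IsFlatSection U s) (h' : A.IsFlatSection U' s') {y : N}
    (hy : y ∈ U) (hy' : y ∈ U') :
    MDifferentiableAt 𝓘(ℝ, E) 𝓘(ℝ, F) (fun z ↦ div (s z) (s' z)) y ∧
      mfderiv 𝓘(ℝ, E) 𝓘(ℝ, F) (fun z ↦ div (s z) (s' z)) y = 0 := by
  have hnear : ∀ᶠ z in 𝓝 y, P.proj (s z) = P.proj (s' z) := by
    filter_upwards [h.isOpen.mem_nhds hy, h'.isOpen.mem_nhds hy'] with z hz hz'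
    rw [h.proj_eq z hz, h'.proj_eq z hz']
  have hk : MDifferentiableAt 𝓘(ℝ, E) 𝓘(ℝ, F) (fun z ↦ div (s z) (s' z)) y :=
    (contMDiffAt_div (h.contMDiffAt hy) (h'.contMDiffAt hy') hnear).mdifferentiableAt (by simp)
  refine ⟨hk, ?_⟩
  ext v
  have h1 := A.form_mfderiv_act (h.mdifferentiableAt hy) hk v
  have hid : (fun z ↦ P.act (s z) (div (s z) (s' z))) =ᶠ[𝓝 y] s' := by
    filter_upwards [hnear] with z hz
    exact act_div hz
  have h2 : (mfderiv 𝓘(ℝ, E) (bundleModel E F) (fun z ↦ P.act (s z) (div (s z) (s' z))) y v : E × F)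
      = mfderiv 𝓘(ℝ, E) (bundleModel E F) s' y v :=
    DFunLike.congr_fun (hid.mfderiv_eq (I := 𝓘(ℝ, E)) (I' := bundleModel E F)) v
  have h3 : A.form (P.act (s y) (div (s y) (s' y)))
      (mfderiv 𝓘(ℝ, E) (bundleModel E F) (fun z ↦ P.act (s z) (div (s z) (s' z))) y v) = 0 := by
    refine (A.form_congr (act_div hnear.self_of_nhds) _).trans ?_
    exact (congrArg (A.form (s' y)) h2).trans (h'.form_eq_zero y hy' v)
  rw [h3, h.form_eq_zero y hy, adjointAction_zero, zero_add] at h1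
  exact (maurerCartan_eq_zero_iff _ _).1 h1.symm

/-- Two flat sections that agree at a point agree nearby. -/
theorem eventually_eq [IsManifold 𝓘(ℝ, E) ∞ N] (h : A.IsFlatSection U s)
    (h' : A.IsFlatSection U' s') {y : N}
    (hy : y ∈ U) (hy' : y ∈ U') (e : s y = s' y) : ∀ᶠ z in 𝓝 y, s z = s' z := by
  have : IsManifold 𝓘(ℝ, F) ∞ G := inferInstance
  have hU : ∀ᶠ z in 𝓝 y, z ∈ U := h.isOpen.mem_nhds hy
  have hU' : ∀ᶠ z in 𝓝 y, z ∈ U' := h'.isOpen.mem_nhds hy'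
  have h1 := eventually_eq_of_mfderiv_eq_zero (I₁ := 𝓘(ℝ, E)) (I₂ := 𝓘(ℝ, F))
    (f := fun z ↦ div (s z) (s' z)) (x := y) (by
      filter_upwards [hU, hU'] with z hz hz'
      exact h.mfderiv_div_eq_zero h' hz hz')
  filter_upwards [h1, hU, hU'] with z hz hzU hzU'
  have h2 : div (s y) (s' y) = 1 := div_eq (by rw [P.act_one, e])
  rw [h2] at hz
  have h3 := act_div (q := s z) (q' := s' z) (by rw [h.proj_eq z hzU, h'.proj_eq z hzU'])
  rw [hz, P.act_one] at h3
  exact h3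

end IsFlatSection

/-! ### The leaf topology -/

/-- The total space with the topology of the leaves of a flat connection, the finest topology for
which all flat local sections are continuous. -/
@[ext]
structure Leaf (A : PrincipalConnection P) where
  /-- The underlying point of the total space. -/
  pt : P.Total

instance : TopologicalSpace (Leaf A) where
  IsOpen O := ∀ (U : Set N) (s : N → P.Total), A.IsFlatSection U s →
    IsOpen (U ∩ {y | Leaf.mk (s y) ∈ O})
  isOpen_univ U s h := by simpa using! h.isOpen
  isOpen_inter O O' hO hO' U s h := by
    have := (hO U s h).inter (hO' U s h)
    rwa [← Set.inter_inter_distrib_left] at this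
  isOpen_sUnion S hS U s h := by
    have : U ∩ {y | Leaf.mk (s y) ∈ ⋃₀ S} = ⋃ t ∈ S, U ∩ {y | Leaf.mk (s y) ∈ t} := by
      ext y; simp
    rw [this]
    exact isOpen_biUnion fun t ht ↦ hS t ht U s h

theorem isOpen_leaf_iff {O : Set (Leaf A)} : IsOpen O ↔
    ∀ (U : Set N) (s : N → P.Total), A.IsFlatSection U s →
      IsOpen (U ∩ {y | Leaf.mk (s y) ∈ O}) := Iff.rfl

variable (A) in
/-- The projection of the total space with the leaf topology. -/
def leafProj (q : Leaf A) : N := P.proj q.pt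

theorem IsFlatSection.continuousOn_leaf {U : Set N} {s : N → P.Total}
    (h : A.IsFlatSection U s) : ContinuousOn (fun y ↦ (Leaf.mk (s y) : Leaf A)) U :=
  (continuousOn_open_iff h.isOpen).2 fun _ hO ↦ isOpen_leaf_iff.1 hO U s h

theorem continuous_leafProj : Continuous (leafProj A) := by
  refine continuous_def.2 fun V hV ↦ isOpen_leaf_iff.2 fun U s h ↦ ?_
  have : U ∩ {y | Leaf.mk (s y) ∈ leafProj A ⁻¹' V} = U ∩ V := by
    ext y
    refine and_congr_right fun hy ↦ ?_
    change P.proj (s y) ∈ V ↔ _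
    rw [h.proj_eq y hy]
  rw [this]
  exact h.isOpen.inter hV

/-- A map from the leaf topology is continuous if its composition with all flat sections is. -/
theorem continuous_leaf {Y : Type*} [TopologicalSpace Y] {f : Leaf A → Y}
    (hf : ∀ (U : Set N) (s : N → P.Total), A.IsFlatSection U s →
      ContinuousOn (fun y ↦ f (Leaf.mk (s y))) U) : Continuous f :=
  continuous_def.2 fun O hO ↦ isOpen_leaf_iff.2 fun U s h ↦
    (continuousOn_open_iff h.isOpen).1 (hf U s h) O hO

/-- A copy of a type with the discrete topology; for `X = G` it is the fibre of the covering by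
leaves. -/
@[ext]
structure DiscreteCopy (X : Type*) where
  /-- The underlying element. -/
  val : X

instance (X : Type*) : TopologicalSpace (DiscreteCopy X) := ⊥
instance (X : Type*) : DiscreteTopology (DiscreteCopy X) := ⟨rfl⟩

variable [LieGroup 𝓘(ℝ, F) ∞ G] [IsManifold 𝓘(ℝ, E) ∞ N]

/-- A flat section `s` over `U` trivializes the total space with the leaf topology over `U`, with
discrete fibre `G`. -/
def IsFlatSection.leafTrivialization {U : Set N} {s : N → P.Total} (h : A.IsFlatSection U s) :
    Bundle.Trivialization (DiscreteCopy G) (leafProj A) where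
  toFun q := (leafProj A q, ⟨div (s (P.proj q.pt)) q.pt⟩)
  invFun p := ⟨P.act (s p.1) p.2.val⟩
  source := leafProj A ⁻¹' U
  target := U ×ˢ Set.univ
  map_source' q hq := ⟨hq, trivial⟩
  map_target' p hp := by
    change P.proj (P.act (s p.1) p.2.val) ∈ U
    rw [P.proj_act, h.proj_eq _ hp.1]
    exact hp.1
  left_inv' q hq := Leaf.ext (act_div (h.proj_eq _ hq))
  right_inv' p hp := by
    have h1 : P.proj (P.act (s p.1) p.2.val) = p.1 := by rw [P.proj_act, h.proj_eq _ hp.1]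
    refine Prod.ext h1 (DiscreteCopy.ext ?_)
    change div (s (P.proj (P.act (s p.1) p.2.val))) (P.act (s p.1) p.2.val) = _
    rw [h1]
    exact div_eq rfl
  open_source := h.isOpen.preimage continuous_leafProj
  open_target := h.isOpen.prod isOpen_univ
  continuousOn_toFun := by
    refine continuous_leafProj.continuousOn.prodMk fun q hq ↦ ?_
    refine ContinuousWithinAt.congr_of_eventuallyEq
      (f := fun _ ↦ (⟨div (s (P.proj q.pt)) q.pt⟩ : DiscreteCopy G)) continuousWithinAt_const ?_ rfl
    -- the translate of `s` through `q` is open in the leaf topology, since flat sections that agree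
    -- at a point agree nearby
    have hop : IsOpen {p : Leaf A | leafProj A p ∈ U ∧
        P.act (s (P.proj p.pt)) (div (s (P.proj q.pt)) q.pt) = p.pt} := by
      refine isOpen_leaf_iff.2 fun U' s' h' ↦ isOpen_iff_mem_nhds.2 ?_
      rintro y ⟨hy, hy'⟩
      have hyU : y ∈ U := by
        have := hy'.1
        change P.proj (s' y) ∈ U at this
        rwa [h'.proj_eq y hy] at this
      have hye : P.act (s y) (div (s (P.proj q.pt)) q.pt) = s' y := by
        have := hy'.2
        rwa [h'.proj_eq y hy] at this
      filter_upwards [(h.act _).eventually_eq h' hyU hy hye, h.isOpen.mem_nhds hyU,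
        h'.isOpen.mem_nhds hy] with z hz hzU hzU'
      refine ⟨hzU', ?_, ?_⟩
      · change P.proj (s' z) ∈ U
        rwa [h'.proj_eq z hzU']
      · rwa [h'.proj_eq z hzU']
    have hmem := hop.mem_nhds (show q ∈ _ from ⟨hq, act_div (h.proj_eq _ hq)⟩)
    filter_upwards [mem_nhdsWithin_of_mem_nhds hmem] with p hp
    exact DiscreteCopy.ext (div_eq hp.2)
  continuousOn_invFun := by
    rw [continuousOn_prod_of_discrete_right]
    intro k
    simpa using! (h.act k.val).continuousOn_leaf
  baseSet := U
  open_baseSet := h.isOpen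
  source_eq := rfl
  target_eq := rfl
  proj_toFun q hq := rfl

/-- For a flat connection, the total space with the leaf topology is a covering space. -/
theorem HasFlatSections.isCoveringMap (h : A.HasFlatSections) : IsCoveringMap (leafProj A) := by
  have hx : ∀ x : N, ∃ (U : Set N) (s : N → P.Total), A.IsFlatSection U s ∧ x ∈ U := by
    intro x
    obtain ⟨q, rfl⟩ := P.exists_proj_eq x
    obtain ⟨U, s, hs, hq, -⟩ := h q
    exact ⟨U, s, hs, hq⟩
  choose U s hs hU using hx
  exact IsCoveringMap.mk _ (fun _ ↦ DiscreteCopy G) (fun x ↦ (hs x).leafTrivialization) hU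

end PrincipalConnection
end

noncomputable section

/-! ### Flat connections have flat sections -/

namespace PrincipalConnection
open PrincipalBundle
variable {E F : Type*} [NormedAddCommGroup E] [NormedSpace ℝ E]
  [NormedAddCommGroup F] [NormedSpace ℝ F]
  {N : Type v} [TopologicalSpace N] [ChartedSpace E N]
  {G : Type w} [TopologicalSpace G] [ChartedSpace F G] [Group G]
  {P : PrincipalBundle E F N G} (A : PrincipalConnection P)

/-- A local parametrization `Φ` of the total space near a point, with inverse `Ψ`, that is adapted
to the projection to the base and for which the connection form is injective on the vertical
directions. -/
structure AdaptedParametrization (q : P.Total) where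
  /-- The domain in `E × F`. -/
  D : Set (E × F)
  /-- The image in the total space. -/
  W : Set P.Total
  /-- The parametrization. -/
  Φ : E × F → P.Total
  /-- Its inverse. -/
  Ψ : P.Total → E × F
  isOpen_D : IsOpen D
  isOpen_W : IsOpen W
  mem_W : q ∈ W
  mapsTo_Φ : ∀ u ∈ D, Φ u ∈ W
  mapsTo_Ψ : ∀ p ∈ W, Ψ p ∈ D
  left_inv : ∀ u ∈ D, Ψ (Φ u) = u
  right_inv : ∀ p ∈ W, Φ (Ψ p) = p
  contMDiffOn_Φ : ContMDiffOn 𝓘(ℝ, E × F) (bundleModel E F) ∞ Φ D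
  contMDiffOn_Ψ : ContMDiffOn (bundleModel E F) 𝓘(ℝ, E × F) ∞ Ψ W
  proj_Φ : ∀ u ∈ D, P.proj (Φ u) = (extChartAt 𝓘(ℝ, E) (P.proj q)).symm u.1
  Ψ_fst : ∀ p ∈ W, (Ψ p).1 = extChartAt 𝓘(ℝ, E) (P.proj q) (P.proj p)
  form_injective : ∀ u ∈ D, ∀ w : F, A.form (Φ u)
    (mfderiv 𝓘(ℝ, E × F) (bundleModel E F) Φ u ((0, w) : E × F)) = 0 → w = 0

/-- Adapted parametrizations exist: charts of `N` and of `G` are combined by means of the action on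
a local section. -/
theorem exists_adaptedParametrization [IsManifold 𝓘(ℝ, E) ∞ N] [LieGroup 𝓘(ℝ, F) ∞ G]
    (q : P.Total) : Nonempty (A.AdaptedParametrization q) := by
  have : IsManifold 𝓘(ℝ, F) ∞ G := inferInstance
  obtain ⟨U, σ₀, κ, hU, hx, hσ₀, hσ₀', -, hκ, -⟩ := P.exists_localSection (P.proj q)
  set σ : N → P.Total := fun y ↦ P.act (σ₀ y) (κ q) with hσdef
  have hσq : σ (P.proj q) = q := hκ q hx
  have hσ : ∀ y ∈ U, ContMDiffAt 𝓘(ℝ, E) (bundleModel E F) ∞ σ y := fun y hy ↦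
    contMDiffAt_act (hσ₀.contMDiffAt (hU.mem_nhds hy)) contMDiffAt_const
  have hσ' : ∀ y ∈ U, P.proj (σ y) = y := fun y hy ↦ by rw [hσdef, P.proj_act, hσ₀' y hy]
  set ψ := extChartAt 𝓘(ℝ, E) (P.proj q) with hψ
  set χ := extChartAt 𝓘(ℝ, F) (1 : G) with hχ
  have hψt : IsOpen ψ.target := isOpen_extChartAt_target _
  have hψs : IsOpen ψ.source := isOpen_extChartAt_source _
  have hχt : IsOpen χ.target := isOpen_extChartAt_target _
  have hχs : IsOpen χ.source := isOpen_extChartAt_source _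
  have hψc : ContinuousOn ψ.symm ψ.target := continuousOn_extChartAt_symm _
  have hψsm : ∀ x ∈ ψ.target, ContMDiffAt 𝓘(ℝ, E) 𝓘(ℝ, E) ∞ ψ.symm x := fun x hx ↦
    (contMDiffOn_extChartAt_symm (P.proj q)).contMDiffAt (hψt.mem_nhds hx)
  have hχsm : ∀ x ∈ χ.target, ContMDiffAt 𝓘(ℝ, F) 𝓘(ℝ, F) ∞ χ.symm x := fun x hx ↦
    (contMDiffOn_extChartAt_symm (1 : G)).contMDiffAt (hχt.mem_nhds hx)
  have hψm : ∀ y ∈ ψ.source, ContMDiffAt 𝓘(ℝ, E) 𝓘(ℝ, E) ∞ ψ y := fun y hy ↦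
    contMDiffAt_extChartAt' (by rwa [hψ, extChartAt_source] at hy)
  have hχm : ∀ y ∈ χ.source, ContMDiffAt 𝓘(ℝ, F) 𝓘(ℝ, F) ∞ χ y := fun y hy ↦
    contMDiffAt_extChartAt' (by rwa [hχ, extChartAt_source] at hy)
  set V : Set P.Total := P.proj ⁻¹' (U ∩ ψ.source) with hV
  have hVo : IsOpen V := (hU.inter hψs).preimage P.contMDiff_proj.continuous
  have hk : ∀ p ∈ V, ContMDiffAt (bundleModel E F) 𝓘(ℝ, F) ∞
      (fun p ↦ div (σ (P.proj p)) p) p := by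
    intro p hp
    refine contMDiffAt_div ((hσ _ hp.1).comp p P.contMDiff_proj.contMDiffAt) contMDiffAt_id ?_
    filter_upwards [hVo.mem_nhds hp] with p' hp'
    exact hσ' _ hp'.1
  set D : Set (E × F) := (ψ.target ∩ ψ.symm ⁻¹' U) ×ˢ χ.target with hD
  set Φ : E × F → P.Total := fun u ↦ P.act (σ (ψ.symm u.1)) (χ.symm u.2) with hΦ
  have hDo : IsOpen D := (hψc.isOpen_inter_preimage hψt hU).prod hχt
  have hsub : ∀ u ∈ D, P.proj (Φ u) = ψ.symm u.1 := fun u hu ↦ by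
    rw [hΦ, P.proj_act, hσ' _ hu.1.2]
  have ha : ∀ u ∈ D, ContMDiffAt 𝓘(ℝ, E × F) (bundleModel E F) ∞
      (fun u : E × F ↦ σ (ψ.symm u.1)) u := fun u hu ↦
    (hσ _ hu.1.2).comp u ((hψsm _ hu.1.1).comp u (contDiff_fst.contMDiff u))
  have hb : ∀ u ∈ D, ContMDiffAt 𝓘(ℝ, E × F) 𝓘(ℝ, F) ∞ (fun u : E × F ↦ χ.symm u.2) u :=
    fun u hu ↦ (hχsm _ hu.2).comp u (contDiff_snd.contMDiff u)
  have hdiv : ∀ u ∈ D, div (σ (P.proj (Φ u))) (Φ u) = χ.symm u.2 := fun u hu ↦ by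
    rw [hsub u hu]; exact div_eq rfl
  refine ⟨⟨D, V ∩ (fun p ↦ div (σ (P.proj p)) p) ⁻¹' χ.source, Φ,
    fun p ↦ (ψ (P.proj p), χ (div (σ (P.proj p)) p)), hDo, ?_, ?_, fun u hu ↦ ⟨?_, ?_⟩, ?_, ?_, ?_,
    ?_, ?_, hsub, fun p hp ↦ rfl, ?_⟩⟩
  · exact (ContinuousOn.isOpen_inter_preimage
      (fun p hp ↦ (hk p hp).continuousAt.continuousWithinAt) hVo hχs)
  · refine ⟨⟨hx, mem_extChartAt_source _⟩, ?_⟩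
    change div (σ (P.proj q)) q ∈ χ.source
    rw [hσq, div_eq (P.act_one q)]
    exact mem_extChartAt_source _
  · change P.proj (Φ u) ∈ U ∩ ψ.source
    rw [hsub u hu]
    exact ⟨hu.1.2, ψ.map_target hu.1.1⟩
  · change div (σ (P.proj (Φ u))) (Φ u) ∈ χ.source
    rw [hdiv u hu]
    exact χ.map_target hu.2
  · rintro p ⟨hp, hp'⟩
    refine ⟨⟨ψ.map_source hp.2, ?_⟩, χ.map_source hp'⟩
    change ψ.symm (ψ (P.proj p)) ∈ U
    rw [ψ.left_inv hp.2]
    exact hp.1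
  · intro u hu
    rw [hdiv u hu, hsub u hu, ψ.right_inv hu.1.1, χ.right_inv hu.2]
  · rintro p ⟨hp, hp'⟩
    change P.act (σ (ψ.symm (ψ (P.proj p)))) (χ.symm (χ (div (σ (P.proj p)) p))) = p
    rw [ψ.left_inv hp.2, χ.left_inv hp', act_div (hσ' _ hp.1)]
  · intro u hu
    exact (contMDiffAt_act (ha u hu) (hb u hu)).contMDiffWithinAt
  · rintro p ⟨hp, hp'⟩
    refine ContMDiffAt.contMDiffWithinAt (ContMDiffAt.prodMk_space ?_ ?_)
    · exact (hψm _ hp.2).comp p P.contMDiff_proj.contMDiffAt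
    · exact ContMDiffAt.comp (g := χ) (f := fun p ↦ div (σ (P.proj p)) p) p (hχm _ hp') (hk p hp)
  · intro u hu w hw
    have h1 := A.form_mfderiv_act ((ha u hu).mdifferentiableAt (by simp))
      ((hb u hu).mdifferentiableAt (by simp)) ((0, w) : E × F)
    have h2 : mfderiv 𝓘(ℝ, E × F) (bundleModel E F) (fun u : E × F ↦ σ (ψ.symm u.1)) u
        ((0, w) : E × F) = 0 := by
      have := mfderiv_comp_apply_of_apply_eq (f := (Prod.fst : E × F → E)) (x := u) rfl
        (((hσ _ hu.1.2).comp u.1 (hψsm _ hu.1.1)).mdifferentiableAt (by simp))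
        ((contDiff_fst.contMDiff u).mdifferentiableAt (n := ∞) (by simp)) ((0, w) : E × F)
      refine Eq.trans this ?_
      rw [mfderiv_eq_fderiv, fderiv_fst]
      exact map_zero (mfderiv 𝓘(ℝ, E) (bundleModel E F) (fun x ↦ σ (ψ.symm x)) u.1)
    have h3 : A.form (P.act (σ (ψ.symm u.1)) (χ.symm u.2))
        (mfderiv 𝓘(ℝ, E × F) (bundleModel E F) (fun u : E × F ↦
          P.act (σ (ψ.symm u.1)) (χ.symm u.2)) u ((0, w) : E × F)) = 0 := hw
    rw [h2, map_zero, adjointAction_zero, zero_add, h3] at h1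
    have h4 := (maurerCartan_eq_zero_iff _ _).1 h1.symm
    have h5 := mfderiv_comp_apply_of_apply_eq (f := fun u : E × F ↦ χ.symm u.2) (x := u) rfl
      ((hχm _ (χ.map_target hu.2)).mdifferentiableAt (by simp))
      ((hb u hu).mdifferentiableAt (by simp)) ((0, w) : E × F)
    have h6 : (fun u : E × F ↦ χ (χ.symm u.2)) =ᶠ[𝓝 u] Prod.snd := by
      filter_upwards [hDo.mem_nhds hu] with u' hu'
      exact χ.right_inv hu'.2
    rw [h6.mfderiv_eq, mfderiv_eq_fderiv, fderiv_snd, h4] at h5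
    have h7 : (ContinuousLinearMap.snd ℝ E F) (0, w) = 0 := Eq.trans h5 (map_zero _)
    simpa using h7

namespace AdaptedParametrization
variable {A} {q : P.Total} (c : A.AdaptedParametrization q)

theorem contMDiffAt_Φ {u : E × F} (hu : u ∈ c.D) :
    ContMDiffAt 𝓘(ℝ, E × F) (bundleModel E F) ∞ c.Φ u :=
  c.contMDiffOn_Φ.contMDiffAt (c.isOpen_D.mem_nhds hu)

theorem contMDiffAt_Ψ {p : P.Total} (hp : p ∈ c.W) :
    ContMDiffAt (bundleModel E F) 𝓘(ℝ, E × F) ∞ c.Ψ p :=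
  c.contMDiffOn_Ψ.contMDiffAt (c.isOpen_W.mem_nhds hp)

/-- The connection form in the coordinates of the parametrization. -/
def coordForm (u : E × F) : E × F →L[ℝ] F :=
  (A.form (c.Φ u)).comp (mfderiv 𝓘(ℝ, E × F) (bundleModel E F) c.Φ u)

theorem contDiffOn_coordForm [FiniteDimensional ℝ E] [FiniteDimensional ℝ F] :
    ContDiffOn ℝ ∞ c.coordForm c.D := by
  refine contDiffOn_clm_apply.2 fun X u hu ↦ ?_
  have h1 : ContMDiffAt 𝓘(ℝ, E × F) (𝓘(ℝ, E × F)).tangent ∞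
      (fun u : E × F ↦ (⟨u, X⟩ : TangentBundle 𝓘(ℝ, E × F) (E × F))) u :=
    contMDiffAt_vectorSpace_iff_contDiffAt.2 contDiffAt_const
  have h2 := c.contMDiffOn_Φ.contMDiffOn_tangentMapWithin (m := ∞) (by simp)
    c.isOpen_D.uniqueMDiffOn
  have h3 : ContMDiffAt (𝓘(ℝ, E × F)).tangent (bundleModel E F).tangent ∞
      (tangentMapWithin 𝓘(ℝ, E × F) (bundleModel E F) c.Φ c.D)
      (⟨u, X⟩ : TangentBundle 𝓘(ℝ, E × F) (E × F)) := by
    refine h2.contMDiffAt ((c.isOpen_D.preimage ?_).mem_nhds hu)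
    exact FiberBundle.continuous_proj _ _
  have h4 : ContMDiffAt 𝓘(ℝ, E × F) 𝓘(ℝ, F) ∞ (fun u ↦ c.coordForm u X) u := by
    have h5 := A.contMDiff_form.contMDiffAt.comp u (h3.comp u h1)
    refine h5.congr_of_eventuallyEq ?_
    filter_upwards [c.isOpen_D.mem_nhds hu] with u' hu'
    change _ = A.form (c.Φ u') (mfderivWithin 𝓘(ℝ, E × F) (bundleModel E F) c.Φ c.D u' X)
    rw [mfderivWithin_of_isOpen c.isOpen_D hu']
    rfl
  exact h4.contDiffAt.contDiffWithinAt

/-- The vertical part of the connection form. -/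
def vertForm (u : E × F) : F →L[ℝ] F := (c.coordForm u).comp (ContinuousLinearMap.inr ℝ E F)

/-- The linear map whose graph is the kernel of the connection form. -/
def slope (u : E × F) : E →L[ℝ] F :=
  -(c.vertForm u).inverse.comp ((c.coordForm u).comp (ContinuousLinearMap.inl ℝ E F))

theorem isInvertible_vertForm [FiniteDimensional ℝ F] {u : E × F} (hu : u ∈ c.D) :
    (c.vertForm u).IsInvertible := by
  have hinj : Function.Injective (c.vertForm u).toLinearMap := by
    refine (injective_iff_map_eq_zero _).2 fun w hw ↦ c.form_injective u hu w hw
  exact ⟨(LinearEquiv.ofInjectiveEndo _ hinj).toContinuousLinearEquiv, by ext; rfl⟩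

theorem contDiffOn_slope [FiniteDimensional ℝ E] [FiniteDimensional ℝ F] :
    ContDiffOn ℝ ∞ c.slope c.D := by
  intro u hu
  have : CompleteSpace F := FiniteDimensional.complete ℝ F
  have h1 : ContDiffAt ℝ ∞ c.coordForm u :=
    c.contDiffOn_coordForm.contDiffAt (c.isOpen_D.mem_nhds hu)
  have h2 : ContDiffAt ℝ ∞ c.vertForm u := h1.clm_comp contDiffAt_const
  obtain ⟨e, he⟩ := c.isInvertible_vertForm hu
  have h3 : ContDiffAt ℝ ∞ (fun u ↦ (c.vertForm u).inverse) u := by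
    refine ContDiffAt.comp u (g := ContinuousLinearMap.inverse) ?_ h2
    rw [← he]
    exact contDiffAt_map_inverse e
  exact (h3.clm_comp (h1.clm_comp contDiffAt_const)).neg.contDiffWithinAt

theorem coordForm_slope [FiniteDimensional ℝ F] {u : E × F} (hu : u ∈ c.D) (v : E) :
    c.coordForm u (v, c.slope u v) = 0 := by
  have h1 : (v, c.slope u v) = ContinuousLinearMap.inl ℝ E F v +
      ContinuousLinearMap.inr ℝ E F (c.slope u v) := by simp
  rw [h1, map_add]
  have h2 : c.coordForm u (ContinuousLinearMap.inr ℝ E F (c.slope u v)) =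
      c.vertForm u (c.slope u v) := rfl
  obtain ⟨e, he⟩ := c.isInvertible_vertForm hu
  rw [h2, slope, ← he]
  simp

theorem mfderiv_Φ_mfderiv_Ψ {p : P.Total} (hp : p ∈ c.W) (X : E × F) :
    (mfderiv 𝓘(ℝ, E × F) (bundleModel E F) c.Φ (c.Ψ p)
      (mfderiv (bundleModel E F) 𝓘(ℝ, E × F) c.Ψ p X : E × F) : E × F) = X := by
  have h := mfderiv_comp_apply_of_apply_eq (f := c.Ψ) (x := p) rfl
    ((c.contMDiffAt_Φ (c.mapsTo_Ψ p hp)).mdifferentiableAt (by simp))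
    ((c.contMDiffAt_Ψ hp).mdifferentiableAt (by simp)) X
  have e : (fun p ↦ c.Φ (c.Ψ p)) =ᶠ[𝓝 p] id := by
    filter_upwards [c.isOpen_W.mem_nhds hp] with p' hp'
    exact c.right_inv p' hp'
  have h' := e.mfderiv_eq (I := bundleModel E F) (I' := bundleModel E F)
  rw [mfderiv_id] at h'
  exact h.symm.trans (DFunLike.congr_fun h' X)

theorem mfderiv_Ψ_mfderiv_Φ {p : P.Total} (hp : p ∈ c.W) (X : E × F) :
    (mfderiv (bundleModel E F) 𝓘(ℝ, E × F) c.Ψ p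
      (mfderiv 𝓘(ℝ, E × F) (bundleModel E F) c.Φ (c.Ψ p) X : E × F) : E × F) = X := by
  have h := mfderiv_comp_apply_of_apply_eq (f := c.Φ) (x := c.Ψ p) (c.right_inv p hp)
    ((c.contMDiffAt_Ψ hp).mdifferentiableAt (by simp))
    ((c.contMDiffAt_Φ (c.mapsTo_Ψ p hp)).mdifferentiableAt (by simp)) X
  have e : (fun u ↦ c.Ψ (c.Φ u)) =ᶠ[𝓝 (c.Ψ p)] id := by
    filter_upwards [c.isOpen_D.mem_nhds (c.mapsTo_Ψ p hp)] with u hu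
    exact c.left_inv u hu
  have h' := e.mfderiv_eq (I := 𝓘(ℝ, E × F)) (I' := 𝓘(ℝ, E × F))
  rw [mfderiv_id] at h'
  exact h.symm.trans (DFunLike.congr_fun h' X)

theorem isInvertible_mfderiv_Ψ {p : P.Total} (hp : p ∈ c.W) :
    (mfderiv (bundleModel E F) 𝓘(ℝ, E × F) c.Ψ p).IsInvertible := by
  refine ContinuousLinearMap.IsInvertible.of_inverse
    (g := (mfderiv 𝓘(ℝ, E × F) (bundleModel E F) c.Φ (c.Ψ p) : E × F →L[ℝ] E × F)) ?_ ?_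
  · exact ContinuousLinearMap.ext (c.mfderiv_Ψ_mfderiv_Φ hp)
  · exact ContinuousLinearMap.ext (c.mfderiv_Φ_mfderiv_Ψ hp)

theorem mpullback_Ψ {p : P.Total} (hp : p ∈ c.W) (V : ∀ u : E × F, TangentSpace 𝓘(ℝ, E × F) u) :
    (VectorField.mpullback (bundleModel E F) 𝓘(ℝ, E × F) c.Ψ V p : E × F) =
      mfderiv 𝓘(ℝ, E × F) (bundleModel E F) c.Φ (c.Ψ p) (V (c.Ψ p)) := by
  exact (c.isInvertible_mfderiv_Ψ hp).inverse_apply_eq.2 (c.mfderiv_Ψ_mfderiv_Φ hp _).symm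

theorem form_mpullback_Ψ {p : P.Total} (hp : p ∈ c.W)
    (V : ∀ u : E × F, TangentSpace 𝓘(ℝ, E × F) u) :
    A.form p (VectorField.mpullback (bundleModel E F) 𝓘(ℝ, E × F) c.Ψ V p) =
      c.coordForm (c.Ψ p) (V (c.Ψ p)) := by
  refine (congrArg (A.form p) (c.mpullback_Ψ hp V)).trans ?_
  exact A.form_congr (c.right_inv p hp).symm _

/-- Vanishing of the curvature is the integrability condition for the horizontal distribution: the
bracket of the horizontal fields `(v, slope v)` and `(w, slope w)` is the vertical vector given by
the difference of the two sides. -/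
theorem slope_integrable [FiniteDimensional ℝ E] [FiniteDimensional ℝ F] (hA : A.IsFlat)
    {u : E × F} (hu : u ∈ c.D) (v w : E) :
    fderiv ℝ c.slope u (v, c.slope u v) w = fderiv ℝ c.slope u (w, c.slope u w) v := by
  have : CompleteSpace F := FiniteDimensional.complete ℝ F
  have : CompleteSpace E := FiniteDimensional.complete ℝ E
  have hsl : ContDiffAt ℝ ∞ c.slope u := c.contDiffOn_slope.contDiffAt (c.isOpen_D.mem_nhds hu)
  set p := c.Φ u with hpdef
  have hp : p ∈ c.W := c.mapsTo_Φ u hu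
  have hpu : c.Ψ p = u := c.left_inv u hu
  let X : E → ∀ u : E × F, TangentSpace 𝓘(ℝ, E × F) u := fun v u ↦ ((v, c.slope u v) : E × F)
  have hXd : ∀ v, ContDiffAt ℝ ∞ (fun u ↦ ((v, c.slope u v) : E × F)) u := fun v ↦
    contDiffAt_const.prodMk (hsl.clm_apply contDiffAt_const)
  have hX : ∀ v, ContMDiffAt 𝓘(ℝ, E × F) (𝓘(ℝ, E × F)).tangent ∞
      (fun u ↦ (⟨u, X v u⟩ : TangentBundle 𝓘(ℝ, E × F) (E × F))) (c.Ψ p) := fun v ↦ by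
    rw [hpu]
    exact contMDiffAt_vectorSpace_iff_contDiffAt.2 (hXd v)
  have hV : ∀ v, ContMDiffAt (bundleModel E F) (bundleModel E F).tangent ∞
      (fun p ↦ (⟨p, VectorField.mpullback (bundleModel E F) 𝓘(ℝ, E × F) c.Ψ (X v) p⟩ :
        TangentBundle (bundleModel E F) P.Total)) p := fun v ↦
    ContMDiffAt.mpullback_vectorField_preimage (hX v) (c.contMDiffAt_Ψ hp)
      (c.isInvertible_mfderiv_Ψ hp) (by simp)
  have hhor : ∀ v, ∀ᶠ p' in 𝓝 p, A.form p'
      (VectorField.mpullback (bundleModel E F) 𝓘(ℝ, E × F) c.Ψ (X v) p') = 0 := fun v ↦ by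
    filter_upwards [c.isOpen_W.mem_nhds hp] with p' hp'
    rw [c.form_mpullback_Ψ hp']
    exact c.coordForm_slope (c.mapsTo_Ψ p' hp') v
  have : IsManifold (bundleModel E F) (minSmoothness ℝ 2) P.Total :=
    IsManifold.of_le (n := ∞) (by simpa using ENat.LEInfty.out)
  have h0 := hA p _ _ (hV v) (hV w) (hhor v) (hhor w)
  rw [← VectorField.mpullback_mlieBracket ((hX v).mdifferentiableAt (by simp))
    ((hX w).mdifferentiableAt (by simp)) (c.contMDiffAt_Ψ hp) (by simpa using ENat.LEInfty.out),
    c.form_mpullback_Ψ hp, hpu] at h0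
  have hbr : VectorField.mlieBracket 𝓘(ℝ, E × F) (X v) (X w) u =
      ((0, fderiv ℝ c.slope u (v, c.slope u v) w - fderiv ℝ c.slope u (w, c.slope u w) v) :
        E × F) := by
    rw [← VectorField.mlieBracketWithin_univ, VectorField.mlieBracketWithin_eq_lieBracketWithin,
      VectorField.lieBracketWithin_univ]
    have hd : ∀ v, HasFDerivAt (fun u ↦ ((v, c.slope u v) : E × F))
        ((0 : E × F →L[ℝ] E).prod ((fderiv ℝ c.slope u).flip v)) u := fun v ↦ by
      have h1 := (hsl.differentiableAt (by simp)).hasFDerivAt.clm_apply (hasFDerivAt_const v u)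
      have h2 := (hasFDerivAt_const v u).prodMk h1
      simpa using h2
    change fderiv ℝ (fun u ↦ ((w, c.slope u w) : E × F)) u (v, c.slope u v) -
      fderiv ℝ (fun u ↦ ((v, c.slope u v) : E × F)) u (w, c.slope u w) = _
    rw [(hd v).fderiv, (hd w).fderiv]
    simp
  rw [hbr] at h0
  exact sub_eq_zero.1 (c.form_injective u hu _ h0)

end AdaptedParametrization

variable {A}

/-- A flat connection has flat local sections: in an adapted parametrization they are the solutions
of the total differential equation `dy = slope(x, y)`. -/
theorem IsFlat.hasFlatSections [FiniteDimensional ℝ E] [FiniteDimensional ℝ F]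
    [IsManifold 𝓘(ℝ, E) ∞ N] [LieGroup 𝓘(ℝ, F) ∞ G] (hA : A.IsFlat) : A.HasFlatSections := by
  intro q
  have : CompleteSpace F := FiniteDimensional.complete ℝ F
  obtain ⟨c⟩ := A.exists_adaptedParametrization q
  set ψ := extChartAt 𝓘(ℝ, E) (P.proj q) with hψ
  obtain ⟨r, hr, y, hy0, hys, hy⟩ := exists_hasFDerivAt_of_integrable c.isOpen_D c.contDiffOn_slope
    (fun u hu v w ↦ c.slope_integrable hA hu v w) (c.mapsTo_Ψ q c.mem_W)
  rw [c.Ψ_fst q c.mem_W] at hy hys hy0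
  have hU : IsOpen (ψ.source ∩ ψ ⁻¹' Metric.ball (ψ (P.proj q)) r) :=
    (continuousOn_extChartAt _).isOpen_inter_preimage (isOpen_extChartAt_source _)
      Metric.isOpen_ball
  have hΘ : ∀ x ∈ Metric.ball (ψ (P.proj q)) r, ContMDiffAt 𝓘(ℝ, E) (bundleModel E F) ∞
      (fun x ↦ c.Φ (x, y x)) x := fun x hx ↦ by
    have h1 : ContDiffAt ℝ ∞ (fun x ↦ (x, y x)) x :=
      contDiffAt_id.prodMk (hys.contDiffAt (Metric.isOpen_ball.mem_nhds hx))
    exact (c.contMDiffAt_Φ (hy x hx).1).comp x h1.contMDiffAt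
  have hψm : ∀ z ∈ ψ.source, ContMDiffAt 𝓘(ℝ, E) 𝓘(ℝ, E) ∞ ψ z := fun z hz ↦
    contMDiffAt_extChartAt' (by rwa [hψ, extChartAt_source] at hz)
  refine ⟨_, fun z ↦ c.Φ (ψ z, y (ψ z)), ⟨hU, fun z hz ↦ ?_, fun z hz ↦ ?_, fun z hz v ↦ ?_⟩,
    ⟨mem_extChartAt_source _, Metric.mem_ball_self hr⟩, ?_⟩
  · exact ((hΘ _ hz.2).comp z (hψm z hz.1)).contMDiffWithinAt
  · rw [c.proj_Φ _ (hy _ hz.2).1]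
    exact ψ.left_inv hz.1
  · have h1 := mfderiv_comp_apply_of_apply_eq (x := z) rfl
      ((hΘ _ hz.2).mdifferentiableAt (by simp)) ((hψm z hz.1).mdifferentiableAt (by simp)) v
    set v' : E := mfderiv 𝓘(ℝ, E) 𝓘(ℝ, E) ψ z v
    have h2 := mfderiv_comp_apply_of_apply_eq (f := fun x ↦ (x, y x)) (g := c.Φ) (x := ψ z) rfl
      ((c.contMDiffAt_Φ (hy _ hz.2).1).mdifferentiableAt (by simp))
      (((hasFDerivAt_id _).prodMk (hy _ hz.2).2).hasMFDerivAt.mdifferentiableAt) v'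
    have h3 : (mfderiv 𝓘(ℝ, E) 𝓘(ℝ, E × F) (fun x ↦ (x, y x)) (ψ z) v' : E × F) =
        (v', c.slope (ψ z, y (ψ z)) v') := by
      have hd : HasFDerivAt (fun x ↦ (x, y x))
          ((ContinuousLinearMap.id ℝ E).prod (c.slope (ψ z, y (ψ z)))) (ψ z) :=
        (hasFDerivAt_id _).prodMk (hy _ hz.2).2
      exact DFunLike.congr_fun hd.hasMFDerivAt.mfderiv v'
    rw [h3] at h2
    refine (congrArg (A.form _) (h1.trans h2)).trans ?_
    exact c.coordForm_slope (hy _ hz.2).1 v'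
  · have h1 : (ψ (P.proj q), y (ψ (P.proj q))) = c.Ψ q :=
      Prod.ext (c.Ψ_fst q c.mem_W).symm hy0
    change c.Φ (ψ (P.proj q), y (ψ (P.proj q))) = q
    rw [h1, c.right_inv q c.mem_W]

end PrincipalConnection
end

noncomputable section

/-! ### Horizontal paths -/

namespace PrincipalConnection
open PrincipalBundle
variable {E F : Type*} [NormedAddCommGroup E] [NormedSpace ℝ E]
  [NormedAddCommGroup F] [NormedSpace ℝ F]
  {N : Type v} [TopologicalSpace N] [ChartedSpace E N]
  {G : Type w} [TopologicalSpace G] [ChartedSpace F G] [Group G]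
  {P : PrincipalBundle E F N G} {A : PrincipalConnection P}

theorem IsHorizontal.trans {q q' q'' : P.Total} {γ : Path q q'} {γ' : Path q' q''}
    (h : A.IsHorizontal γ) (h' : A.IsHorizontal γ') : A.IsHorizontal (γ.trans γ') := by
  obtain ⟨S, hS, h⟩ := h
  obtain ⟨S', hS', h'⟩ := h'
  -- both halves of the concatenation are reparametrizations `u ↦ f (2 u - b)`
  have key : ∀ (f g : ℝ → P.Total) (b t : ℝ), g =ᶠ[𝓝 t] (fun u ↦ f (2 * u - b)) →
      (ContMDiffAt 𝓘(ℝ, ℝ) (bundleModel E F) ∞ f (2 * t - b) ∧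
        A.form (f (2 * t - b)) (mfderiv 𝓘(ℝ, ℝ) (bundleModel E F) f (2 * t - b) (1 : ℝ)) = 0) →
      ContMDiffAt 𝓘(ℝ, ℝ) (bundleModel E F) ∞ g t ∧
        A.form (g t) (mfderiv 𝓘(ℝ, ℝ) (bundleModel E F) g t (1 : ℝ)) = 0 := by
    rintro f g b t e ⟨hf, hf'⟩
    have hl : ContDiff ℝ ∞ (fun u : ℝ ↦ 2 * u - b) := by fun_prop
    have hd : HasDerivAt (fun u : ℝ ↦ 2 * u - b) 2 t := by
      simpa using ((hasDerivAt_id t).const_mul 2).sub_const b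
    refine ⟨(hf.comp t hl.contMDiff.contMDiffAt).congr_of_eventuallyEq e, ?_⟩
    have h1 := mfderiv_comp_apply_of_apply_eq (f := fun u : ℝ ↦ 2 * u - b) (g := f) (x := t) rfl
      (hf.mdifferentiableAt (by simp)) (hl.contMDiff.mdifferentiableAt (by simp)) (1 : ℝ)
    have h2 : (mfderiv 𝓘(ℝ, ℝ) 𝓘(ℝ, ℝ) (fun u : ℝ ↦ 2 * u - b) t (1 : ℝ) : ℝ) =
        (2 : ℝ) • (1 : ℝ) := by
      have := hd.hasFDerivAt.hasMFDerivAt.mfderiv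
      exact (DFunLike.congr_fun this (1 : ℝ)).trans
        (ContinuousLinearMap.toSpanSingleton_apply ℝ (2 : ℝ) (1 : ℝ) |>.trans (by norm_num))
    have h3 : (mfderiv 𝓘(ℝ, ℝ) (bundleModel E F) g t (1 : ℝ) : E × F) =
        (2 : ℝ) • (mfderiv 𝓘(ℝ, ℝ) (bundleModel E F) f (2 * t - b) (1 : ℝ) : E × F) := by
      refine (DFunLike.congr_fun (e.mfderiv_eq (I := 𝓘(ℝ, ℝ)) (I' := bundleModel E F))
        (1 : ℝ)).trans (h1.trans ?_)
      refine (congrArg (mfderiv 𝓘(ℝ, ℝ) (bundleModel E F) f (2 * t - b)) h2).trans ?_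
      exact map_smul (mfderiv 𝓘(ℝ, ℝ) (bundleModel E F) f (2 * t - b)) (2 : ℝ) (1 : ℝ)
    refine (A.form_congr e.self_of_nhds _).trans ?_
    refine (congrArg (A.form (f (2 * t - b))) h3).trans ?_
    refine (map_smul (A.form (f (2 * t - b))) (2 : ℝ) _).trans ?_
    rw [hf', smul_zero]
  refine ⟨(fun t ↦ 2 * t - 0) ⁻¹' S ∪ (fun t ↦ 2 * t - 1) ⁻¹' S' ∪ {1 / 2}, ?_, ?_⟩
  · refine ((hS.preimage ?_).union (hS'.preimage ?_)).union (Set.finite_singleton _) <;>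
    · intro a _ b _ hab
      simp only at hab
      linarith
  · rintro t ⟨ht, htS⟩
    simp only [Set.mem_union, Set.mem_preimage, Set.mem_singleton_iff, not_or] at htS
    rcases lt_or_gt_of_ne htS.2 with hlt | hgt
    · refine key γ.extend _ 0 t ?_ (h _ ⟨⟨by linarith [ht.1], by linarith⟩, htS.1.1⟩)
      filter_upwards [Iio_mem_nhds hlt] with u hu
      rw [Path.extend_trans_of_le_half _ _ (le_of_lt hu), sub_zero]
    · refine key γ'.extend _ 1 t ?_ (h' _ ⟨⟨by linarith, by linarith [ht.2]⟩, htS.1.2⟩)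
      filter_upwards [Ioi_mem_nhds hgt] with u hu
      rw [Path.extend_trans_of_half_le _ _ (le_of_lt hu)]

theorem IsTransport.trans {x y z : N} {α : Path x y} {β : Path y z} {q q' q'' : P.Total}
    (h : A.IsTransport α q q') (h' : A.IsTransport β q' q'') :
    A.IsTransport (α.trans β) q q'' := by
  obtain ⟨γ, hγ, hp⟩ := h
  obtain ⟨γ', hγ', hp'⟩ := h'
  refine ⟨γ.trans γ', hγ.trans hγ', fun t ↦ ?_⟩
  rw [Path.trans_apply, Path.trans_apply]
  split_ifs
  · exact hp _
  · exact hp' _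

/-- A flat section carries smooth paths to horizontal paths. -/
theorem IsFlatSection.isTransport {U : Set N} {s : N → P.Total} (hs : A.IsFlatSection U s)
    {x y : N} (α : Path x y) (hα : ∀ t, α t ∈ U)
    (hsm : ∀ t ∈ Set.Ioo (0 : ℝ) 1, ContMDiffAt 𝓘(ℝ, ℝ) 𝓘(ℝ, E) ∞ α.extend t) :
    A.IsTransport α (s x) (s y) := by
  have hc : ContinuousOn s (Set.range α) :=
    hs.contMDiffOn.continuousOn.mono (by rintro _ ⟨t, rfl⟩; exact hα t)
  refine ⟨α.map' hc, ⟨∅, Set.finite_empty, fun t ht ↦ ?_⟩, fun t ↦ hs.proj_eq _ (hα t)⟩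
  have hU : α.extend t ∈ U := by
    obtain ⟨u, hu⟩ : α.extend t ∈ Set.range α := α.extend_range ▸ Set.mem_range_self t
    exact hu ▸ hα u
  have he : ((α.map' hc).extend : ℝ → P.Total) = fun t ↦ s (α.extend t) := rfl
  refine he ▸ ⟨(hs.contMDiffAt hU).comp t (hsm t ht.1), ?_⟩
  have h1 := mfderiv_comp_apply_of_apply_eq (f := α.extend) (g := s) (x := t) rfl
    (hs.mdifferentiableAt hU) ((hsm t ht.1).mdifferentiableAt (by simp)) (1 : ℝ)
  exact (congrArg (A.form (s (α.extend t))) h1).trans (hs.form_eq_zero _ hU _)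

variable [LieGroup 𝓘(ℝ, F) ∞ G]

/-- A horizontal path stays in one leaf: in the coordinate given by a flat section its velocity
vanishes off a finite set. -/
theorem IsHorizontal.continuous_leaf [CompleteSpace F] (hA : A.HasFlatSections)
    {q q' : P.Total} {γ : Path q q'}
    (hγ : A.IsHorizontal γ) : Continuous fun t : ℝ ↦ (⟨γ.extend t⟩ : Leaf A) := by
  obtain ⟨S, hS, h⟩ := hγ
  -- outside the interval, `γ.extend` is constant
  have hall : ∀ t ∉ S ∪ {0, 1}, ContMDiffAt 𝓘(ℝ, ℝ) (bundleModel E F) ∞ γ.extend t ∧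
      A.form (γ.extend t) (mfderiv 𝓘(ℝ, ℝ) (bundleModel E F) γ.extend t (1 : ℝ)) = 0 := by
    have key : ∀ (p : P.Total) (t : ℝ), γ.extend =ᶠ[𝓝 t] (fun _ ↦ p) →
        ContMDiffAt 𝓘(ℝ, ℝ) (bundleModel E F) ∞ γ.extend t ∧
          A.form (γ.extend t) (mfderiv 𝓘(ℝ, ℝ) (bundleModel E F) γ.extend t (1 : ℝ)) = 0 := by
      intro p t e
      refine ⟨contMDiffAt_const.congr_of_eventuallyEq e, ?_⟩
      have h1 := e.mfderiv_eq (I := 𝓘(ℝ, ℝ)) (I' := bundleModel E F)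
      rw [mfderiv_const] at h1
      exact (congrArg (A.form (γ.extend t)) (DFunLike.congr_fun h1 (1 : ℝ))).trans
        (map_zero (A.form (γ.extend t)))
    intro t ht
    simp only [Set.mem_union, Set.mem_insert_iff, Set.mem_singleton_iff, not_or] at ht
    rcases lt_or_gt_of_ne ht.2.1 with h0 | h0
    · exact key q t (by
        filter_upwards [Iio_mem_nhds h0] with u hu using γ.extend_of_le_zero hu.le)
    rcases lt_or_gt_of_ne ht.2.2 with h1 | h1
    · exact h t ⟨⟨h0, h1⟩, ht.1⟩
    · exact key q' t (by
        filter_upwards [Ioi_mem_nhds h1] with u hu using γ.extend_of_one_le hu.le)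
  refine continuous_iff_continuousAt.2 fun t₀ ↦ ?_
  obtain ⟨U, s, hs, hU, hq⟩ := hA (γ.extend t₀)
  have hcp : Continuous fun t ↦ P.proj (γ.extend t) :=
    P.contMDiff_proj.continuous.comp γ.continuous_extend
  have hk : ∀ p, P.proj p ∈ U →
      ContMDiffAt (bundleModel E F) 𝓘(ℝ, F) ∞ (fun p ↦ div (s (P.proj p)) p) p := fun p hp ↦ by
    refine contMDiffAt_div ((hs.contMDiffAt hp).comp p P.contMDiff_proj.contMDiffAt)
      contMDiffAt_id ?_
    filter_upwards [P.contMDiff_proj.continuous.continuousAt.preimage_mem_nhds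
      (hs.isOpen.mem_nhds hp)] with p' hp'
    exact hs.proj_eq _ hp'
  set κ : ℝ → G := fun t ↦ div (s (P.proj (γ.extend t))) (γ.extend t) with hκ
  have hκc : ∀ t, P.proj (γ.extend t) ∈ U → ContinuousAt κ t := fun t ht ↦
    (hk _ ht).continuousAt.comp (f := γ.extend) γ.continuous_extend.continuousAt
  have hκ0 : κ t₀ = 1 := div_eq (by rw [P.act_one, hq])
  have hev : ∀ᶠ t in 𝓝 t₀,
      P.proj (γ.extend t) ∈ U ∧ κ t ∈ (extChartAt 𝓘(ℝ, F) (1 : G)).source := by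
    refine (hcp.continuousAt.eventually_mem (hs.isOpen.mem_nhds hU)).and
      ((hκc t₀ hU).eventually_mem ?_)
    rw [hκ0]
    exact extChartAt_source_mem_nhds 1
  obtain ⟨ε, hε, hball⟩ := Metric.eventually_nhds_iff_ball.1 hev
  have hder : ∀ t ∈ Metric.ball t₀ ε, t ∉ S ∪ {0, 1} →
      MDifferentiableAt 𝓘(ℝ, ℝ) 𝓘(ℝ, F) κ t ∧ mfderiv 𝓘(ℝ, ℝ) 𝓘(ℝ, F) κ t = 0 := by
    intro t ht htS
    have hpt := (hball t ht).1
    have hγt := (hall t htS).1.mdifferentiableAt (n := ∞) (by simp)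
    have hkt := (hk _ hpt).mdifferentiableAt (n := ∞) (by simp)
    refine ⟨hkt.comp t hγt, ?_⟩
    refine ContinuousLinearMap.ext fun (r : ℝ) ↦ ?_
    have h1 := mfderiv_comp_apply_of_apply_eq (f := γ.extend)
      (g := fun p ↦ div (s (P.proj p)) p) (x := t) rfl hkt hγt (1 : ℝ)
    have h2 := (hs.form_eq hpt _).symm.trans (hall t htS).2
    rw [maurerCartan_eq_zero_iff] at h2
    have h3 : (mfderiv 𝓘(ℝ, ℝ) 𝓘(ℝ, F) κ t (1 : ℝ) : F) = 0 := h1.trans h2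
    have h4 : (mfderiv 𝓘(ℝ, ℝ) 𝓘(ℝ, F) κ t r : F) =
        (r : ℝ) • (mfderiv 𝓘(ℝ, ℝ) 𝓘(ℝ, F) κ t (1 : ℝ) : F) := by
      refine Eq.trans ?_ (map_smul (mfderiv 𝓘(ℝ, ℝ) 𝓘(ℝ, F) κ t) r (1 : ℝ))
      exact congrArg (mfderiv 𝓘(ℝ, ℝ) 𝓘(ℝ, F) κ t) (mul_one (r : ℝ)).symm
    exact h4.trans (by rw [h3, smul_zero]; rfl)
  have hconst : ∀ t ∈ Metric.ball t₀ ε, κ t = 1 := by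
    have hfin : (S ∪ {0, 1}).Finite := hS.union (Set.toFinite _)
    have hsub : ∀ t ∈ Metric.ball t₀ ε, ∀ u ∈ Set.uIcc t₀ t, u ∈ Metric.ball t₀ ε :=
      fun t ht u hu ↦ (convex_ball t₀ ε).ordConnected.uIcc_subset (Metric.mem_ball_self hε) ht hu
    have hstep : ∀ a b, a ≤ b → Set.Icc a b ⊆ Metric.ball t₀ ε → κ a = κ b := fun a b hab hsub ↦
      eq_of_mfderiv_eq_zero_off_finite (I₂ := 𝓘(ℝ, F)) hab hfin
        (fun u hu ↦ (hκc u (hball u (hsub hu)).1).continuousWithinAt) 1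
        (fun u hu ↦ (hball u (hsub hu)).2)
        (fun u hu ↦ hder u (hsub (Set.Ioo_subset_Icc_self hu.1)) hu.2)
    intro t ht
    rcases le_total t₀ t with hle | hle
    · rw [← hκ0]
      refine (hstep t₀ t hle fun u hu ↦ hsub t ht u ?_).symm
      rwa [Set.uIcc_of_le hle]
    · rw [← hκ0]
      refine hstep t t₀ hle fun u hu ↦ hsub t ht u ?_
      rwa [Set.uIcc_of_ge hle]
  have hleaf : ContinuousAt (fun t : ℝ ↦ (⟨s (P.proj (γ.extend t))⟩ : Leaf A)) t₀ :=
    (hs.continuousOn_leaf.continuousAt (hs.isOpen.mem_nhds hU)).comp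
      (f := fun t : ℝ ↦ P.proj (γ.extend t)) hcp.continuousAt
  refine hleaf.congr ?_
  filter_upwards [Metric.ball_mem_nhds t₀ hε] with t ht
  have h1 := act_div (q := s (P.proj (γ.extend t))) (q' := γ.extend t)
    (hs.proj_eq _ (hball t ht).1)
  change P.act _ (κ t) = _ at h1
  rw [hconst t ht, P.act_one] at h1
  exact Leaf.ext h1

variable [IsManifold 𝓘(ℝ, E) ∞ N]

/-! ### Parallel transport along homotopy classes -/

namespace HasFlatSections

open Classical in
/-- Parallel transport along a homotopy class `a` of paths from `x` to `y`, as the monodromy of the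
covering by leaves. It is extended by the identity to points that do not lie over `x`. -/
def transport (hA : A.HasFlatSections) {x y : N} (a : Path.Homotopic.Quotient x y) (q : P.Total) :
    P.Total :=
  if h : P.proj q = x then (hA.isCoveringMap.monodromy a ⟨⟨q⟩, h⟩).1.pt else q

variable (hA : A.HasFlatSections) {x y z : N}

theorem transport_eq (a : Path.Homotopic.Quotient x y) {q : P.Total} (h : P.proj q = x) :
    hA.transport a q = (hA.isCoveringMap.monodromy a ⟨⟨q⟩, h⟩).1.pt := by
  rw [transport, dif_pos h]

theorem proj_transport (a : Path.Homotopic.Quotient x y) {q : P.Total} (h : P.proj q = x) :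
    P.proj (hA.transport a q) = y := by
  rw [hA.transport_eq a h]
  exact (hA.isCoveringMap.monodromy a ⟨⟨q⟩, h⟩).2

theorem transport_refl {q : P.Total} (h : P.proj q = x) : hA.transport (.refl x) q = q := by
  rw [hA.transport_eq _ h, hA.isCoveringMap.monodromy_refl]
  rfl

theorem transport_trans (a : Path.Homotopic.Quotient x y) (b : Path.Homotopic.Quotient y z)
    {q : P.Total} (h : P.proj q = x) :
    hA.transport (a.trans b) q = hA.transport b (hA.transport a q) := by
  rw [hA.transport_eq _ h, hA.transport_eq b (hA.proj_transport a h),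
    hA.isCoveringMap.monodromy_trans_apply]
  congr 3
  exact Subtype.ext (Leaf.ext (hA.transport_eq a h).symm)

theorem transport_transport_symm (a : Path.Homotopic.Quotient x y) {q : P.Total}
    (h : P.proj q = y) : hA.transport a (hA.transport a.symm q) = q := by
  rw [← hA.transport_trans _ _ h, Path.Homotopic.Quotient.symm_trans, hA.transport_refl h]

/-- The end of a lift of `α` to the leaf topology is the parallel transport of its beginning. -/
theorem transport_mk (α : Path x y) {l l' : Leaf A} (γ : Path l l')
    (h : ∀ t, leafProj A (γ t) = α t) : hA.transport (.mk α) l.pt = l'.pt := by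
  have hl : leafProj A l = x := by rw [← γ.source, h, α.source]
  rw [hA.transport_eq _ hl]
  have := (hA.isCoveringMap.eq_liftPath_iff' (γ := α.toContinuousMap) (e := l)
    (α.source.trans hl.symm) (Γ := γ.toContinuousMap)).2 ⟨funext h, γ.source⟩
  have h1 := congrArg (fun f : C(unitInterval, Leaf A) ↦ (f 1).pt) this
  refine h1.symm.trans ?_
  exact congrArg Leaf.pt γ.target

theorem exists_leaf_lift (α : Path x y) {q : P.Total} (hq : P.proj q = x) :
    ∃ γ : Path (⟨q⟩ : Leaf A) ⟨hA.transport (.mk α) q⟩, ∀ t, leafProj A (γ t) = α t := by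
  have h0 : α.toContinuousMap 0 = leafProj A ⟨q⟩ := α.source.trans hq.symm
  let γ : Path (⟨q⟩ : Leaf A) ⟨hA.transport (.mk α) q⟩ :=
    { toContinuousMap := hA.isCoveringMap.liftPath α.toContinuousMap ⟨q⟩ h0
      source' := hA.isCoveringMap.liftPath_zero _ _ _
      target' := by
        rw [hA.transport_eq _ hq]
        rfl }
  exact ⟨γ, fun t ↦ congrFun (hA.isCoveringMap.liftPath_lifts α.toContinuousMap ⟨q⟩ h0) t⟩

/-- A fibre-preserving map over `f` that is continuous for the leaf topologies commutes with
parallel transport. -/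
theorem transport_map {G' F' : Type*} [NormedAddCommGroup F'] [NormedSpace ℝ F']
    [TopologicalSpace G'] [ChartedSpace F' G'] [Group G'] [LieGroup 𝓘(ℝ, F') ∞ G']
    {P' : PrincipalBundle E F' N G'} {A' : PrincipalConnection P'} (hA' : A'.HasFlatSections)
    {f : C(N, N)} {φ : P.Total → P'.Total}
    (hφ : Continuous fun l : Leaf A ↦ (⟨φ l.pt⟩ : Leaf A'))
    (hf : ∀ q, P'.proj (φ q) = f (P.proj q)) (a : Path.Homotopic.Quotient x y) {q : P.Total}
    (hq : P.proj q = x) : hA'.transport (a.map f) (φ q) = φ (hA.transport a q) := by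
  obtain ⟨α, rfl⟩ := Path.Homotopic.Quotient.mk_surjective a
  obtain ⟨γ, hγ⟩ := hA.exists_leaf_lift α hq
  rw [← Path.Homotopic.Quotient.mk_map]
  refine hA'.transport_mk (α.map f.continuous) (γ.map hφ) fun t ↦ ?_
  exact (hf _).trans (congrArg f (hγ t))

theorem transport_act (a : Path.Homotopic.Quotient x y) {q : P.Total} (hq : P.proj q = x) (g : G) :
    hA.transport a (P.act q g) = P.act (hA.transport a q) g := by
  have h : Continuous fun l : Leaf A ↦ (⟨P.act l.pt g⟩ : Leaf A) :=
    continuous_leaf fun U s hs ↦ (hs.act g).continuousOn_leaf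
  have := hA.transport_map hA (f := .id N) h (fun q ↦ P.proj_act q g) a hq
  obtain ⟨α, rfl⟩ := Path.Homotopic.Quotient.mk_surjective a
  exact this

/-- Along paths inside its domain, parallel transport follows a flat section. -/
theorem transport_section {U : Set N} {s : N → P.Total} (hs : A.IsFlatSection U s) (α : Path x y)
    (hα : ∀ t, α t ∈ U) : hA.transport (.mk α) (s x) = s y := by
  have hc : ContinuousOn (fun y ↦ (Leaf.mk (s y) : Leaf A)) (Set.range α) :=
    hs.continuousOn_leaf.mono (by rintro _ ⟨t, rfl⟩; exact hα t)
  exact hA.transport_mk α (α.map' hc) fun t ↦ hs.proj_eq _ (hα t)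

/-- Parallel transport along piecewise smooth paths is unique and depends only on the homotopy
class. -/
theorem eq_transport_of_isTransport [CompleteSpace F] {α : Path x y} {q q' : P.Total}
    (h : A.IsTransport α q q') : q' = hA.transport (.mk α) q := by
  obtain ⟨γ, hγ, hp⟩ := h
  have hc := hγ.continuous_leaf hA
  let γ' : Path (⟨q⟩ : Leaf A) ⟨q'⟩ :=
    { toFun := fun t ↦ ⟨γ t⟩
      continuous_toFun := by
        refine (hc.comp continuous_subtype_val).congr fun t ↦ ?_
        exact Leaf.ext (γ.extend_extends' t)
      source' := Leaf.ext γ.source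
      target' := Leaf.ext γ.target }
  exact (hA.transport_mk α γ' hp).symm

/-- Every homotopy class contains a path along which parallel transport exists. -/
theorem exists_isTransport (a : Path.Homotopic.Quotient x y) {q : P.Total} (hq : P.proj q = x) :
    ∃ α : Path x y, Path.Homotopic.Quotient.mk α = a ∧ A.IsTransport α q (hA.transport a q) := by
  refine Path.Homotopic.Quotient.local_induction (fun x y a ↦ ∀ q, P.proj q = x →
    ∃ α : Path x y, Path.Homotopic.Quotient.mk α = a ∧ A.IsTransport α q (hA.transport a q))
    ?_ ?_ a q hq
  · intro x y z a b ha hb q hq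
    obtain ⟨α, hα, hα'⟩ := ha q hq
    obtain ⟨β, hβ, hβ'⟩ := hb _ (hA.proj_transport a hq)
    refine ⟨α.trans β, by rw [Path.Homotopic.Quotient.mk_trans, hα, hβ], ?_⟩
    rw [hA.transport_trans _ _ hq]
    exact hα'.trans hβ'
  · intro x
    obtain ⟨q₁, rfl⟩ := P.exists_proj_eq x
    obtain ⟨U', s, hs', hU', -⟩ := hA q₁
    obtain ⟨U, hUb, hU, hUU'⟩ := exists_isBallLike (E := E) (hs'.isOpen.mem_nhds hU')
    have hs := hs'.mono hUb.isOpen hUU'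
    refine ⟨U, hUb.isOpen.mem_nhds hU, fun y z γ hγ q hq ↦ ?_⟩
    have hy : y ∈ U := γ.source ▸ hγ 0
    have hz : z ∈ U := γ.target ▸ hγ 1
    obtain ⟨β, hβ, hβs⟩ := hUb.exists_path y hy z hz
    refine ⟨β, Path.Homotopic.Quotient.eq.2 (hUb.homotopic _ _ _ _ hβ hγ), ?_⟩
    have hsy : P.act (s y) (div (s y) q) = q := act_div (by rw [hs.proj_eq y hy, hq])
    have h1 := (hs.act (div (s y) q)).isTransport β hβ hβs
    have h2 := hA.transport_section (hs.act (div (s y) q)) γ hγ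
    rw [hsy] at h1 h2
    rwa [h2]

end HasFlatSections
end PrincipalConnection
end

noncomputable section

/-! ### Homotopy classes of paths in a double cover -/

/-- A homotopy class of loops as an element of the group of loops. -/
def loopOf {X : Type*} [TopologicalSpace X] {x : X} (a : Path.Homotopic.Quotient x x) :
    LoopGroup X x :=
  MulOpposite.op (FundamentalGroup.fromPath a)

section
variable {X : Type*} [TopologicalSpace X] {x : X}

theorem loopOf_surjective : Function.Surjective (loopOf (x := x)) := fun a ↦ ⟨a.unop, rfl⟩

theorem loopOf_injective : Function.Injective (loopOf (x := x)) := fun _ _ h ↦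
  MulOpposite.op_injective h

theorem loopOf_trans (a b : Path.Homotopic.Quotient x x) :
    loopOf (a.trans b) = loopOf a * loopOf b := rfl

theorem loopOf_refl : loopOf (.refl x) = 1 := rfl

end

namespace IsDoubleCover
variable {E : Type*} [NormedAddCommGroup E] [NormedSpace ℝ E]
  {M : Type*} [TopologicalSpace M] [ChartedSpace E M]
  {N : Type*} [TopologicalSpace N] [ChartedSpace E N] {π : N → M} {τ : N → N}
  (h : IsDoubleCover E π τ)

theorem deck_deck (h : IsDoubleCover E π τ) (x : N) : τ (τ x) = x :=
  ((h.fibre x (τ (τ x))).1 (by rw [h.proj_deck, h.proj_deck])).resolve_right (h.deck_ne (τ x))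

/-- The covering as a continuous map. -/
def projMap : C(N, M) := ⟨π, h.isCoveringMap.continuous⟩

/-- The deck transformation as a continuous map. -/
def deckMap : C(N, N) := ⟨τ, h.contMDiff_deck.continuous⟩

/-- The translate of a class of paths by the deck transformation. -/
def translate {x y : N} (a : Path.Homotopic.Quotient x y) : Path.Homotopic.Quotient (τ x) (τ y) :=
  a.map h.deckMap

variable {x : N}

/-- The class of loops in `M` under a class of paths in `N` from `x` to `τ x`. -/
def projClass (b : Path.Homotopic.Quotient x (τ x)) : LoopGroup M (π x) :=
  loopOf ((b.map h.projMap).cast rfl (h.proj_deck x).symm)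

theorem onLoops_loopOf (a : Path.Homotopic.Quotient x x) :
    h.onLoops x (loopOf a) = loopOf (a.map h.projMap) := rfl

/-- Coverings are injective on fundamental groups. -/
theorem onLoops_injective : Function.Injective (h.onLoops x) := by
  intro a b hab
  obtain ⟨a, rfl⟩ := loopOf_surjective a
  obtain ⟨b, rfl⟩ := loopOf_surjective b
  rw [onLoops_loopOf, onLoops_loopOf] at hab
  exact congrArg loopOf (h.isCoveringMap.injective_path_homotopic_map x x (loopOf_injective hab))

theorem projClass_injective : Function.Injective (h.projClass (x := x)) := by
  intro a b hab
  refine h.isCoveringMap.injective_path_homotopic_map x (τ x) ?_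
  obtain ⟨α, rfl⟩ := Path.Homotopic.Quotient.mk_surjective a
  obtain ⟨β, rfl⟩ := Path.Homotopic.Quotient.mk_surjective b
  obtain ⟨H⟩ := Path.Homotopic.Quotient.exact (loopOf_injective hab)
  exact Path.Homotopic.Quotient.eq.2 ⟨H.pathCast rfl (h.proj_deck x)⟩

theorem exists_projClass_eq {c : LoopGroup M (π x)} (hc : c ∉ (h.onLoops x).range) :
    ∃ b, h.projClass b = c := by
  obtain ⟨c, rfl⟩ := loopOf_surjective c
  obtain ⟨γ, rfl⟩ := Path.Homotopic.Quotient.mk_surjective c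
  obtain ⟨Γ, hΓ, hΓ0⟩ := h.isCoveringMap.exists_path_lifts γ.toContinuousMap x γ.source
  have hΓ1 : π x = π (Γ 1) := (γ.target.symm.trans (congrFun hΓ 1).symm)
  rcases (h.fibre _ _).1 hΓ1 with h1 | h1
  · refine absurd ⟨loopClass ⟨Γ, hΓ0, h1⟩, ?_⟩ hc
    refine congrArg (fun p : Path (π x) (π x) ↦ loopClass p)
      (?_ : Path.map ⟨Γ, hΓ0, h1⟩ h.isCoveringMap.continuous = γ)
    ext t
    exact congrFun hΓ t
  · refine ⟨.mk ⟨Γ, hΓ0, h1⟩, ?_⟩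
    refine congrArg (fun p : Path (π x) (π x) ↦ loopClass p)
      (?_ : h.projLoop ⟨Γ, hΓ0, h1⟩ = γ)
    ext t
    exact congrFun hΓ t

theorem projClass_trans (a : Path.Homotopic.Quotient x x) (b : Path.Homotopic.Quotient x (τ x)) :
    h.projClass (a.trans b) = h.onLoops x (loopOf a) * h.projClass b := by
  obtain ⟨α, rfl⟩ := Path.Homotopic.Quotient.mk_surjective a
  obtain ⟨β, rfl⟩ := Path.Homotopic.Quotient.mk_surjective b
  refine congrArg (fun p : Path (π x) (π x) ↦ loopClass p)
    (?_ : h.projLoop (α.trans β) = (α.map h.isCoveringMap.continuous).trans (h.projLoop β))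
  ext t
  simp only [projLoop, Path.cast_coe, Path.trans_apply, Path.map_coe, Function.comp]
  split_ifs <;> rfl

theorem projClass_trans_deck (b : Path.Homotopic.Quotient x (τ x))
    (a : Path.Homotopic.Quotient x x) :
    h.projClass (b.trans (h.translate a)) = h.projClass b * h.onLoops x (loopOf a) := by
  obtain ⟨α, rfl⟩ := Path.Homotopic.Quotient.mk_surjective a
  obtain ⟨β, rfl⟩ := Path.Homotopic.Quotient.mk_surjective b
  refine congrArg (fun p : Path (π x) (π x) ↦ loopClass p)
    (?_ : h.projLoop (β.trans (α.map h.contMDiff_deck.continuous)) =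
      (h.projLoop β).trans (α.map h.isCoveringMap.continuous))
  ext t
  simp only [projLoop, Path.cast_coe, Path.trans_apply, Path.map_coe, Function.comp]
  split_ifs
  · rfl
  · exact h.proj_deck _

/-- A path from `x` to `τ x` followed by its translate is a loop over the square. -/
theorem onLoops_trans_deck (b : Path.Homotopic.Quotient x (τ x)) :
    h.onLoops x (loopOf ((b.trans (h.translate b)).cast rfl (h.deck_deck x).symm)) =
      h.projClass b ^ 2 := by
  rw [pow_two]
  obtain ⟨β, rfl⟩ := Path.Homotopic.Quotient.mk_surjective b
  refine congrArg (fun p : Path (π x) (π x) ↦ loopClass p)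
    (?_ : ((β.trans (β.map h.contMDiff_deck.continuous)).cast rfl (h.deck_deck x).symm).map
      h.isCoveringMap.continuous = (h.projLoop β).trans (h.projLoop β))
  ext t
  simp only [projLoop, Path.cast_coe, Path.trans_apply, Path.map_coe, Function.comp]
  split_ifs
  · rfl
  · exact h.proj_deck _

end IsDoubleCover

namespace PrincipalConnection
open PrincipalBundle
variable {E F : Type*} [NormedAddCommGroup E] [NormedSpace ℝ E]
  [NormedAddCommGroup F] [NormedSpace ℝ F]
  {N : Type v} [TopologicalSpace N] [ChartedSpace E N]
  {G : Type w} [TopologicalSpace G] [ChartedSpace F G] [Group G]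
  {P : PrincipalBundle E F N G} {A : PrincipalConnection P}
  [LieGroup 𝓘(ℝ, F) ∞ G] [IsManifold 𝓘(ℝ, E) ∞ N]

theorem HasFlatSections.transport_cast (hA : A.HasFlatSections) {x y y' : N}
    (a : Path.Homotopic.Quotient x y) (e : y' = y) (q : P.Total) :
    hA.transport (a.cast rfl e) q = hA.transport a q := by
  subst e
  rw [Path.Homotopic.Quotient.cast_rfl_rfl]

end PrincipalConnection

/-! ### Parallel transport in a flat twisted bundle -/

namespace FlatTwistedBundle
open PrincipalBundle PrincipalConnection
variable {E F : Type*} [NormedAddCommGroup E] [NormedSpace ℝ E]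
  [NormedAddCommGroup F] [NormedSpace ℝ F]
  {M : Type*} [TopologicalSpace M] [ChartedSpace E M]
  {N : Type v} [TopologicalSpace N] [ChartedSpace E N]
  {G : Type w} [TopologicalSpace G] [ChartedSpace F G] [Group G]
  {π : N → M} {τ : N → N} {z : G}

/-- The lift of the deck transformation carries flat sections to flat sections. -/
theorem isFlatSection_lift (hπ : IsDoubleCover E π τ) {U : Set N}
    {D : FlatTwistedBundle E F τ z} {s : N → D.bundle.Total}
    (hs : D.conn.IsFlatSection U s) :
    D.conn.IsFlatSection (τ ⁻¹' U) (fun y ↦ D.lift (s (τ y))) := by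
  refine ⟨hs.isOpen.preimage hπ.contMDiff_deck.continuous, fun y hy ↦ ?_, fun y hy ↦ ?_,
    fun y hy v ↦ ?_⟩
  · exact (D.contMDiff_lift.contMDiffAt.comp y ((hs.contMDiffAt hy).comp y
      hπ.contMDiff_deck.contMDiffAt)).contMDiffWithinAt
  · rw [D.proj_lift, hs.proj_eq _ hy, hπ.deck_deck]
  · have hτ := hπ.contMDiff_deck.mdifferentiableAt (x := y) (by simp)
    have hsτ : MDifferentiableAt 𝓘(ℝ, E) (bundleModel E F) (fun y ↦ s (τ y)) y :=
      MDifferentiableAt.comp y (hs.mdifferentiableAt hy) hτ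
    have h1 := mfderiv_comp_apply_of_apply_eq (f := fun y ↦ s (τ y)) (g := D.lift) (x := y) rfl
      (D.contMDiff_lift.mdifferentiableAt (by simp)) hsτ v
    have h2 := mfderiv_comp_apply_of_apply_eq (f := τ) (g := s) (x := y) rfl
      (hs.mdifferentiableAt hy) hτ v
    refine (congrArg (D.conn.form (D.lift (s (τ y)))) h1).trans ?_
    refine (D.invariant _ _).trans ?_
    exact (congrArg (D.conn.form (s (τ y))) h2).trans (hs.form_eq_zero _ hy _)

variable [FiniteDimensional ℝ E] [FiniteDimensional ℝ F] [IsManifold 𝓘(ℝ, E) ∞ N]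
  [LieGroup 𝓘(ℝ, F) ∞ G]

/-- Parallel transport in a flat twisted bundle. -/
def transport (D : FlatTwistedBundle E F τ z) {x y : N} (a : Path.Homotopic.Quotient x y)
    (q : D.bundle.Total) : D.bundle.Total :=
  D.flat.hasFlatSections.transport a q

variable (D D' : FlatTwistedBundle E F τ z) {x y y' : N}

theorem proj_transport (a : Path.Homotopic.Quotient x y) {q : D.bundle.Total}
    (h : D.bundle.proj q = x) : D.bundle.proj (D.transport a q) = y :=
  D.flat.hasFlatSections.proj_transport a h

theorem transport_trans (a : Path.Homotopic.Quotient x y) (b : Path.Homotopic.Quotient y y')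
    {q : D.bundle.Total} (h : D.bundle.proj q = x) :
    D.transport (a.trans b) q = D.transport b (D.transport a q) :=
  D.flat.hasFlatSections.transport_trans a b h

theorem transport_act (a : Path.Homotopic.Quotient x y) {q : D.bundle.Total}
    (h : D.bundle.proj q = x) (g : G) :
    D.transport a (D.bundle.act q g) = D.bundle.act (D.transport a q) g :=
  D.flat.hasFlatSections.transport_act a h g

variable {D D'}

/-- Parallel transport commutes with the lift of the deck transformation. -/
theorem transport_lift (hπ : IsDoubleCover E π τ) (a : Path.Homotopic.Quotient x y)
    {q : D.bundle.Total} (h : D.bundle.proj q = x) :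
    D.transport (hπ.translate a) (D.lift q) = D.lift (D.transport a q) := by
  refine D.flat.hasFlatSections.transport_map D.flat.hasFlatSections (f := hπ.deckMap)
    (φ := D.lift) ?_ D.proj_lift a h
  refine continuous_leaf fun U s hs ↦ ?_
  have h1 := (isFlatSection_lift hπ hs).continuousOn_leaf
  have h2 : ContinuousOn τ U := hπ.contMDiff_deck.continuous.continuousOn
  refine (h1.comp h2 fun y hy ↦ ?_).congr fun y hy ↦ ?_
  · rwa [Set.mem_preimage, hπ.deck_deck]
  · simp only [Function.comp, hπ.deck_deck]

/-- An isomorphism commutes with parallel transport. -/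
theorem Iso.transport_comm (f : Diffeomorph (bundleModel E F) (bundleModel E F)
      D.bundle.Total D'.bundle.Total ∞)
    (hf : ∀ q, D'.bundle.proj (f q) = D.bundle.proj q)
    (hform : ∀ (q : D.bundle.Total) (X : TangentSpace (bundleModel E F) q),
      D'.conn.form (f q) (mfderiv (bundleModel E F) (bundleModel E F) f q X) = D.conn.form q X)
    (a : Path.Homotopic.Quotient x y) {q : D.bundle.Total} (h : D.bundle.proj q = x) :
    D'.transport a (f q) = f (D.transport a q) := by
  have hc : Continuous fun l : Leaf D.conn ↦ (⟨f l.pt⟩ : Leaf D'.conn) := by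
    refine continuous_leaf fun U s hs ↦ ?_
    refine IsFlatSection.continuousOn_leaf (A := D'.conn) (s := fun y ↦ f (s y))
      ⟨hs.isOpen, fun y hy ↦ ?_, fun y hy ↦ ?_, fun y hy v ↦ ?_⟩
    · exact f.contMDiff.contMDiffAt.comp_contMDiffWithinAt y (hs.contMDiffOn y hy)
    · rw [hf, hs.proj_eq y hy]
    · have h1 := mfderiv_comp_apply_of_apply_eq (f := s) (g := f) (x := y) rfl
        (f.contMDiff.mdifferentiableAt (by simp)) (hs.mdifferentiableAt hy) v
      refine (congrArg (D'.conn.form (f (s y))) h1).trans ?_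
      exact (hform _ _).trans (hs.form_eq_zero y hy v)
  have := D.flat.hasFlatSections.transport_map D'.flat.hasFlatSections (f := .id N) hc hf a h
  obtain ⟨α, rfl⟩ := Path.Homotopic.Quotient.mk_surjective a
  exact this

end FlatTwistedBundle
end

section

/-! ### Holonomy determines a flat bundle -/

namespace PrincipalConnection.HasFlatSections
open PrincipalBundle
variable {E F : Type*} [NormedAddCommGroup E] [NormedSpace ℝ E]
  [NormedAddCommGroup F] [NormedSpace ℝ F]
  {N : Type v} [TopologicalSpace N] [ChartedSpace E N] [IsManifold 𝓘(ℝ, E) ∞ N]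
  {G : Type w} [TopologicalSpace G] [ChartedSpace F G] [Group G] [LieGroup 𝓘(ℝ, F) ∞ G]
  {P P' : PrincipalBundle E F N G} {A : PrincipalConnection P} {A' : PrincipalConnection P'}

/-- Over a path-connected base, flat bundles with the same holonomy at two base points `q₀`, `q₀'`
of the total spaces are related by a smooth connection-preserving map, which carries the parallel
transports of `q₀` to those of `q₀'`. The values on parallel transports determine the map, and
equality of the holonomies makes it independent of the paths. -/
theorem exists_map_of_holonomy_eq [PathConnectedSpace N] (hA : A.HasFlatSections)
    (hA' : A'.HasFlatSections)
    {x : N} {q₀ : P.Total} {q₀' : P'.Total} (hq : P.proj q₀ = x) (hq' : P'.proj q₀' = x)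
    (hol : ∀ a : Path.Homotopic.Quotient x x, ∃ g, hA.transport a q₀ = P.act q₀ g ∧
      hA'.transport a q₀' = P'.act q₀' g) :
    ∃ f : P.Total → P'.Total, (∀ (y : N) (a : Path.Homotopic.Quotient x y) (k : G),
        f (P.act (hA.transport a q₀) k) = P'.act (hA'.transport a q₀') k) ∧
      ContMDiff (bundleModel E F) (bundleModel E F) ∞ f ∧
      ∀ (q : P.Total) (X : TangentSpace (bundleModel E F) q),
        A'.form (f q) (mfderiv (bundleModel E F) (bundleModel E F) f q X) = A.form q X := by
  have hpath : ∀ y : N, Nonempty (Path.Homotopic.Quotient x y) := fun y ↦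
    ⟨.mk (PathConnectedSpace.somePath x y)⟩
  let p : ∀ y : N, Path.Homotopic.Quotient x y := fun y ↦ (hpath y).some
  let f : P.Total → P'.Total := fun q ↦
    P'.act (hA'.transport (p (P.proj q)) q₀') (div (hA.transport (p (P.proj q)) q₀) q)
  have hf : ∀ (y : N) (a : Path.Homotopic.Quotient x y) (k : G),
      f (P.act (hA.transport a q₀) k) = P'.act (hA'.transport a q₀') k := by
    intro y a k
    have hy : P.proj (P.act (hA.transport a q₀) k) = y := by
      rw [P.proj_act, hA.proj_transport a hq]
    have key : ∀ b : Path.Homotopic.Quotient x y, P'.act (hA'.transport b q₀')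
        (div (hA.transport b q₀) (P.act (hA.transport a q₀) k)) =
          P'.act (hA'.transport a q₀') k := by
      intro b
      obtain ⟨g, hg, hg'⟩ := hol (a.trans b.symm)
      have h1 : hA.transport a q₀ = P.act (hA.transport b q₀) g := by
        rw [← hA.transport_act b hq, ← hg, hA.transport_trans _ _ hq,
          hA.transport_transport_symm b (hA.proj_transport a hq)]
      have h2 : hA'.transport a q₀' = P'.act (hA'.transport b q₀') g := by
        rw [← hA'.transport_act b hq', ← hg', hA'.transport_trans _ _ hq',
          hA'.transport_transport_symm b (hA'.proj_transport a hq')]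
      rw [h1, h2, ← P.act_mul, ← P'.act_mul, div_eq rfl]
    change P'.act (hA'.transport (p (P.proj (P.act (hA.transport a q₀) k))) q₀')
      (div (hA.transport (p (P.proj (P.act (hA.transport a q₀) k))) q₀) _) = _
    rw [hy]
    exact key _
  -- Near each point, `f` is expressed by two flat sections.
  have hloc : ∀ q : P.Total, ∃ (U : Set N) (s : N → P.Total) (s' : N → P'.Total),
      A.IsFlatSection U s ∧ A'.IsFlatSection U s' ∧ P.proj q ∈ U ∧
        ∀ r, P.proj r ∈ U → f r = P'.act (s' (P.proj r)) (div (s (P.proj r)) r) := by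
    intro q
    have hx := hA.proj_transport (p (P.proj q)) hq
    have hx' := hA'.proj_transport (p (P.proj q)) hq'
    obtain ⟨U, s, hs, hU, hsq⟩ := hA (hA.transport (p (P.proj q)) q₀)
    obtain ⟨U', s', hs', hU', hsq'⟩ := hA' (hA'.transport (p (P.proj q)) q₀')
    rw [hx] at hU hsq
    rw [hx'] at hU' hsq'
    obtain ⟨V, hV, hqV, hVU⟩ := exists_isBallLike (E := E)
      ((hs.isOpen.inter hs'.isOpen).mem_nhds ⟨hU, hU'⟩)
    refine ⟨V, s, s', hs.mono hV.isOpen fun y hy ↦ (hVU hy).1,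
      hs'.mono hV.isOpen fun y hy ↦ (hVU hy).2, hqV, fun r hr ↦ ?_⟩
    obtain ⟨β, hβ, -⟩ := hV.exists_path _ hqV _ hr
    have h1 := hA.transport_section hs β fun t ↦ (hVU (hβ t)).1
    have h2 := hA'.transport_section hs' β fun t ↦ (hVU (hβ t)).2
    rw [hsq, ← hA.transport_trans _ _ hq] at h1
    rw [hsq', ← hA'.transport_trans _ _ hq'] at h2
    have h3 := act_div (q := s (P.proj r)) (q' := r) (hs.proj_eq _ (hVU hr).1)
    have h4 := hf _ ((p (P.proj q)).trans (.mk β)) (div (s (P.proj r)) r)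
    rwa [h1, h2, h3] at h4
  have hprem : ∀ (U : Set N) (s : N → P.Total), A.IsFlatSection U s → ∀ q, P.proj q ∈ U →
      ContMDiffAt (bundleModel E F) 𝓘(ℝ, F) ∞ (fun r ↦ div (s (P.proj r)) r) q := by
    intro U s hs q hqU
    refine contMDiffAt_div ((hs.contMDiffAt hqU).comp q P.contMDiff_proj.contMDiffAt)
      contMDiffAt_id ?_
    filter_upwards [P.contMDiff_proj.continuous.continuousAt.preimage_mem_nhds
      (hs.isOpen.mem_nhds hqU)] with r hr
    exact hs.proj_eq _ hr
  have hnear : ∀ (U : Set N) (_ : IsOpen U) (q : P.Total) (_ : P.proj q ∈ U),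
      ∀ᶠ r in 𝓝 q, P.proj r ∈ U := fun U hU q hq ↦
    P.contMDiff_proj.continuous.continuousAt.eventually_mem (hU.mem_nhds hq)
  refine ⟨f, hf, fun q ↦ ?_, fun q X ↦ ?_⟩
  · obtain ⟨U, s, s', hs, hs', hqU, hfU⟩ := hloc q
    refine (contMDiffAt_act ((hs'.contMDiffAt hqU).comp q P.contMDiff_proj.contMDiffAt)
      (hprem U s hs q hqU)).congr_of_eventuallyEq ?_
    filter_upwards [hnear U hs.isOpen q hqU] with r hr
    exact hfU r hr
  · obtain ⟨U, s, s', hs, hs', hqU, hfU⟩ := hloc q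
    have hs'p : MDifferentiableAt (bundleModel E F) (bundleModel E F) (fun r ↦ s' (P.proj r)) q :=
      (hs'.mdifferentiableAt hqU).comp q (P.contMDiff_proj.mdifferentiableAt (by simp))
    have h1 := A'.form_mfderiv_act hs'p ((hprem U s hs q hqU).mdifferentiableAt (by simp)) X
    have h2 : A'.form (s' (P.proj q))
        (mfderiv (bundleModel E F) (bundleModel E F) (fun r ↦ s' (P.proj r)) q X) = 0 := by
      have := mfderiv_comp_apply_of_apply_eq rfl (hs'.mdifferentiableAt hqU)
        (P.contMDiff_proj.mdifferentiableAt (x := q) (by simp)) X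
      exact (congrArg (A'.form (s' (P.proj q))) this).trans (hs'.form_eq_zero _ hqU _)
    rw [h2, adjointAction_zero, zero_add, ← hs.form_eq hqU] at h1
    have e : f =ᶠ[𝓝 q] fun r ↦ P'.act (s' (P.proj r)) (div (s (P.proj r)) r) := by
      filter_upwards [hnear U hs.isOpen q hqU] with r hr
      exact hfU r hr
    refine (A'.form_congr e.self_of_nhds _).trans (Eq.trans ?_ h1)
    exact congrArg (A'.form _) (DFunLike.congr_fun
      (e.mfderiv_eq (I := bundleModel E F) (I' := bundleModel E F)) X)

end PrincipalConnection.HasFlatSections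

/-! ### Holonomy of flat twisted bundles -/

namespace FlatTwistedBundle
open PrincipalBundle PrincipalConnection
variable {E F : Type*} [NormedAddCommGroup E] [NormedSpace ℝ E] [FiniteDimensional ℝ E]
  [NormedAddCommGroup F] [NormedSpace ℝ F] [FiniteDimensional ℝ F]
  {M : Type*} [TopologicalSpace M] [ChartedSpace E M]
  {N : Type v} [TopologicalSpace N] [ChartedSpace E N] [IsManifold 𝓘(ℝ, E) ∞ N]
  {G : Type w} [TopologicalSpace G] [ChartedSpace F G] [Group G] [LieGroup 𝓘(ℝ, F) ∞ G]
  {π : N → M} {τ : N → N} {z : G} {D D' : FlatTwistedBundle E F τ z}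
  (hπ : IsDoubleCover E π τ) {x : N} {c : LoopGroup M (π x)}
  {b : Path.Homotopic.Quotient x (τ x)}

/-- The holonomy condition in terms of homotopy classes; it suffices to test the one class `b` of
paths from `x` to `τ x` over `c`. -/
theorem isHolonomy_iff (hb : hπ.projClass b = c) {q₀ : D.bundle.Total}
    {p : TwistedPair (hπ.onLoops x) c z} :
    IsHolonomy hπ D q₀ p ↔ D.bundle.proj q₀ = x ∧
      (∀ a, D.transport a q₀ = D.bundle.act q₀ (p.hom (loopOf a))⁻¹) ∧
      D.transport b q₀ = D.bundle.act (D.lift q₀) p.elt⁻¹ := by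
  have : CompleteSpace F := FiniteDimensional.complete ℝ F
  have hA := D.flat.hasFlatSections
  refine and_congr_right fun hq ↦ and_congr ⟨fun h a ↦ ?_, fun h α q hα ↦ ?_⟩
    ⟨fun h ↦ ?_, fun h β q hβ hβ' ↦ ?_⟩
  · obtain ⟨α, rfl, hα⟩ := hA.exists_isTransport a hq
    exact h α _ hα
  · rw [hA.eq_transport_of_isTransport hα]
    exact h _
  · obtain ⟨β, rfl, hβ⟩ := hA.exists_isTransport b hq
    exact h β _ hb hβ
  · rw [hA.eq_transport_of_isTransport hβ']
    have : b = .mk β := hπ.projClass_injective (hb.trans hβ.symm)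
    rw [← this]
    exact h

/-- Every flat twisted bundle has a holonomy with respect to every base point. -/
theorem exists_isHolonomy (hb : hπ.projClass b = c) (hz : z ∈ Subgroup.center G)
    {q₀ : D.bundle.Total} (hq : D.bundle.proj q₀ = x) :
    ∃ p : TwistedPair (hπ.onLoops x) c z, IsHolonomy hπ D q₀ p := by
  have hdiv : ∀ a : Path.Homotopic.Quotient x x,
      D.bundle.act q₀ (div q₀ (D.transport a q₀)) = D.transport a q₀ := fun a ↦
    act_div (by rw [hq, D.proj_transport a hq])
  let φ : LoopGroup N x →* G :=
    { toFun a := (div q₀ (D.transport a.unop q₀))⁻¹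
      map_one' := by
        rw [inv_eq_one]
        exact div_eq ((D.bundle.act_one q₀).trans
          (D.flat.hasFlatSections.transport_refl hq).symm)
      map_mul' a a' := by
        rw [← mul_inv_rev, inv_inj]
        refine div_eq ?_
        rw [D.bundle.act_mul, hdiv, ← D.transport_act _ hq, hdiv]
        exact (D.transport_trans a.unop a'.unop hq).symm }
  have hφ : ∀ a, D.transport a q₀ = D.bundle.act q₀ (φ (loopOf a))⁻¹ := fun a ↦ by
    change _ = D.bundle.act q₀ (div q₀ (D.transport a q₀))⁻¹⁻¹
    rw [inv_inv, hdiv]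
  obtain ⟨g, hg⟩ : ∃ g, D.transport b q₀ = D.bundle.act (D.lift q₀) g⁻¹ := by
    refine ⟨(div (D.lift q₀) (D.transport b q₀))⁻¹, ?_⟩
    rw [inv_inv, act_div (by rw [D.proj_lift, hq, D.proj_transport b hq])]
  have hql : D.bundle.proj (D.lift q₀) = τ x := by rw [D.proj_lift, hq]
  refine ⟨⟨φ, g, fun a ↦ ?_, ?_⟩, (isHolonomy_iff hπ hb).2 ⟨hq, hφ, hg⟩⟩
  · obtain ⟨a, rfl⟩ := loopOf_surjective a
    -- the loop `a'` over `c π(a) c⁻¹`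
    set a' : Path.Homotopic.Quotient x x := (b.trans (hπ.translate a)).trans b.symm
    have ha' : a'.trans b = b.trans (hπ.translate a) := by
      simp only [a', Path.Homotopic.Quotient.trans_assoc, Path.Homotopic.Quotient.symm_trans,
        Path.Homotopic.Quotient.trans_refl]
    refine ⟨loopOf a', ?_, ?_⟩
    · rw [eq_mul_inv_iff_mul_eq, ← hb, ← hπ.projClass_trans, ← hπ.projClass_trans_deck, ha']
    · have h1 : D.transport (a'.trans b) q₀ =
          D.bundle.act (D.lift q₀) (g⁻¹ * (φ (loopOf a'))⁻¹) := by
        rw [D.transport_trans _ _ hq, hφ, D.transport_act _ hq, hg, D.bundle.act_mul]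
      have h2 : D.transport (b.trans (hπ.translate a)) q₀ =
          D.bundle.act (D.lift q₀) ((φ (loopOf a))⁻¹ * g⁻¹) := by
        refine (D.transport_trans b (hπ.translate a) hq).trans ?_
        rw [hg]
        refine (D.transport_act (hπ.translate a) hql g⁻¹).trans ?_
        rw [transport_lift hπ a hq, hφ, D.lift_act, D.bundle.act_mul]
      rw [ha', h2] at h1
      have h3 := act_right_injective h1
      rw [← inv_inj]
      simp only [mul_inv_rev, inv_inv]
      rw [h3, mul_inv_cancel_left]
  · refine ⟨_, (hπ.onLoops_trans_deck b).trans (by rw [hb]), ?_⟩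
    have h1 : D.transport (b.trans (hπ.translate b)) q₀ = D.bundle.act q₀ (z * g⁻¹ * g⁻¹) := by
      refine (D.transport_trans b (hπ.translate b) hq).trans ?_
      rw [hg]
      refine (D.transport_act (hπ.translate b) hql g⁻¹).trans ?_
      rw [transport_lift hπ b hq, hg, D.lift_act, D.lift_lift, D.bundle.act_mul, D.bundle.act_mul]
    have h2 := hφ ((b.trans (hπ.translate b)).cast rfl (hπ.deck_deck x).symm)
    have h3 := D.flat.hasFlatSections.transport_cast (b.trans (hπ.translate b))
      (hπ.deck_deck x).symm q₀
    have h4 := act_right_injective (h2.symm.trans (h3.trans h1))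
    change g ^ 2 * (φ (loopOf _))⁻¹ = z
    rw [h4, mul_assoc z, ← Subgroup.mem_center_iff.1 hz]
    group

/-- The holonomies with respect to two base points are conjugate. -/
theorem conj_of_isHolonomy (hb : hπ.projClass b = c) {q₀ q₁ : D.bundle.Total}
    {p p' : TwistedPair (hπ.onLoops x) c z} (h : IsHolonomy hπ D q₀ p)
    (h' : IsHolonomy hπ D q₁ p') : TwistedPair.conjSetoid (hπ.onLoops x) c z p p' := by
  rw [isHolonomy_iff hπ hb] at h h'
  obtain ⟨hq, h1, h2⟩ := h
  obtain ⟨hq', h1', h2'⟩ := h'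
  obtain ⟨k, rfl⟩ := exists_act_eq (hq.trans hq'.symm)
  refine ⟨k⁻¹, fun a ↦ ?_, ?_⟩
  · obtain ⟨a, rfl⟩ := loopOf_surjective a
    have := h1' a
    rw [D.transport_act a hq, h1, ← D.bundle.act_mul, ← D.bundle.act_mul] at this
    have h3 := act_right_injective this
    rw [← inv_inj, eq_inv_mul_of_mul_eq h3.symm]
    group
  · rw [D.transport_act b hq, h2, D.lift_act, ← D.bundle.act_mul, ← D.bundle.act_mul] at h2'
    have h3 := act_right_injective h2'
    rw [← inv_inj, eq_inv_mul_of_mul_eq h3.symm]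
    group

/-- Every pair conjugate to the holonomy is the holonomy with respect to another base point. -/
theorem exists_isHolonomy_of_conj (hb : hπ.projClass b = c) {q₀ : D.bundle.Total}
    {p p' : TwistedPair (hπ.onLoops x) c z} (h : IsHolonomy hπ D q₀ p)
    (hp : TwistedPair.conjSetoid (hπ.onLoops x) c z p p') : ∃ q₁, IsHolonomy hπ D q₁ p' := by
  rw [isHolonomy_iff hπ hb] at h
  obtain ⟨hq, h1, h2⟩ := h
  obtain ⟨k, hk, hk'⟩ := hp
  refine ⟨D.bundle.act q₀ k⁻¹, (isHolonomy_iff hπ hb).2 ⟨by rw [D.bundle.proj_act, hq],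
    fun a ↦ ?_, ?_⟩⟩
  · rw [D.transport_act a hq, h1, hk, ← D.bundle.act_mul, ← D.bundle.act_mul]
    congr 1
    group
  · rw [D.transport_act b hq, h2, hk', D.lift_act, ← D.bundle.act_mul, ← D.bundle.act_mul]
    congr 1
    group

/-- Isomorphic bundles have the same holonomies. -/
theorem Iso.exists_isHolonomy (hb : hπ.projClass b = c) (e : Iso D D') {q₀ : D.bundle.Total}
    {p : TwistedPair (hπ.onLoops x) c z} (h : IsHolonomy hπ D q₀ p) :
    ∃ q₀', IsHolonomy hπ D' q₀' p := by
  rw [isHolonomy_iff hπ hb] at h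
  obtain ⟨hq, h1, h2⟩ := h
  obtain ⟨f, hf, hact, hlift, hform⟩ := e
  refine ⟨f q₀, (isHolonomy_iff hπ hb).2 ⟨by rw [hf, hq], fun a ↦ ?_, ?_⟩⟩
  · rw [Iso.transport_comm f hf hform a hq, h1, hact]
  · rw [Iso.transport_comm f hf hform b hq, h2, hact, hlift]

/-- Bundles with the same holonomy are isomorphic, by the map that matches the parallel transports
of the two base points. -/
theorem iso_of_isHolonomy [PathConnectedSpace N] (hb : hπ.projClass b = c)
    {q₀ : D.bundle.Total} {q₀' : D'.bundle.Total}
    {p : TwistedPair (hπ.onLoops x) c z} (h : IsHolonomy hπ D q₀ p)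
    (h' : IsHolonomy hπ D' q₀' p) : Iso D D' := by
  rw [isHolonomy_iff hπ hb] at h h'
  obtain ⟨hq, h1, h2⟩ := h
  obtain ⟨hq', h1', h2'⟩ := h'
  obtain ⟨f, hf, hfs, hform⟩ := D.flat.hasFlatSections.exists_map_of_holonomy_eq
    D'.flat.hasFlatSections hq hq' fun a ↦ ⟨_, h1 a, h1' a⟩
  obtain ⟨f', hf', hfs', -⟩ := D'.flat.hasFlatSections.exists_map_of_holonomy_eq
    D.flat.hasFlatSections hq' hq fun a ↦ ⟨_, h1' a, h1 a⟩
  have hex : ∀ (D : FlatTwistedBundle E F τ z) (q₀ q : D.bundle.Total) (_ : D.bundle.proj q₀ = x),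
      ∃ (a : Path.Homotopic.Quotient x (D.bundle.proj q)) (k : G),
        D.bundle.act (D.transport a q₀) k = q := fun D q₀ q hq ↦ by
    let a : Path.Homotopic.Quotient x (D.bundle.proj q) := .mk (PathConnectedSpace.somePath _ _)
    obtain ⟨k, hk⟩ := exists_act_eq (D.proj_transport a hq)
    exact ⟨a, k, hk⟩
  have hleft : ∀ q, f' (f q) = q := fun q ↦ by
    obtain ⟨a, k, hk⟩ := hex D q₀ q hq
    rw [← hk]
    exact (congrArg f' (hf _ a k)).trans (hf' _ a k)
  have hright : ∀ q, f (f' q) = q := fun q ↦ by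
    obtain ⟨a, k, hk⟩ := hex D' q₀' q hq'
    rw [← hk]
    exact (congrArg f (hf' _ a k)).trans (hf _ a k)
  refine ⟨⟨⟨f, f', hleft, hright⟩, hfs, hfs'⟩, fun q ↦ ?_, fun q g ↦ ?_, fun q ↦ ?_, hform⟩
  · obtain ⟨a, k, hk⟩ := hex D q₀ q hq
    have h3 : f q = D'.bundle.act (D'.transport a q₀') k :=
      (congrArg f hk.symm).trans (hf _ a k)
    change D'.bundle.proj (f q) = _
    rw [h3, D'.bundle.proj_act, D'.proj_transport a hq']
  · obtain ⟨a, k, hk⟩ := hex D q₀ q hq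
    change f (D.bundle.act q g) = D'.bundle.act (f q) g
    rw [← hk, ← D.bundle.act_mul]
    refine (hf _ a (k * g)).trans ?_
    rw [D'.bundle.act_mul]
    exact congrArg (fun q ↦ D'.bundle.act q g) (hf _ a k).symm
  · obtain ⟨a, k, hk⟩ := hex D q₀ q hq
    change f (D.lift q) = D'.lift (f q)
    -- the lift is determined by parallel transport, `b` and `g`
    have key : ∀ (D : FlatTwistedBundle E F τ z) (q₀ : D.bundle.Total) (_ : D.bundle.proj q₀ = x)
        (_ : D.transport b q₀ = D.bundle.act (D.lift q₀) p.elt⁻¹) (k : G),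
        D.lift (D.bundle.act (D.transport a q₀) k) =
          D.bundle.act (D.transport (b.trans (hπ.translate a)) q₀) (p.elt * k) := by
      intro D q₀ hq h2 k
      have hql : D.bundle.proj (D.lift q₀) = τ x := by rw [D.proj_lift, hq]
      have h3 : D.transport (b.trans (hπ.translate a)) q₀ =
          D.bundle.act (D.lift (D.transport a q₀)) p.elt⁻¹ := by
        refine (D.transport_trans b (hπ.translate a) hq).trans ?_
        rw [h2]
        refine (D.transport_act (hπ.translate a) hql _).trans ?_
        rw [transport_lift hπ a hq]
      rw [h3, ← D.bundle.act_mul, D.lift_act]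
      congr 1
      group
    rw [← hk, key D q₀ hq h2 k]
    refine (hf _ (b.trans (hπ.translate a)) _).trans ?_
    refine (key D' q₀' hq' h2' k).symm.trans ?_
    exact congrArg D'.lift (hf _ a k).symm

end FlatTwistedBundle
end

section

/-! ### Brackets of vector fields tangent to level sets -/

section Bracket
variable {E F : Type*} [NormedAddCommGroup E] [NormedSpace ℝ E]
  [NormedAddCommGroup F] [NormedSpace ℝ F]

/-- If the derivative of `f` vanishes on two vector fields, it vanishes on their bracket, by the
symmetry of the second derivative. -/
theorem fderiv_lieBracket_eq_zero {f : E → F} {V W : E → E} {x : E} (hf : ContDiffAt ℝ ∞ f x)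
    (hV : DifferentiableAt ℝ V x) (hW : DifferentiableAt ℝ W x)
    (hfV : ∀ᶠ y in 𝓝 x, fderiv ℝ f y (V y) = 0) (hfW : ∀ᶠ y in 𝓝 x, fderiv ℝ f y (W y) = 0) :
    fderiv ℝ f x (VectorField.lieBracket ℝ V W x) = 0 := by
  have hf' : DifferentiableAt ℝ (fderiv ℝ f) x :=
    (hf.fderiv_right (m := ∞) (by simp)).differentiableAt (by simp)
  have key : ∀ X : E → E, DifferentiableAt ℝ X x → (∀ᶠ y in 𝓝 x, fderiv ℝ f y (X y) = 0) →
      ∀ w, fderiv ℝ f x (fderiv ℝ X x w) = - fderiv ℝ (fderiv ℝ f) x w (X x) := by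
    intro X hX hfX w
    have h1 := hf'.hasFDerivAt.clm_apply hX.hasFDerivAt
    have h2 : (fun y ↦ fderiv ℝ f y (X y)) =ᶠ[𝓝 x] fun _ ↦ 0 := hfX
    have h3 := (h1.congr_of_eventuallyEq h2.symm).unique (hasFDerivAt_const (0 : F) x)
    have h4 := DFunLike.congr_fun h3 w
    simp only [add_apply, ContinuousLinearMap.comp_apply, ContinuousLinearMap.flip_apply,
      zero_apply] at h4
    exact eq_neg_of_add_eq_zero_left h4
  have hsymm : IsSymmSndFDerivAt ℝ f x := hf.isSymmSndFDerivAt (by simpa using ENat.LEInfty.out)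
  rw [VectorField.lieBracket, map_sub, key W hW hfW, key V hV hfV, hsymm.eq, sub_self]

variable {H : Type*} [TopologicalSpace H] {I : ModelWithCorners ℝ E H} [I.Boundaryless]
  {M : Type*} [TopologicalSpace M] [ChartedSpace H M] [IsManifold I ∞ M] [CompleteSpace E]

/-- If the differential of `f` vanishes on two vector fields near `x`, it vanishes on their bracket
at `x`. -/
theorem mfderiv_mlieBracket_eq_zero {f : M → F} {V W : ∀ p : M, TangentSpace I p} {x : M}
    (hf : ContMDiffAt I 𝓘(ℝ, F) ∞ f x)
    (hV : ContMDiffAt I I.tangent ∞ (fun p ↦ (⟨p, V p⟩ : TangentBundle I M)) x)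
    (hW : ContMDiffAt I I.tangent ∞ (fun p ↦ (⟨p, W p⟩ : TangentBundle I M)) x)
    (hfV : ∀ᶠ p in 𝓝 x, (mfderiv I 𝓘(ℝ, F) f p (V p) : F) = 0)
    (hfW : ∀ᶠ p in 𝓝 x, (mfderiv I 𝓘(ℝ, F) f p (W p) : F) = 0) :
    (mfderiv I 𝓘(ℝ, F) f x (VectorField.mlieBracket I V W x) : F) = 0 := by
  have : IsManifold I (minSmoothness ℝ 2) M :=
    IsManifold.of_le (n := ∞) (by simpa using ENat.LEInfty.out)
  set θ : E → M := fun y ↦ (extChartAt I x).symm y with hθ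
  set u : E := extChartAt I x x with hu
  have hθu : θ u = x := extChartAt_to_inv x
  have htgt : ∀ᶠ y in 𝓝 u, y ∈ (extChartAt I x).target :=
    (isOpen_extChartAt_target x).mem_nhds (mem_extChartAt_target x)
  have hθs : ∀ y ∈ (extChartAt I x).target, ContMDiffAt 𝓘(ℝ, E) I ∞ θ y := fun y hy ↦
    (contMDiffOn_extChartAt_symm x).contMDiffAt ((isOpen_extChartAt_target x).mem_nhds hy)
  have hinv : ∀ y ∈ (extChartAt I x).target, (mfderiv 𝓘(ℝ, E) I θ y).IsInvertible := fun y hy ↦ by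
    have := isInvertible_mfderivWithin_extChartAt_symm (I := I) hy
    rwa [I.range_eq_univ, mfderivWithin_univ] at this
  have hθc : ContinuousAt θ u := (hθs u (mem_extChartAt_target x)).continuousAt
  have hfs : ∀ᶠ p in 𝓝 x, MDifferentiableAt I 𝓘(ℝ, F) f p := by
    have : IsManifold I 1 M := IsManifold.of_le (n := ∞) (by simp)
    have h1 : ∀ᶠ p in 𝓝 x, ContMDiffAt I 𝓘(ℝ, F) 1 f p :=
      (contMDiffAt_iff_contMDiffAt_nhds (by simp)).1
        (hf.of_le (n := ∞) (by simp))
    filter_upwards [h1] with p hp using hp.mdifferentiableAt (by simp)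
  -- the differential of `f` on `X` is the derivative of `f ∘ θ` on the pullback of `X`
  have hcoord : ∀ X : ∀ p : M, TangentSpace I p,
      ∀ᶠ y in 𝓝 u, (fderiv ℝ (fun z ↦ f (θ z)) y
        (VectorField.mpullback 𝓘(ℝ, E) I θ X y : E) : F) =
          mfderiv I 𝓘(ℝ, F) f (θ y) (X (θ y)) := by
    intro X
    have hfs' := hθc.eventually (hθu.symm ▸ hfs)
    filter_upwards [hfs', htgt] with y hy hyt
    have h1 := mfderiv_comp_apply_of_apply_eq (f := θ) (g := f) (x := y) rfl hy
      ((hθs y hyt).mdifferentiableAt (by simp))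
      (VectorField.mpullback 𝓘(ℝ, E) I θ X y)
    have h2 : mfderiv 𝓘(ℝ, E) I θ y (VectorField.mpullback 𝓘(ℝ, E) I θ X y) = X (θ y) := by
      exact ((hinv y hyt).inverse_apply_eq.1 rfl).symm
    rw [h2] at h1
    exact (DFunLike.congr_fun (mfderiv_eq_fderiv (f := fun z ↦ f (θ z))).symm _).trans h1
  have hdiff : ∀ X : ∀ p : M, TangentSpace I p,
      ContMDiffAt I I.tangent ∞ (fun p ↦ (⟨p, X p⟩ : TangentBundle I M)) x →
      DifferentiableAt ℝ (fun y ↦ (VectorField.mpullback 𝓘(ℝ, E) I θ X y : E)) u := by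
    intro X hX
    have h1 : ContMDiffAt 𝓘(ℝ, E) (𝓘(ℝ, E)).tangent ∞ (fun y ↦
        (⟨y, VectorField.mpullback 𝓘(ℝ, E) I θ X y⟩ : TangentBundle 𝓘(ℝ, E) E)) u :=
      ContMDiffAt.mpullback_vectorField_preimage (hθu.symm ▸ hX)
        (hθs u (mem_extChartAt_target x)) (hinv u (mem_extChartAt_target x)) (by simp)
    exact (contMDiffAt_vectorSpace_iff_contDiffAt.1 h1).differentiableAt (by simp)
  have hev : ∀ X : ∀ p : M, TangentSpace I p,
      (∀ᶠ p in 𝓝 x, (mfderiv I 𝓘(ℝ, F) f p (X p) : F) = 0) →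
      ∀ᶠ y in 𝓝 u, (fderiv ℝ (fun z ↦ f (θ z)) y
        (VectorField.mpullback 𝓘(ℝ, E) I θ X y : E) : F) = 0 := by
    intro X hX
    filter_upwards [hcoord X, hθc.eventually (hθu.symm ▸ hX)] with y hy hy'
    exact hy.trans hy'
  have hfθ : ContDiffAt ℝ ∞ (fun z ↦ f (θ z)) u := by
    have : ContMDiffAt 𝓘(ℝ, E) 𝓘(ℝ, F) ∞ (fun z ↦ f (θ z)) u :=
      ContMDiffAt.comp u (hθu.symm ▸ hf) (hθs u (mem_extChartAt_target x))
    exact this.contDiffAt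
  have h0 := fderiv_lieBracket_eq_zero hfθ (hdiff V hV) (hdiff W hW) (hev V hfV) (hev W hfW)
  have hbr := VectorField.mpullback_mlieBracket (I := 𝓘(ℝ, E)) (I' := I) (f := θ) (x₀ := u)
    (V := V) (W := W) (n := ∞)
    (hθu.symm ▸ hV.mdifferentiableAt (by simp)) (hθu.symm ▸ hW.mdifferentiableAt (by simp))
    (hθs u (mem_extChartAt_target x)) (by simpa using ENat.LEInfty.out)
  have h1 := (hcoord (VectorField.mlieBracket I V W)).self_of_nhds
  rw [hθu] at h1
  have h2 : VectorField.mlieBracket 𝓘(ℝ, E) (VectorField.mpullback 𝓘(ℝ, E) I θ V)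
      (VectorField.mpullback 𝓘(ℝ, E) I θ W) u =
      VectorField.lieBracket ℝ (fun y ↦ (VectorField.mpullback 𝓘(ℝ, E) I θ V y : E))
        (fun y ↦ (VectorField.mpullback 𝓘(ℝ, E) I θ W y : E)) u := by
    rw [← VectorField.mlieBracketWithin_univ,
      VectorField.mlieBracketWithin_eq_lieBracketWithin]
    exact congrFun VectorField.lieBracketWithin_univ u
  exact h1.symm.trans ((congrArg (fderiv ℝ (fun z ↦ f (θ z)) u) (hbr.trans h2)).trans h0)

end Bracket

/-! ### Smoothness of the Maurer–Cartan form -/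

/-- The Maurer–Cartan form is smooth: it is the restriction of the tangent map of
`(g, h) ↦ g⁻¹ h` to the vectors `(0, X)` over the diagonal. -/
theorem contMDiff_maurerCartan {F : Type*} [NormedAddCommGroup F] [NormedSpace ℝ F]
    {G : Type*} [TopologicalSpace G] [ChartedSpace F G] [Group G] [LieGroup 𝓘(ℝ, F) ∞ G] :
    ContMDiff (M' := F) (𝓘(ℝ, F)).tangent 𝓘(ℝ, F) ∞
      (fun X : TangentBundle 𝓘(ℝ, F) G ↦ maurerCartan F X.1 X.2) := by
  have : IsManifold 𝓘(ℝ, F) ∞ G := inferInstance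
  let fz : TangentBundle 𝓘(ℝ, F) G → TangentBundle 𝓘(ℝ, F) G := fun X ↦ ⟨X.1, 0⟩
  have hfz : ContMDiff (𝓘(ℝ, F)).tangent (𝓘(ℝ, F)).tangent ∞ fz :=
    (Bundle.contMDiff_zeroSection ℝ (TangentSpace 𝓘(ℝ, F))).comp
      (Bundle.contMDiff_proj (TangentSpace 𝓘(ℝ, F)))
  have hm : ContMDiff ((𝓘(ℝ, F)).prod 𝓘(ℝ, F)) 𝓘(ℝ, F) ∞ (fun p : G × G ↦ p.1⁻¹ * p.2) :=
    (contMDiff_fst.inv).mul contMDiff_snd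
  have hT : ContMDiff (𝓘(ℝ, F)).tangent (𝓘(ℝ, F)).tangent ∞
      (fun X : TangentBundle 𝓘(ℝ, F) G ↦
        tangentMap ((𝓘(ℝ, F)).prod 𝓘(ℝ, F)) 𝓘(ℝ, F) (fun p : G × G ↦ p.1⁻¹ * p.2)
          ((equivTangentBundleProd 𝓘(ℝ, F) G 𝓘(ℝ, F) G).symm (fz X, X))) :=
    (hm.contMDiff_tangentMap (m := ∞) (by simp)).comp
      (contMDiff_equivTangentBundleProd_symm.comp (hfz.prodMk contMDiff_id))
  have hval : ∀ X : TangentBundle 𝓘(ℝ, F) G,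
      (tangentMap ((𝓘(ℝ, F)).prod 𝓘(ℝ, F)) 𝓘(ℝ, F) (fun p : G × G ↦ p.1⁻¹ * p.2)
          ((equivTangentBundleProd 𝓘(ℝ, F) G 𝓘(ℝ, F) G).symm (fz X, X))).2 =
        (maurerCartan F X.1 X.2 : F) := by
    intro X
    have h1 := mfderiv_prod_eq_add_apply (v := ((0, X.2) : F × F))
      (hm.mdifferentiableAt (x := (X.1, X.1)) (n := ∞) (by simp))
    have h2 : (mfderiv 𝓘(ℝ, F) 𝓘(ℝ, F) (fun z : G ↦ z⁻¹ * X.1) X.1 (0 : F) : F) = 0 :=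
      map_zero (mfderiv 𝓘(ℝ, F) 𝓘(ℝ, F) (fun z : G ↦ z⁻¹ * X.1) X.1)
    exact h1.trans ((congrArg (· + (maurerCartan F X.1 X.2 : F)) h2).trans (zero_add _))
  -- the values of the tangent map lie over `1`, where the trivialization of the tangent bundle at
  -- `1` is the identity
  have htriv : ∀ (a b : G) (_ : a = 1) (_ : b = 1) (v : F),
      (trivializationAt F (TangentSpace 𝓘(ℝ, F)) b (⟨a, v⟩ : TangentBundle 𝓘(ℝ, F) G)).2 = v := by
    rintro _ _ rfl rfl v
    exact tangentCoordChange_self (I := 𝓘(ℝ, F)) (x := (1 : G)) (z := 1) (mem_extChartAt_source 1)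
  intro X
  have h := (Bundle.contMDiffAt_totalSpace.1 (hT X)).2
  refine h.congr_of_eventuallyEq (Filter.Eventually.of_forall fun Y ↦ ?_)
  refine ((htriv _ _ ?_ ?_ _).trans (hval Y)).symm <;> exact inv_mul_cancel _

/-! ### Manifolds with charts in a manifold -/

section Comp
variable {E : Type*} [NormedAddCommGroup E] [NormedSpace ℝ E] {H : Type*} [TopologicalSpace H]
  (I : ModelWithCorners ℝ E H) {X : Type*} [TopologicalSpace X] [ChartedSpace H X]
  [IsManifold I ∞ X] {T : Type*} [TopologicalSpace T] [ChartedSpace X T]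

/-- A space with charts in a manifold `X` and smooth coordinate changes is a manifold. -/
theorem isManifold_comp
    (hT : ∀ e ∈ atlas X T, ∀ e' ∈ atlas X T,
      ContMDiffOn I I ∞ (e.symm ≫ₕ e') (e.symm ≫ₕ e').source) :
    @IsManifold ℝ _ E _ _ H _ I ∞ T _ (ChartedSpace.comp H X T) := by
  let _ := ChartedSpace.comp H X T
  refine isManifold_of_contDiffOn I ∞ T ?_
  rintro _ _ ⟨e, he, c, hc, rfl⟩ ⟨e', he', c', hc', rfl⟩
  rw [← contMDiffOn_iff_contDiffOn]
  have h1 : ContMDiffOn 𝓘(ℝ, E) I ∞ (c.extend I).symm (I '' c.target) :=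
    contMDiffOn_extend_symm (IsManifold.subset_maximalAtlas hc)
  have h2 : ContMDiffOn I 𝓘(ℝ, E) ∞ (I ∘ c') c'.source :=
    I.contMDiff.comp_contMDiffOn
      (contMDiffOn_of_mem_maximalAtlas (IsManifold.subset_maximalAtlas hc'))
  refine (h2.comp' ((hT e he e' he').comp' h1)).mono ?_
  rintro _ ⟨hu, u, rfl⟩
  simp only [OpenPartialHomeomorph.trans_source, OpenPartialHomeomorph.symm_source,
    OpenPartialHomeomorph.trans_target, OpenPartialHomeomorph.coe_trans_symm, Set.mem_inter_iff,
    Set.mem_preimage, Function.comp_apply, I.left_inv] at hu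
  refine ⟨⟨⟨u, hu.1.1, rfl⟩, ?_⟩, ?_⟩
  · simpa [OpenPartialHomeomorph.trans_source] using ⟨hu.1.2, hu.2.1⟩
  · simpa using hu.2.2

/-- The charts with values in `X` of a space as in `isManifold_comp` are smooth in both
directions. -/
theorem contMDiffOn_of_mem_atlas_comp
    (hT : ∀ e ∈ atlas X T, ∀ e' ∈ atlas X T, ContMDiffOn I I ∞ (e.symm ≫ₕ e') (e.symm ≫ₕ e').source)
    {e : OpenPartialHomeomorph T X} (he : e ∈ atlas X T) :
    let _ := ChartedSpace.comp H X T
    ContMDiffOn I I ∞ e e.source ∧ ContMDiffOn I I ∞ e.symm e.target := by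
  intro _
  have : IsManifold I ∞ T := isManifold_comp I hT
  have hmem : ∀ x : X, e ≫ₕ chartAt H x ∈ IsManifold.maximalAtlas I ∞ T := fun x ↦
    IsManifold.subset_maximalAtlas ⟨e, he, _, chart_mem_atlas H x, rfl⟩
  constructor
  · intro p hp
    have h1 := contMDiffOn_of_mem_maximalAtlas (hmem (e p))
    have h2 : ContMDiffOn I I ∞ (chartAt H (e p)).symm (chartAt H (e p)).target :=
      contMDiffOn_symm_of_mem_maximalAtlas (IsManifold.chart_mem_maximalAtlas (e p))
    have hs : p ∈ (e ≫ₕ chartAt H (e p)).source := ⟨hp, mem_chart_source H (e p)⟩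
    have h3 := ((h2 _ ((chartAt H (e p)).map_source (mem_chart_source H (e p)))).contMDiffAt
      ((chartAt H (e p)).open_target.mem_nhds
        ((chartAt H (e p)).map_source (mem_chart_source H (e p))))).comp p
      (h1.contMDiffAt ((e ≫ₕ chartAt H (e p)).open_source.mem_nhds hs))
    refine (h3.congr_of_eventuallyEq ?_).contMDiffWithinAt
    filter_upwards [(e ≫ₕ chartAt H (e p)).open_source.mem_nhds hs] with p' hp'
    exact ((chartAt H (e p)).left_inv hp'.2).symm
  · intro x hx
    have h1 := contMDiffOn_symm_of_mem_maximalAtlas (hmem x)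
    have h2 : ContMDiffOn I I ∞ (chartAt H x) (chartAt H x).source :=
      contMDiffOn_of_mem_maximalAtlas (IsManifold.chart_mem_maximalAtlas x)
    have ht : chartAt H x x ∈ (e ≫ₕ chartAt H x).target := by
      simp [hx]
    have h3 := (h1.contMDiffAt ((e ≫ₕ chartAt H x).open_target.mem_nhds ht)).comp x
      (h2.contMDiffAt ((chartAt H x).open_source.mem_nhds (mem_chart_source H x)))
    refine (h3.congr_of_eventuallyEq ?_).contMDiffWithinAt
    filter_upwards [(chartAt H x).open_source.mem_nhds (mem_chart_source H x)] with y hy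
    exact congrArg e.symm ((chartAt H x).left_inv hy).symm

end Comp

end

noncomputable section

/-! ### The flat bundle of a locally constant cocycle -/

/-- A cocycle with values in `G` that is locally constant, with respect to an open cover of `N`
indexed by the points of `N`. The cocycle `t i j` changes coordinates from `U i` to `U j`. -/
structure FlatCocycle (N : Type v) [TopologicalSpace N] (G : Type w) [Group G] where
  /-- The open cover. -/
  U : N → Set N
  isOpen : ∀ i, IsOpen (U i)
  mem : ∀ i, i ∈ U i
  /-- The cocycle. -/
  t : N → N → N → G
  t_self : ∀ i, ∀ y ∈ U i, t i i y = 1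
  t_comp : ∀ i j k, ∀ y ∈ U i, y ∈ U j → y ∈ U k → t j k y * t i j y = t i k y
  t_eventually : ∀ i j, ∀ y ∈ U i, y ∈ U j → ∀ᶠ y' in 𝓝 y, t i j y' = t i j y

namespace FlatCocycle
variable {N : Type v} [TopologicalSpace N] {G : Type w} [TopologicalSpace G] [Group G]
  [IsTopologicalGroup G] (Z : FlatCocycle N G)

/-- The fibre bundle core given by the cocycle. -/
def core : FiberBundleCore N N G where
  baseSet := Z.U
  isOpen_baseSet := Z.isOpen
  indexAt := id
  mem_baseSet_at := Z.mem
  coordChange i j y h := Z.t i j y * h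
  coordChange_self i y hy h := by rw [Z.t_self i y hy, one_mul]
  continuousOn_coordChange i j := by
    rintro ⟨y, h⟩ ⟨hy, -⟩
    have h1 : ContinuousAt (fun p : N × G ↦ Z.t i j y * p.2) (y, h) := by fun_prop
    refine (h1.congr ?_).continuousWithinAt
    have h2 := (continuous_fst.continuousAt (x := (y, h))).eventually
      (Z.t_eventually i j y hy.1 hy.2)
    filter_upwards [h2] with p hp
    rw [hp]
  coordChange_comp i j k y hy h := by
    rw [← mul_assoc, Z.t_comp i j k y hy.1.1 hy.1.2 hy.2]

/-- The total space of the bundle of the cocycle. It carries the smooth structure given by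
`chartedSpaceProd`, not one of those that Mathlib puts on total spaces of bundles. -/
def Total : Type (max v w) := Bundle.TotalSpace G Z.core.Fiber

instance : TopologicalSpace Z.Total :=
  inferInstanceAs (TopologicalSpace (Bundle.TotalSpace G Z.core.Fiber))

/-- The local trivialization over `Z.U i`. -/
def triv (i : N) : OpenPartialHomeomorph Z.Total (N × G) :=
  (Z.core.localTriv i).toOpenPartialHomeomorph

/-- The projection of the bundle. -/
def proj (q : Z.Total) : N := Bundle.TotalSpace.proj (F := G) (E := Z.core.Fiber) q

/-- The coordinate in `G` given by the trivialization over `Z.U i`. -/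
def coord (i : N) (q : Z.Total) : G := (Z.triv i q).2

/-- The point over `y` with the given coordinate in the trivialization over `Z.U i`. -/
def pt (i y : N) (h : G) : Z.Total := (Z.triv i).symm (y, h)

/-- The right action of `G`. It commutes with the coordinate changes, which are left
translations. -/
def act (q : Z.Total) (g : G) : Z.Total :=
  Bundle.TotalSpace.mk (F := G) (E := Z.core.Fiber) q.1 (show G from (show G from q.2) * g)

variable {Z} {i j y : N} {q : Z.Total}

theorem proj_pt {h : G} : Z.proj (Z.pt i y h) = y := rfl

theorem coord_pt (hy : y ∈ Z.U i) (h : G) : Z.coord i (Z.pt i y h) = h :=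
  congrArg Prod.snd ((Z.triv i).right_inv (x := (y, h)) ⟨hy, trivial⟩)

theorem pt_coord (hq : Z.proj q ∈ Z.U i) : Z.pt i (Z.proj q) (Z.coord i q) = q :=
  (Z.triv i).left_inv (x := q) hq

theorem coord_change (hi : Z.proj q ∈ Z.U i) (hj : Z.proj q ∈ Z.U j) :
    Z.coord j q = Z.t i j (Z.proj q) * Z.coord i q := by
  have h := Z.t_comp (Z.proj q) i j (Z.proj q) (Z.mem _) hi hj
  exact (congrArg (· * (show G from q.2)) h.symm).trans (mul_assoc _ _ _)

theorem pt_change (hi : y ∈ Z.U i) (hj : y ∈ Z.U j) (h : G) :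
    Z.pt i y h = Z.pt j y (Z.t i j y * h) := by
  have h1 := coord_change (q := Z.pt i y h) (i := i) (j := j) hi hj
  rw [coord_pt hi] at h1
  rw [← pt_coord (q := Z.pt i y h) (i := j) hj, h1, proj_pt]

theorem proj_act (q : Z.Total) (g : G) : Z.proj (Z.act q g) = Z.proj q := rfl

theorem coord_act (i : N) (q : Z.Total) (g : G) :
    Z.coord i (Z.act q g) = Z.coord i q * g :=
  (mul_assoc (Z.t q.1 i q.1) _ g).symm

theorem pt_act (hy : y ∈ Z.U i) (h g : G) : Z.act (Z.pt i y h) g = Z.pt i y (h * g) := by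
  rw [← pt_coord (q := Z.act (Z.pt i y h) g) (i := i) hy, coord_act, coord_pt hy, proj_act, proj_pt]

instance chartedSpaceProd : ChartedSpace (N × G) Z.Total where
  atlas := Set.range Z.triv
  chartAt q := Z.triv (Z.proj q)
  mem_chart_source _ := Z.mem _
  chart_mem_atlas _ := ⟨_, rfl⟩

section Smooth
variable {E F : Type*} [NormedAddCommGroup E] [NormedSpace ℝ E]
  [NormedAddCommGroup F] [NormedSpace ℝ F] [ChartedSpace E N] [ChartedSpace F G]

instance chartedSpace : ChartedSpace (ModelProd E F) Z.Total :=
  ChartedSpace.comp (ModelProd E F) (N × G) Z.Total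

variable [LieGroup 𝓘(ℝ, F) ∞ G]

/-- The coordinate changes are locally `(y, h) ↦ (y, t h)` with constant `t`. -/
theorem contMDiffOn_triv_change : ∀ e ∈ atlas (N × G) Z.Total, ∀ e' ∈ atlas (N × G) Z.Total,
    ContMDiffOn (bundleModel E F) (bundleModel E F) ∞ (e.symm ≫ₕ e') (e.symm ≫ₕ e').source := by
  rintro _ ⟨i, rfl⟩ _ ⟨j, rfl⟩ ⟨y, h⟩ hy
  have hi : y ∈ Z.U i := hy.1.1
  have hj : y ∈ Z.U j := hy.2
  have h1 : ContMDiffAt (bundleModel E F) (bundleModel E F) ∞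
      (fun p : N × G ↦ (p.1, Z.t i j y * p.2)) (y, h) :=
    (contMDiff_fst.prodMk ((contMDiff_const_mul _).comp contMDiff_snd)).contMDiffAt
  refine (h1.congr_of_eventuallyEq ?_).contMDiffWithinAt
  have h2 := (continuous_fst.continuousAt (x := (y, h))).eventually
    ((Z.t_eventually i j y hi hj).and
      (((Z.isOpen i).eventually_mem hi).and ((Z.isOpen j).eventually_mem hj)))
  filter_upwards [h2] with p hp
  refine Prod.ext rfl ?_
  change Z.coord j (Z.pt i p.1 p.2) = Z.t i j y * p.2
  rw [coord_change (i := i) hp.2.1 hp.2.2, coord_pt hp.2.1, proj_pt, hp.1]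

/-- Left translation by a constant does not change the pullback of the Maurer–Cartan form. -/
theorem maurerCartan_mfderiv_eq_of_eventually_const_mul {q : Z.Total} {k k' : Z.Total → G} {c : G}
    (hk : MDifferentiableAt (bundleModel E F) 𝓘(ℝ, F) k q)
    (h : ∀ᶠ q' in 𝓝 q, k' q' = c * k q') (X : TangentSpace (bundleModel E F) q) :
    (maurerCartan F (k' q) (mfderiv (bundleModel E F) 𝓘(ℝ, F) k' q X) : F) =
      maurerCartan F (k q) (mfderiv (bundleModel E F) 𝓘(ℝ, F) k q X) := by
  have e : k' =ᶠ[𝓝 q] fun q' ↦ c * k q' := h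
  have h1 := mfderiv_comp_apply_of_apply_eq (f := k) (g := fun x : G ↦ c * x) (x := q) rfl
    (mdifferentiableAt_const_mul c _) hk X
  have h2 : (mfderiv (bundleModel E F) 𝓘(ℝ, F) k' q X : F) =
      mfderiv 𝓘(ℝ, F) 𝓘(ℝ, F) (fun x : G ↦ c * x) (k q)
        (mfderiv (bundleModel E F) 𝓘(ℝ, F) k q X) :=
    (DFunLike.congr_fun (e.mfderiv_eq (I := bundleModel E F) (I' := 𝓘(ℝ, F))) X).trans h1
  have h3 : ∀ (a b : G) (_ : a = b) (Y : F), (maurerCartan F a Y : F) = maurerCartan F b Y := by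
    rintro a _ rfl Y; rfl
  refine (h3 _ _ e.self_of_nhds _).trans ?_
  refine (congrArg (maurerCartan F (c * k q)) h2).trans ?_
  exact maurerCartan_mfderiv_const_mul c (k q) _

variable [IsManifold 𝓘(ℝ, E) ∞ N]

instance isManifold : IsManifold (bundleModel E F) ∞ Z.Total :=
  have : IsManifold 𝓘(ℝ, F) ∞ G := inferInstance
  isManifold_comp (bundleModel E F) contMDiffOn_triv_change

variable (E F Z) in
theorem contMDiffOn_triv (i : N) :
    ContMDiffOn (bundleModel E F) (bundleModel E F) ∞ (Z.triv i) (Z.triv i).source :=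
  have : IsManifold 𝓘(ℝ, F) ∞ G := inferInstance
  (contMDiffOn_of_mem_atlas_comp (bundleModel E F) contMDiffOn_triv_change (e := Z.triv i)
    ⟨i, rfl⟩).1

variable (E F Z) in
theorem contMDiffOn_triv_symm (i : N) :
    ContMDiffOn (bundleModel E F) (bundleModel E F) ∞ (Z.triv i).symm (Z.triv i).target :=
  have : IsManifold 𝓘(ℝ, F) ∞ G := inferInstance
  (contMDiffOn_of_mem_atlas_comp (bundleModel E F) contMDiffOn_triv_change (e := Z.triv i)
    ⟨i, rfl⟩).2

theorem continuous_proj : Continuous Z.proj := Z.core.continuous_proj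

variable (E F) in
theorem contMDiffAt_triv (hq : Z.proj q ∈ Z.U i) :
    ContMDiffAt (bundleModel E F) (bundleModel E F) ∞ (Z.triv i) q :=
  (contMDiffOn_triv Z E F i).contMDiffAt ((Z.triv i).open_source.mem_nhds hq)

variable (E F) in
theorem contMDiffAt_coord (hq : Z.proj q ∈ Z.U i) :
    ContMDiffAt (bundleModel E F) 𝓘(ℝ, F) ∞ (Z.coord i) q :=
  contMDiffAt_snd.comp q (contMDiffAt_triv E F hq)

variable (E F Z) in
theorem contMDiff_proj : ContMDiff (bundleModel E F) 𝓘(ℝ, E) ∞ Z.proj := fun q ↦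
  contMDiffAt_fst.comp q (contMDiffAt_triv E F (Z.mem (Z.proj q)))

theorem contMDiffAt_pt {E₁ H₁ : Type*} [NormedAddCommGroup E₁] [NormedSpace ℝ E₁]
    [TopologicalSpace H₁] {I₁ : ModelWithCorners ℝ E₁ H₁} {M₁ : Type*} [TopologicalSpace M₁]
    [ChartedSpace H₁ M₁] {a : M₁ → N} {k : M₁ → G} {m : M₁}
    (ha : ContMDiffAt I₁ 𝓘(ℝ, E) ∞ a m) (hk : ContMDiffAt I₁ 𝓘(ℝ, F) ∞ k m) (hm : a m ∈ Z.U i) :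
    ContMDiffAt I₁ (bundleModel E F) ∞ (fun m ↦ Z.pt i (a m) (k m)) m :=
  ((contMDiffOn_triv_symm Z E F i).contMDiffAt
    ((Z.triv i).open_target.mem_nhds (show (a m, k m) ∈ _ from ⟨hm, trivial⟩))).comp m
    (f := fun m ↦ (a m, k m)) (ha.prodMk hk)

theorem eventually_proj_mem (hq : Z.proj q ∈ Z.U i) : ∀ᶠ q' in 𝓝 q, Z.proj q' ∈ Z.U i :=
  continuous_proj.continuousAt.eventually_mem ((Z.isOpen i).mem_nhds hq)

variable (E F Z) in
/-- The principal bundle of a locally constant cocycle. -/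
def bundle : PrincipalBundle E F N G where
  Total := Z.Total
  proj := Z.proj
  act := Z.act
  act_one q := congrArg (Bundle.TotalSpace.mk (F := G) (E := Z.core.Fiber) q.1)
    (mul_one (show G from q.2))
  act_mul q g h := congrArg (Bundle.TotalSpace.mk (F := G) (E := Z.core.Fiber) q.1)
    (mul_assoc (show G from q.2) g h).symm
  proj_act _ _ := rfl
  contMDiff_proj := contMDiff_proj Z E F
  contMDiff_act := by
    rintro ⟨q, g⟩
    have hq := Z.mem (Z.proj q)
    have h1 : ContMDiffAt ((bundleModel E F).prod 𝓘(ℝ, F)) (bundleModel E F) ∞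
        (fun p : Z.Total × G ↦ Z.pt (Z.proj q) (Z.proj p.1) (Z.coord (Z.proj q) p.1 * p.2))
        (q, g) :=
      contMDiffAt_pt ((contMDiff_proj Z E F).contMDiffAt.comp (q, g) contMDiffAt_fst)
        (((contMDiffAt_coord E F hq).comp (q, g) contMDiffAt_fst).mul contMDiffAt_snd) hq
    refine h1.congr_of_eventuallyEq ?_
    filter_upwards [(continuous_fst.continuousAt (x := (q, g))).eventually
      (eventually_proj_mem hq)] with p hp
    rw [← coord_act, ← proj_act p.1 p.2, pt_coord (q := Z.act p.1 p.2) hp]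
  locallyTrivial x := ⟨Z.U x, Z.triv x, Z.isOpen x, Z.mem x, rfl, rfl, contMDiffOn_triv Z E F x,
    contMDiffOn_triv_symm Z E F x, fun _ _ ↦ rfl, fun q _ g ↦ coord_act x q g⟩

theorem mdifferentiableAt_coord (hq : Z.proj q ∈ Z.U i) :
    MDifferentiableAt (bundleModel E F) 𝓘(ℝ, F) (Z.coord i) q :=
  (contMDiffAt_coord E F hq).mdifferentiableAt (by simp)

variable (E F) in
/-- The Maurer–Cartan form in the coordinate `Z.coord i`. -/
def coordForm (i : N) (q : Z.Total) :
    TangentSpace (bundleModel E F) q →L[ℝ] GroupLieAlgebra 𝓘(ℝ, F) G :=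
  (maurerCartan F (Z.coord i q)).comp (mfderiv (bundleModel E F) 𝓘(ℝ, F) (Z.coord i) q)

/-- The forms of two trivializations agree, since the coordinates differ by a locally constant left
factor. -/
theorem coordForm_eq (hi : Z.proj q ∈ Z.U i) (hj : Z.proj q ∈ Z.U j)
    (X : TangentSpace (bundleModel E F) q) :
    coordForm E F j q X = coordForm E F i q X := by
  refine maurerCartan_mfderiv_eq_of_eventually_const_mul (c := Z.t i j (Z.proj q))
    (mdifferentiableAt_coord hi) ?_ X
  filter_upwards [eventually_proj_mem hi, eventually_proj_mem hj,
    continuous_proj.continuousAt.eventually (Z.t_eventually i j _ hi hj)] with q' h1 h2 h3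
  rw [coord_change h1 h2, h3]

theorem contMDiffAt_coordForm (i : N) (X : TangentBundle (bundleModel E F) Z.Total)
    (hX : Z.proj X.1 ∈ Z.U i) :
    ContMDiffAt (M' := F) (bundleModel E F).tangent 𝓘(ℝ, F) ∞
      (fun X : TangentBundle (bundleModel E F) Z.Total ↦ coordForm E F i X.1 X.2) X := by
  have hop : IsOpen (Z.proj ⁻¹' Z.U i) := (Z.isOpen i).preimage continuous_proj
  have h1 : ContMDiffOn (bundleModel E F) 𝓘(ℝ, F) ∞ (Z.coord i) (Z.proj ⁻¹' Z.U i) :=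
    fun q hq ↦ (contMDiffAt_coord E F hq).contMDiffWithinAt
  have h2 := h1.contMDiffOn_tangentMapWithin (m := ∞) (by simp) hop.uniqueMDiffOn
  have hop' : IsOpen ((fun Y : TangentBundle (bundleModel E F) Z.Total ↦ Y.1) ⁻¹'
      (Z.proj ⁻¹' Z.U i)) :=
    hop.preimage (FiberBundle.continuous_proj (E × F)
      (TangentSpace (bundleModel E F) : Z.Total → Type _))
  have h3 := contMDiff_maurerCartan.contMDiffAt.comp X (h2.contMDiffAt (hop'.mem_nhds hX))
  refine h3.congr_of_eventuallyEq ?_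
  filter_upwards [hop'.mem_nhds hX] with Y hY
  have h4 : mfderivWithin (bundleModel E F) 𝓘(ℝ, F) (Z.coord i) (Z.proj ⁻¹' Z.U i) Y.1 =
      mfderiv (bundleModel E F) 𝓘(ℝ, F) (Z.coord i) Y.1 := mfderivWithin_of_isOpen hop hY
  exact congrArg (maurerCartan F (Z.coord i Y.1)) (DFunLike.congr_fun h4 Y.2).symm

end Smooth
end FlatCocycle
end

noncomputable section

/-! ### The connection of a locally constant cocycle -/

/-- Under right translations the Maurer–Cartan form changes by the adjoint action. -/
theorem maurerCartan_mfderiv_mul_const {F : Type*} [NormedAddCommGroup F] [NormedSpace ℝ F]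
    {G : Type*} [TopologicalSpace G] [ChartedSpace F G] [Group G] [LieGroup 𝓘(ℝ, F) ∞ G]
    (h g : G) (ξ : TangentSpace 𝓘(ℝ, F) h) :
    (maurerCartan F (h * g) (mfderiv 𝓘(ℝ, F) 𝓘(ℝ, F) (fun x : G ↦ x * g) h ξ : F) : F) =
      adjointAction F g⁻¹ (maurerCartan F h ξ) := by
  have hr : MDifferentiableAt 𝓘(ℝ, F) 𝓘(ℝ, F) (fun x : G ↦ x * g) h :=
    (contMDiff_mul_right (I := 𝓘(ℝ, F)) (n := ∞) h).mdifferentiableAt (by simp)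
  have hc : MDifferentiableAt 𝓘(ℝ, F) 𝓘(ℝ, F) (fun x : G ↦ g⁻¹ * x * g⁻¹⁻¹) 1 :=
    ((contMDiff_mul_right (I := 𝓘(ℝ, F)) (n := ∞) (a := g⁻¹⁻¹)).comp
      (contMDiff_const_mul (F := F) g⁻¹) 1).mdifferentiableAt (by simp)
  have h1 := mfderiv_comp_apply_of_apply_eq (x := h) (y := h * g) rfl
    (mdifferentiableAt_const_mul (F := F) (h * g)⁻¹ (h * g)) hr ξ
  have h2 := mfderiv_comp_apply_of_apply_eq (x := h) (y := (1 : G)) (by simp)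
    hc (mdifferentiableAt_const_mul (F := F) h⁻¹ h) ξ
  have e : (fun x : G ↦ (h * g)⁻¹ * (x * g)) = fun x ↦ g⁻¹ * (h⁻¹ * x) * g⁻¹⁻¹ := by
    funext x; group
  rw [e] at h1
  exact h1.symm.trans h2

namespace FlatCocycle
variable {N : Type v} [TopologicalSpace N] {G : Type w} [TopologicalSpace G] [Group G]
  [IsTopologicalGroup G] {Z : FlatCocycle N G} {i y : N} {q : Z.Total}
  {E F : Type*} [NormedAddCommGroup E] [NormedSpace ℝ E]
  [NormedAddCommGroup F] [NormedSpace ℝ F] [ChartedSpace E N] [ChartedSpace F G]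
  [IsManifold 𝓘(ℝ, E) ∞ N] [LieGroup 𝓘(ℝ, F) ∞ G]

theorem coordForm_vertical (hq : Z.proj q ∈ Z.U i) (ξ : GroupLieAlgebra 𝓘(ℝ, F) G) :
    coordForm E F i (Z.act q 1)
      (mfderiv 𝓘(ℝ, F) (bundleModel E F) (fun g : G ↦ Z.act q g) 1 ξ : E × F) = ξ := by
  have h1 := mfderiv_comp_apply_of_apply_eq (I₁ := 𝓘(ℝ, F)) (I₂ := bundleModel E F)
    (I₃ := 𝓘(ℝ, F)) (f := fun g : G ↦ Z.act q g) (g := Z.coord i) (x := (1 : G)) rfl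
    (mdifferentiableAt_coord (q := Z.act q 1) hq)
    ((PrincipalBundle.contMDiff_act_left (P := Z.bundle E F) q 1).mdifferentiableAt (by simp)) ξ
  have e : (fun g : G ↦ Z.coord i (Z.act q g)) =
    fun g ↦ Z.coord i q * g := by funext g; exact coord_act _ _ _
  rw [e] at h1
  refine (congrArg (maurerCartan F (Z.coord i (Z.act q 1))) h1.symm).trans ?_
  have e' : Z.coord i (Z.act q 1) = Z.coord i q := by rw [coord_act, mul_one]
  rw [e']
  exact maurerCartan_mfderiv_mul _ ξ

theorem coordForm_act (hq : Z.proj q ∈ Z.U i) (g : G) (X : TangentSpace (bundleModel E F) q) :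
    coordForm E F i (Z.act q g)
      (mfderiv (bundleModel E F) (bundleModel E F) (fun p ↦ Z.act p g) q X : E × F) =
      adjointAction F g⁻¹ (coordForm E F i q X) := by
  have h0 : MDifferentiableAt (bundleModel E F) (bundleModel E F) (fun p ↦ Z.act p g) q :=
    (PrincipalBundle.contMDiff_act_right (P := Z.bundle E F) g q).mdifferentiableAt (by simp)
  have h1 := mfderiv_comp_apply_of_apply_eq (I₁ := bundleModel E F) (I₂ := bundleModel E F)
    (I₃ := 𝓘(ℝ, F)) (f := fun p ↦ Z.act p g) (g := Z.coord i) (x := q) rfl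
    (mdifferentiableAt_coord (q := Z.act q g) hq)
    h0 X
  have h2 := mfderiv_comp_apply_of_apply_eq (I₁ := bundleModel E F) (I₂ := 𝓘(ℝ, F))
    (I₃ := 𝓘(ℝ, F)) (f := Z.coord i) (g := fun x : G ↦ x * g) (x := q) rfl
    ((contMDiff_mul_right (I := 𝓘(ℝ, F)) (n := ∞) _).mdifferentiableAt (by simp))
    (mdifferentiableAt_coord hq) X
  have e : (fun p ↦ Z.coord i (Z.act p g)) =
    fun p ↦ Z.coord i p * g := by funext p; exact coord_act _ _ _
  rw [e] at h1
  refine (congrArg (maurerCartan F (Z.coord i (Z.act q g))) (h1.symm.trans h2)).trans ?_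
  rw [coord_act]
  exact maurerCartan_mfderiv_mul_const _ g _

variable (E F Z) in
/-- The connection that is the Maurer–Cartan form in each of the trivializations. -/
def conn : PrincipalConnection (Z.bundle E F) where
  form q := coordForm E F (Z.proj q) q
  contMDiff_form X := by
    have hX := Z.mem (Z.proj X.1)
    refine (contMDiffAt_coordForm (F := F) _ X hX).congr_of_eventuallyEq ?_
    have h1 : ContinuousAt (fun Y : TangentBundle (bundleModel E F) Z.Total ↦ Y.1) X :=
      (FiberBundle.continuous_proj (E × F)
        (TangentSpace (bundleModel E F) : Z.Total → Type _)).continuousAt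
    filter_upwards [h1.eventually (eventually_proj_mem hX)] with Y hY
    exact coordForm_eq hY (Z.mem _) Y.2
  form_vertical q ξ := coordForm_vertical (Z.mem _) ξ
  form_act q g X := coordForm_act (Z.mem _) g X

theorem conn_form (hq : Z.proj q ∈ Z.U i) (X : TangentSpace (bundleModel E F) q) :
    (Z.conn E F).form q X = coordForm E F i q X :=
  coordForm_eq hq (Z.mem _) X

theorem conn_form_eq_zero_iff (hq : Z.proj q ∈ Z.U i) (X : TangentSpace (bundleModel E F) q) :
    (Z.conn E F).form q X = 0 ↔ (mfderiv (bundleModel E F) 𝓘(ℝ, F) (Z.coord i) q X : F) = 0 := by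
  rw [conn_form hq]
  exact maurerCartan_eq_zero_iff _ _

/-- The connection of a cocycle is flat: horizontal vectors are those on which the differential of a
coordinate in `G` vanishes, and these are closed under brackets. -/
theorem isFlat_conn [FiniteDimensional ℝ E] [FiniteDimensional ℝ F] : (Z.conn E F).IsFlat := by
  intro (q : Z.Total) V W hV hW hfV hfW
  have : IsManifold 𝓘(ℝ, F) ∞ G := inferInstance
  have : CompleteSpace (E × F) := FiniteDimensional.complete ℝ _
  have hq := Z.mem (Z.proj q)
  set i := Z.proj q
  have hχ : ∀ᶠ g in 𝓝 (Z.coord i q), MDifferentiableAt 𝓘(ℝ, F) 𝓘(ℝ, F)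
      (extChartAt 𝓘(ℝ, F) (Z.coord i q)) g := by
    filter_upwards [(chartAt F (Z.coord i q)).open_source.mem_nhds (mem_chart_source F _)] with g hg
    exact mdifferentiableAt_extChartAt hg
  have hcomp : ∀ᶠ p in 𝓝 q, ∀ X : E × F,
      (mfderiv (bundleModel E F) 𝓘(ℝ, F)
        (fun p ↦ extChartAt 𝓘(ℝ, F) (Z.coord i q) (Z.coord i p)) p X : F) =
      mfderiv 𝓘(ℝ, F) 𝓘(ℝ, F) (extChartAt 𝓘(ℝ, F) (Z.coord i q)) (Z.coord i p)
        (mfderiv (bundleModel E F) 𝓘(ℝ, F) (Z.coord i) p X) := by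
    filter_upwards [eventually_proj_mem hq,
      (contMDiffAt_coord E F hq).continuousAt.eventually hχ] with p hp hp' X
    exact mfderiv_comp_apply_of_apply_eq (f := Z.coord i) (x := p) rfl hp'
      (mdifferentiableAt_coord hp) X
  have hzero : ∀ X : ∀ p : Z.Total, TangentSpace (bundleModel E F) p,
      (∀ᶠ p in 𝓝 q, (Z.conn E F).form p (X p) = 0) → ∀ᶠ p in 𝓝 q,
      (mfderiv (bundleModel E F) 𝓘(ℝ, F)
        (fun p ↦ extChartAt 𝓘(ℝ, F) (Z.coord i q) (Z.coord i p)) p (X p) : F) = 0 := by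
    intro X hX
    filter_upwards [hX, hcomp, eventually_proj_mem hq] with p h1 h2 h3
    refine (h2 (X p)).trans ?_
    rw [(conn_form_eq_zero_iff h3 _).1 h1]
    exact map_zero (mfderiv 𝓘(ℝ, F) 𝓘(ℝ, F) _ (Z.coord i p))
  have hs : ContMDiffAt (bundleModel E F) 𝓘(ℝ, F) ∞
      (fun p ↦ extChartAt 𝓘(ℝ, F) (Z.coord i q) (Z.coord i p)) q :=
    (contMDiffAt_extChartAt (I := 𝓘(ℝ, F)) (x := Z.coord i q)).comp q (contMDiffAt_coord E F hq)
  have h0 := mfderiv_mlieBracket_eq_zero hs hV hW (hzero V hfV) (hzero W hfW)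
  refine (conn_form_eq_zero_iff hq _).2 ?_
  have h1 := (hcomp.self_of_nhds _).symm.trans h0
  have hinv := isInvertible_mfderiv_extChartAt (I := 𝓘(ℝ, F)) (mem_extChartAt_source (Z.coord i q))
  exact hinv.injective (h1.trans (map_zero (mfderiv 𝓘(ℝ, F) 𝓘(ℝ, F) _ (Z.coord i q))).symm)

/-- The sections of constant coordinate are flat. -/
theorem isFlatSection_pt (i : N) (h : G) :
    (Z.conn E F).IsFlatSection (Z.U i) (fun y ↦ Z.pt i y h) := by
  have hs : ∀ y ∈ Z.U i, ContMDiffAt 𝓘(ℝ, E) (bundleModel E F) ∞ (fun y ↦ Z.pt i y h) y :=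
    fun y hy ↦ contMDiffAt_pt contMDiffAt_id contMDiffAt_const hy
  refine ⟨Z.isOpen i, fun y hy ↦ (hs y hy).contMDiffWithinAt, fun y _ ↦ rfl, fun y hy v ↦ ?_⟩
  refine (conn_form_eq_zero_iff (q := Z.pt i y h) hy _).2 ?_
  have h1 := mfderiv_comp_apply_of_apply_eq (f := fun y ↦ Z.pt i y h) (g := Z.coord i) (x := y) rfl
    (mdifferentiableAt_coord (q := Z.pt i y h) (F := F) hy)
    ((hs y hy).mdifferentiableAt (by simp)) v
  have e : (fun y ↦ Z.coord i (Z.pt i y h)) =ᶠ[𝓝 y] fun _ ↦ h := by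
    filter_upwards [(Z.isOpen i).mem_nhds hy] with y' hy' using coord_pt hy' h
  rw [e.mfderiv_eq, mfderiv_const] at h1
  exact h1.symm

end FlatCocycle
end

noncomputable section

/-! ### The flat bundle of a homomorphism from the group of loops -/

section LoopDiff
variable {X : Type*} [TopologicalSpace X] {x y y' : X}

/-- The loop at `x` that runs along `σ` and returns along `σ'`. -/
def loopDiff (σ σ' : Path.Homotopic.Quotient x y) : LoopGroup X x := loopOf (σ.trans σ'.symm)

theorem loopDiff_self (σ : Path.Homotopic.Quotient x y) : loopDiff σ σ = 1 := by
  rw [loopDiff, Path.Homotopic.Quotient.trans_symm, loopOf_refl]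

theorem trans_symm_trans (σ : Path.Homotopic.Quotient x y) (a : Path.Homotopic.Quotient x y')
    (b : Path.Homotopic.Quotient y' y) :
    σ.trans (a.trans b).symm = (σ.trans b.symm).trans a.symm := by
  have h : (a.trans b).symm = b.symm.trans a.symm := by
    calc (a.trans b).symm = ((a.trans b).symm.trans (a.trans b)).trans (b.symm.trans a.symm) := by
          rw [Path.Homotopic.Quotient.trans_assoc, Path.Homotopic.Quotient.trans_assoc,
            ← Path.Homotopic.Quotient.trans_assoc b, Path.Homotopic.Quotient.trans_symm,
            Path.Homotopic.Quotient.refl_trans, Path.Homotopic.Quotient.trans_symm,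
            Path.Homotopic.Quotient.trans_refl]
      _ = b.symm.trans a.symm := by
          rw [Path.Homotopic.Quotient.symm_trans, Path.Homotopic.Quotient.refl_trans]
  rw [h, Path.Homotopic.Quotient.trans_assoc]

theorem loopDiff_trans_trans (σ σ' : Path.Homotopic.Quotient x y)
    (a : Path.Homotopic.Quotient y y') :
    loopDiff (σ.trans a) (σ'.trans a) = loopDiff σ σ' := by
  rw [loopDiff, trans_symm_trans, Path.Homotopic.Quotient.trans_assoc σ,
    Path.Homotopic.Quotient.trans_symm, Path.Homotopic.Quotient.trans_refl, loopDiff]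

theorem loopDiff_trans_right (σ σ' : Path.Homotopic.Quotient x y)
    (a : Path.Homotopic.Quotient x x) :
    loopDiff σ (a.trans σ') = loopDiff σ σ' * (loopOf a)⁻¹ := by
  rw [loopDiff, trans_symm_trans]
  rfl

theorem loopDiff_mul (σ σ' σ'' : Path.Homotopic.Quotient x y) :
    loopDiff σ σ' * loopDiff σ' σ'' = loopDiff σ σ'' := by
  rw [loopDiff, loopDiff, ← loopOf_trans, Path.Homotopic.Quotient.trans_assoc,
    ← Path.Homotopic.Quotient.trans_assoc σ'.symm, Path.Homotopic.Quotient.symm_trans,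
    Path.Homotopic.Quotient.refl_trans, loopDiff]

end LoopDiff

/-- An open cover of `N` by ball-like sets `U i ∋ i` with, for each `i`, classes `path i y` of paths
from `x₀` to the points `y` that change inside `U i` by concatenation with paths in `U i`. The
classes for `y` outside `U i` are arbitrary. -/
structure RadialPaths (E : Type*) [NormedAddCommGroup E] [NormedSpace ℝ E]
    {N : Type*} [TopologicalSpace N] [ChartedSpace E N] (x₀ : N) where
  /-- The open cover. -/
  U : N → Set N
  isBallLike : ∀ i, IsBallLike E (U i)
  mem : ∀ i, i ∈ U i
  /-- The class of paths to `y` attached to `U i`. -/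
  path : N → ∀ y : N, Path.Homotopic.Quotient x₀ y
  path_trans : ∀ (i : N) {y y' : N} (β : Path y y'), (∀ t, β t ∈ U i) →
    path i y' = (path i y).trans (.mk β)

namespace RadialPaths
variable {E : Type*} [NormedAddCommGroup E] [NormedSpace ℝ E]
  {N : Type v} [TopologicalSpace N] [ChartedSpace E N] {x₀ : N}

/-- In a path-connected manifold one takes, for `y` in `U i`, a path from `x₀` to `i` followed by a
path in `U i`. -/
theorem nonempty [IsManifold 𝓘(ℝ, E) ∞ N] [PathConnectedSpace N] (x₀ : N) :
    Nonempty (RadialPaths E x₀) := by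
  classical
  choose U hU hmem using fun i : N ↦ exists_isBallLike (E := E) (Filter.univ_mem (f := 𝓝 i))
  choose γ hγ using fun (i y : N) (hy : y ∈ U i) ↦ (hU i).exists_path i (hmem i).1 y hy
  refine ⟨⟨U, hU, fun i ↦ (hmem i).1, fun i y ↦ if hy : y ∈ U i then
    (Path.Homotopic.Quotient.mk (PathConnectedSpace.somePath x₀ i)).trans (.mk (γ i y hy)) else
    .mk (PathConnectedSpace.somePath x₀ y), ?_⟩⟩
  intro i y y' β hβ
  have hy : y ∈ U i := by simpa using hβ 0
  have hy' : y' ∈ U i := by simpa using hβ 1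
  rw [dif_pos hy, dif_pos hy', Path.Homotopic.Quotient.trans_assoc]
  refine congrArg (Path.Homotopic.Quotient.trans _) (Path.Homotopic.Quotient.eq.2
    ((hU i).homotopic _ _ _ ((γ i y hy).trans β) (hγ i y' hy').1 fun t ↦ ?_))
  rw [Path.trans_apply]
  split_ifs
  · exact (hγ i y hy).1 _
  · exact hβ _

variable {G : Type w} [Group G] (R : RadialPaths E x₀) (φ : LoopGroup N x₀ →* G)

/-- Near a point of an open set, every point is joined to it by a path in that open set. -/
theorem eventually_exists_path [IsManifold 𝓘(ℝ, E) ∞ N] {W : Set N} (hW : IsOpen W) {y : N}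
    (hy : y ∈ W) : ∀ᶠ y' in 𝓝 y, ∃ β : Path y y', ∀ t, β t ∈ W := by
  obtain ⟨V, hV, hyV, hVW⟩ := exists_isBallLike (E := E) (hW.mem_nhds hy)
  filter_upwards [hV.isOpen.mem_nhds hyV] with y' hy'
  obtain ⟨β, hβ, -⟩ := hV.exists_path y hyV y' hy'
  exact ⟨β, fun t ↦ hVW (hβ t)⟩

variable [IsManifold 𝓘(ℝ, E) ∞ N]

/-- The locally constant cocycle of a homomorphism `φ` from the group of loops. -/
def cocycle : FlatCocycle N G where
  U := R.U
  isOpen i := (R.isBallLike i).isOpen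
  mem := R.mem
  t i j y := φ (loopDiff (R.path j y) (R.path i y))
  t_self i y _ := by rw [loopDiff_self, map_one]
  t_comp i j k y _ _ _ := by rw [← map_mul, loopDiff_mul]
  t_eventually i j y hi hj := by
    filter_upwards [eventually_exists_path (E := E)
      ((R.isBallLike i).isOpen.inter (R.isBallLike j).isOpen) ⟨hi, hj⟩] with y' ⟨β, hβ⟩
    rw [R.path_trans i β fun t ↦ (hβ t).1, R.path_trans j β fun t ↦ (hβ t).2,
      loopDiff_trans_trans]

variable [TopologicalSpace G] [IsTopologicalGroup G] {y y' : N}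

/-- The point of the bundle of `φ` with coordinate `h` in the fibre identified with `G` by means of
the class `σ` of paths from the base point. -/
def pt (σ : Path.Homotopic.Quotient x₀ y) (h : G) : (R.cocycle φ).Total :=
  (R.cocycle φ).pt y y (φ (loopDiff (R.path y y) σ) * h)

variable {R φ}

theorem pt_eq {i : N} (hi : y ∈ R.U i) (σ : Path.Homotopic.Quotient x₀ y) (h : G) :
    R.pt φ σ h = (R.cocycle φ).pt i y (φ (loopDiff (R.path i y) σ) * h) := by
  refine (FlatCocycle.pt_change (Z := R.cocycle φ) (j := i) (R.mem y) hi _).trans ?_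
  change (R.cocycle φ).pt i y (φ (loopDiff (R.path i y) (R.path y y)) * _) = _
  rw [← mul_assoc, ← map_mul, loopDiff_mul]

theorem coord_pt {i : N} (hi : y ∈ R.U i) (σ : Path.Homotopic.Quotient x₀ y) (h : G) :
    (R.cocycle φ).coord i (R.pt φ σ h) = φ (loopDiff (R.path i y) σ) * h := by
  rw [pt_eq hi]
  exact FlatCocycle.coord_pt (Z := R.cocycle φ) hi _

theorem act_pt (σ : Path.Homotopic.Quotient x₀ y) (h k : G) :
    (R.cocycle φ).act (R.pt φ σ h) k = R.pt φ σ (h * k) := by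
  rw [pt, pt, FlatCocycle.pt_act (Z := R.cocycle φ) (R.mem y), mul_assoc]

theorem pt_change (σ σ' : Path.Homotopic.Quotient x₀ y) (h : G) :
    R.pt φ σ h = R.pt φ σ' (φ (loopDiff σ' σ) * h) := by
  rw [pt, pt, ← mul_assoc, ← map_mul, loopDiff_mul]

theorem pt_trans_left (a : Path.Homotopic.Quotient x₀ x₀) (σ : Path.Homotopic.Quotient x₀ y)
    (h : G) : R.pt φ (a.trans σ) h = R.pt φ σ ((φ (loopOf a))⁻¹ * h) := by
  rw [pt_change _ σ, loopDiff_trans_right, loopDiff_self, one_mul, map_inv]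

theorem pt_cast (e : y' = y) (σ : Path.Homotopic.Quotient x₀ y) (h : G) :
    R.pt φ (σ.cast rfl e) h = R.pt φ σ h := by
  subst e
  rw [Path.Homotopic.Quotient.cast_rfl_rfl]

theorem pt_path_coord {i : N} {q : (R.cocycle φ).Total} (hq : (R.cocycle φ).proj q ∈ R.U i) :
    R.pt φ (R.path i ((R.cocycle φ).proj q)) ((R.cocycle φ).coord i q) = q := by
  rw [pt_eq hq, loopDiff_self, map_one, one_mul]
  exact FlatCocycle.pt_coord (Z := R.cocycle φ) hq

theorem exists_eq_pt (q : (R.cocycle φ).Total) :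
    ∃ (y : N) (σ : Path.Homotopic.Quotient x₀ y) (h : G), R.pt φ σ h = q :=
  ⟨_, _, _, pt_path_coord (R.mem ((R.cocycle φ).proj q))⟩

/-- Parallel transport in the bundle of `φ` extends the classes of paths. -/
theorem transport_pt {F : Type*} [NormedAddCommGroup F] [NormedSpace ℝ F] [ChartedSpace F G]
    [LieGroup 𝓘(ℝ, F) ∞ G] (hA : ((R.cocycle φ).conn E F).HasFlatSections)
    (a : Path.Homotopic.Quotient y y') (σ : Path.Homotopic.Quotient x₀ y) (h : G) :
    hA.transport a (R.pt φ σ h) = R.pt φ (σ.trans a) h := by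
  refine Path.Homotopic.Quotient.local_induction (fun y y' a ↦
    ∀ σ : Path.Homotopic.Quotient x₀ y, hA.transport a (R.pt φ σ h) = R.pt φ (σ.trans a) h)
    (fun y y' y'' a b ha hb σ ↦ ?_) (fun i ↦ ⟨R.U i, (R.isBallLike i).isOpen.mem_nhds (R.mem i),
      fun y y' β hβ σ ↦ ?_⟩) a σ
  · refine (hA.transport_trans a b (q := R.pt φ σ h) rfl).trans ?_
    rw [ha, hb, Path.Homotopic.Quotient.trans_assoc]
  · have hy : y ∈ R.U i := by simpa using hβ 0
    have hy' : y' ∈ R.U i := by simpa using hβ 1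
    rw [pt_eq hy, pt_eq hy', R.path_trans i β hβ, loopDiff_trans_trans]
    exact hA.transport_section (FlatCocycle.isFlatSection_pt (Z := R.cocycle φ) i _) β hβ

end RadialPaths
end

noncomputable section

/-! ### The flat twisted bundle of a twisted pair -/

namespace IsDoubleCover
variable {E : Type*} [NormedAddCommGroup E] [NormedSpace ℝ E]
  {M : Type*} [TopologicalSpace M] [ChartedSpace E M]
  {N : Type*} [TopologicalSpace N] [ChartedSpace E N] {π : N → M} {τ : N → N}
  (h : IsDoubleCover E π τ) {x y y' : N}

theorem translate_refl (x : N) : h.translate (.refl x) = .refl (τ x) := rfl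

theorem translate_trans (a : Path.Homotopic.Quotient x y) (b : Path.Homotopic.Quotient y y') :
    h.translate (a.trans b) = (h.translate a).trans (h.translate b) := by
  obtain ⟨α, rfl⟩ := Path.Homotopic.Quotient.mk_surjective a
  obtain ⟨β, rfl⟩ := Path.Homotopic.Quotient.mk_surjective b
  exact congrArg Path.Homotopic.Quotient.mk (Path.map_trans α β h.deckMap.continuous)

theorem translate_symm (a : Path.Homotopic.Quotient x y) :
    h.translate a.symm = (h.translate a).symm := by
  obtain ⟨α, rfl⟩ := Path.Homotopic.Quotient.mk_surjective a
  rfl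

theorem translate_translate (a : Path.Homotopic.Quotient x y) :
    h.translate (h.translate a) = a.cast (h.deck_deck x) (h.deck_deck y) := by
  obtain ⟨α, rfl⟩ := Path.Homotopic.Quotient.mk_surjective a
  refine congrArg Path.Homotopic.Quotient.mk (?_ :
    (α.map h.deckMap.continuous).map h.deckMap.continuous = α.cast _ _)
  ext t
  exact h.deck_deck _

/-- The translate of `b · τ(a)`, preceded by `b`, is the loop `b · τ(b)` followed by `a`. -/
theorem cast_trans_translate (b : Path.Homotopic.Quotient x (τ x))
    (a : Path.Homotopic.Quotient x y) :
    (b.trans (h.translate (b.trans (h.translate a)))).cast rfl (h.deck_deck y).symm =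
      ((b.trans (h.translate b)).cast rfl (h.deck_deck x).symm).trans a := by
  have key : ∀ {w x' y' z : N} (d : Path.Homotopic.Quotient x w) (a : Path.Homotopic.Quotient x' y')
      (e : w = x') (e' : z = y'), (d.trans (a.cast e e')).cast rfl e'.symm =
        (d.cast rfl e.symm).trans a := by
    rintro w _ y' _ d a rfl rfl
    simp
  rw [translate_trans, translate_translate, ← Path.Homotopic.Quotient.trans_assoc]
  exact key _ _ _ _

end IsDoubleCover

section
variable {E : Type*} [NormedAddCommGroup E] [NormedSpace ℝ E]
  {M : Type*} [TopologicalSpace M] [ChartedSpace E M]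
  {N : Type*} [TopologicalSpace N] [ChartedSpace E N] {π : N → M} {τ : N → N}
  {hπ : IsDoubleCover E π τ} {x y : N} {c : LoopGroup M (π x)} {G : Type*} [Group G] {z : G}
  {b : Path.Homotopic.Quotient x (τ x)}

/-- The relation `φ ∘ Ad_c = Ad_g ∘ φ` in terms of `b`. -/
theorem TwistedPair.hom_loopDiff_trans (p : TwistedPair (hπ.onLoops x) c z)
    (hb : hπ.projClass b = c) (σ σ' : Path.Homotopic.Quotient x y) :
    p.hom (loopDiff (b.trans (hπ.translate σ)) (b.trans (hπ.translate σ'))) =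
      p.elt * p.hom (loopDiff σ σ') * p.elt⁻¹ := by
  obtain ⟨a, ha, ha'⟩ := p.hom_conj (loopDiff σ σ')
  rw [← ha']
  congr 1
  apply hπ.onLoops_injective
  rw [ha, eq_mul_inv_iff_mul_eq, ← hb]
  refine (hπ.projClass_trans _ b).symm.trans (Eq.trans ?_ (hπ.projClass_trans_deck b _))
  congr 1
  rw [trans_symm_trans, hπ.translate_trans, hπ.translate_symm, Path.Homotopic.Quotient.trans_assoc,
    Path.Homotopic.Quotient.symm_trans, Path.Homotopic.Quotient.trans_refl,
    Path.Homotopic.Quotient.trans_assoc]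

end

namespace RadialPaths
variable {E F : Type*} [NormedAddCommGroup E] [NormedSpace ℝ E]
  [NormedAddCommGroup F] [NormedSpace ℝ F]
  {M : Type*} [TopologicalSpace M] [ChartedSpace E M]
  {N : Type v} [TopologicalSpace N] [ChartedSpace E N] [IsManifold 𝓘(ℝ, E) ∞ N]
  {G : Type w} [TopologicalSpace G] [ChartedSpace F G] [Group G] [LieGroup 𝓘(ℝ, F) ∞ G]
  [IsTopologicalGroup G]
  {π : N → M} {τ : N → N} {z : G} {x₀ : N} (R : RadialPaths E x₀)
  (hπ : IsDoubleCover E π τ) {c : LoopGroup M (π x₀)} (p : TwistedPair (hπ.onLoops x₀) c z)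
  (b : Path.Homotopic.Quotient x₀ (τ x₀))

/-- The lift of the deck transformation to the bundle of `φ`: paths from the base point are
translated and preceded by `b`, and coordinates are multiplied by `g`. -/
def lift (q : (R.cocycle p.hom).Total) : (R.cocycle p.hom).Total :=
  R.pt p.hom (b.trans (hπ.translate (R.path ((R.cocycle p.hom).proj q) ((R.cocycle p.hom).proj q))))
    (p.elt * (R.cocycle p.hom).coord ((R.cocycle p.hom).proj q) q)

variable {R hπ p b} {y : N}

theorem lift_pt (hb : hπ.projClass b = c) (σ : Path.Homotopic.Quotient x₀ y) (h : G) :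
    R.lift hπ p b (R.pt p.hom σ h) = R.pt p.hom (b.trans (hπ.translate σ)) (p.elt * h) := by
  change R.pt p.hom (b.trans (hπ.translate (R.path y y)))
    (p.elt * (R.cocycle p.hom).coord y (R.pt p.hom σ h)) = _
  rw [coord_pt (R.mem y),
    pt_change (b.trans (hπ.translate σ)) (b.trans (hπ.translate (R.path y y))),
    p.hom_loopDiff_trans hb]
  congr 1
  group

theorem lift_act (hb : hπ.projClass b = c) (q : (R.cocycle p.hom).Total) (k : G) :
    R.lift hπ p b ((R.cocycle p.hom).act q k) = (R.cocycle p.hom).act (R.lift hπ p b q) k := by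
  obtain ⟨y, σ, h, rfl⟩ := exists_eq_pt q
  rw [act_pt, lift_pt hb, lift_pt hb, act_pt, mul_assoc]

/-- The square of the lift is the action of `z`, by the relation `g² φ(c²)⁻¹ = z`. -/
theorem lift_lift (hb : hπ.projClass b = c) (hz : z ∈ Subgroup.center G)
    (q : (R.cocycle p.hom).Total) :
    R.lift hπ p b (R.lift hπ p b q) = (R.cocycle p.hom).act q z := by
  obtain ⟨y, σ, h, rfl⟩ := exists_eq_pt q
  obtain ⟨l, hl, hl'⟩ := p.elt_sq
  have hloop : loopOf ((b.trans (hπ.translate b)).cast rfl (hπ.deck_deck x₀).symm) = l :=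
    hπ.onLoops_injective ((hπ.onLoops_trans_deck b).trans (by rw [hb, hl]))
  rw [lift_pt hb, lift_pt hb, act_pt, ← pt_cast (hπ.deck_deck y).symm, hπ.cast_trans_translate,
    pt_trans_left, hloop]
  congr 1
  have h1 : p.elt * p.elt = p.hom l * z := by
    rw [Subgroup.mem_center_iff.1 hz]
    refine Eq.trans ?_ (congrArg (· * p.hom l) hl')
    rw [← pow_two]
    exact (inv_mul_cancel_right _ _).symm
  rw [← mul_assoc p.elt, h1, mul_assoc, inv_mul_cancel_left, Subgroup.mem_center_iff.1 hz]

/-- In the trivializations, the lift is locally a left translation in `G`. -/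
theorem eventually_coord_lift (hb : hπ.projClass b = c) {i j : N} {q : (R.cocycle p.hom).Total}
    (hi : (R.cocycle p.hom).proj q ∈ R.U i) (hj : τ ((R.cocycle p.hom).proj q) ∈ R.U j) :
    ∃ k : G, ∀ᶠ q' in 𝓝 q, τ ((R.cocycle p.hom).proj q') ∈ R.U j ∧
      (R.cocycle p.hom).coord j (R.lift hπ p b q') = k * (R.cocycle p.hom).coord i q' := by
  set y := (R.cocycle p.hom).proj q
  have hopen : IsOpen (R.U i ∩ τ ⁻¹' R.U j) :=
    (R.isBallLike i).isOpen.inter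
      ((R.isBallLike j).isOpen.preimage hπ.contMDiff_deck.continuous)
  refine ⟨p.hom (loopDiff (R.path j (τ y)) (b.trans (hπ.translate (R.path i y)))) * p.elt, ?_⟩
  have hev := ((FlatCocycle.continuous_proj (Z := R.cocycle p.hom)).continuousAt
    (x := q)).eventually (eventually_exists_path (E := E) hopen ⟨hi, hj⟩)
  filter_upwards [hev] with q' ⟨β, hβ⟩
  have h1 : (R.cocycle p.hom).proj q' ∈ R.U i ∩ τ ⁻¹' R.U j := by simpa using hβ 1
  refine ⟨h1.2, ?_⟩
  conv_lhs => rw [← pt_path_coord (R := R) h1.1]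
  rw [lift_pt hb, coord_pt h1.2, R.path_trans i β fun t ↦ (hβ t).1,
    R.path_trans j (β.map hπ.contMDiff_deck.continuous) fun t ↦ (hβ t).2, hπ.translate_trans,
    ← Path.Homotopic.Quotient.trans_assoc]
  refine Eq.trans ?_ (mul_assoc _ _ _).symm
  exact congrArg (fun l ↦ p.hom l * _) (loopDiff_trans_trans _ _ (hπ.translate (.mk β)))

theorem contMDiff_lift (hb : hπ.projClass b = c) :
    ContMDiff (bundleModel E F) (bundleModel E F) ∞ (R.lift hπ p b) := by
  intro q
  have hi := R.mem ((R.cocycle p.hom).proj q)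
  have hj := R.mem (τ ((R.cocycle p.hom).proj q))
  obtain ⟨k, hk⟩ := eventually_coord_lift hb hi hj
  have h1 : ContMDiffAt (bundleModel E F) (bundleModel E F) ∞
      (fun q' ↦ (R.cocycle p.hom).pt (τ ((R.cocycle p.hom).proj q))
        (τ ((R.cocycle p.hom).proj q'))
        (k * (R.cocycle p.hom).coord ((R.cocycle p.hom).proj q) q')) q :=
    FlatCocycle.contMDiffAt_pt
      (hπ.contMDiff_deck.contMDiffAt.comp q (FlatCocycle.contMDiff_proj (R.cocycle p.hom) E F q))
      ((contMDiff_const_mul (F := F) k).contMDiffAt.comp q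
        (FlatCocycle.contMDiffAt_coord E F hi)) hj
  refine h1.congr_of_eventuallyEq ?_
  filter_upwards [hk] with q' ⟨h2, h3⟩
  rw [← h3]
  exact (FlatCocycle.pt_coord (Z := R.cocycle p.hom) (q := R.lift hπ p b q') h2).symm

theorem conn_form_lift (hb : hπ.projClass b = c) (q : (R.cocycle p.hom).Total)
    (X : TangentSpace (bundleModel E F) q) :
    ((R.cocycle p.hom).conn E F).form (R.lift hπ p b q)
      (mfderiv (bundleModel E F) (bundleModel E F) (R.lift hπ p b) q X) =
    ((R.cocycle p.hom).conn E F).form q X := by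
  have hi := R.mem ((R.cocycle p.hom).proj q)
  have hj := R.mem (τ ((R.cocycle p.hom).proj q))
  obtain ⟨k, hk⟩ := eventually_coord_lift hb hi hj
  refine (FlatCocycle.conn_form (Z := R.cocycle p.hom) (q := R.lift hπ p b q) hj _).trans ?_
  have h1 := mfderiv_comp_apply_of_apply_eq (f := R.lift hπ p b)
    (g := (R.cocycle p.hom).coord (τ ((R.cocycle p.hom).proj q))) (x := q) rfl
    (FlatCocycle.mdifferentiableAt_coord (Z := R.cocycle p.hom) (F := F)
      (q := R.lift hπ p b q) hj)
    ((contMDiff_lift hb).mdifferentiableAt (by simp)) X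
  refine (congrArg (maurerCartan F _) h1.symm).trans ?_
  exact FlatCocycle.maurerCartan_mfderiv_eq_of_eventually_const_mul
    (FlatCocycle.mdifferentiableAt_coord hi) (hk.mono fun _ h ↦ h.2) X

variable [FiniteDimensional ℝ E] [FiniteDimensional ℝ F]

variable (R p) in
/-- The flat bundle with a lift of the deck transformation that is attached to a pair `(φ, g)`. -/
def flatTwistedBundle (hb : hπ.projClass b = c) (hz : z ∈ Subgroup.center G) :
    FlatTwistedBundle E F τ z where
  bundle := (R.cocycle p.hom).bundle E F
  lift := R.lift hπ p b
  contMDiff_lift := contMDiff_lift hb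
  lift_act := lift_act hb
  proj_lift _ := rfl
  lift_lift := lift_lift hb hz
  conn := (R.cocycle p.hom).conn E F
  flat := FlatCocycle.isFlat_conn
  invariant := conn_form_lift hb

/-- The holonomy of the bundle attached to `(φ, g)` is `(φ, g)`. -/
theorem isHolonomy_flatTwistedBundle (hb : hπ.projClass b = c) (hz : z ∈ Subgroup.center G) :
    IsHolonomy hπ (R.flatTwistedBundle (E := E) (F := F) p hb hz) (R.pt p.hom (.refl x₀) 1) p := by
  refine (FlatTwistedBundle.isHolonomy_iff hπ hb).2 ⟨rfl, fun a ↦ ?_, ?_⟩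
  · refine (transport_pt _ a _ _).trans (Eq.trans ?_ (act_pt _ _ _).symm)
    rw [Path.Homotopic.Quotient.refl_trans, ← Path.Homotopic.Quotient.trans_refl a, pt_trans_left,
      Path.Homotopic.Quotient.trans_refl, one_mul, mul_one]
  · refine (transport_pt _ b _ _).trans
      (Eq.trans ?_ (congrArg (fun q ↦ (R.cocycle p.hom).act q _) (lift_pt hb _ _)).symm)
    rw [act_pt, hπ.translate_refl, mul_one, mul_inv_cancel, Path.Homotopic.Quotient.trans_refl,
      Path.Homotopic.Quotient.refl_trans]

end RadialPaths

/-- Every pair `(φ, g)` is the holonomy of some flat twisted bundle. -/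
theorem FlatTwistedBundle.exists_isHolonomy_eq
    {E F : Type*} [NormedAddCommGroup E] [NormedSpace ℝ E] [FiniteDimensional ℝ E]
    [NormedAddCommGroup F] [NormedSpace ℝ F] [FiniteDimensional ℝ F]
    {M : Type*} [TopologicalSpace M] [ChartedSpace E M]
    {N : Type v} [TopologicalSpace N] [ChartedSpace E N] [IsManifold 𝓘(ℝ, E) ∞ N]
    [PathConnectedSpace N]
    {G : Type w} [TopologicalSpace G] [ChartedSpace F G] [Group G] [LieGroup 𝓘(ℝ, F) ∞ G]
    {π : N → M} {τ : N → N} {z : G} (hπ : IsDoubleCover E π τ) {x : N} {c : LoopGroup M (π x)}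
    {b : Path.Homotopic.Quotient x (τ x)} (hb : hπ.projClass b = c)
    (hz : z ∈ Subgroup.center G) (p : TwistedPair (hπ.onLoops x) c z) :
    ∃ (D : FlatTwistedBundle E F τ z) (q₀ : D.bundle.Total), IsHolonomy hπ D q₀ p := by
  have : IsTopologicalGroup G := topologicalGroup_of_lieGroup 𝓘(ℝ, F) ∞
  obtain ⟨R⟩ := RadialPaths.nonempty (E := E) x
  exact ⟨_, _, RadialPaths.isHolonomy_flatTwistedBundle (R := R) hb hz⟩

end

/-! ### The bijection of isomorphism classes -/

/-- A relation that is total on both sides and matches two equivalence relations induces a bijection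
of the quotients. -/
theorem Quotient.exists_equiv_of_rel {α β : Type*} (s : Setoid α) (t : Setoid β) (R : α → β → Prop)
    (left : ∀ a, ∃ b, R a b) (right : ∀ b, ∃ a, R a b)
    (equiv_iff : ∀ {a a' b b'}, R a b → R a' b' → (s a a' ↔ t b b'))
    (trans : ∀ {a b b'}, R a b → t b b' → R a b') :
    ∃ e : Quotient s ≃ Quotient t, ∀ a b, e (Quotient.mk _ a) = Quotient.mk _ b ↔ R a b := by
  choose f hf using left
  have hs : ∀ a a', s a a' → (Quotient.mk t (f a)) = Quotient.mk t (f a') := fun a a' h ↦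
    Quotient.sound ((equiv_iff (hf a) (hf a')).1 h)
  refine ⟨Equiv.ofBijective (Quotient.lift (fun a ↦ Quotient.mk t (f a)) hs) ⟨?_, ?_⟩,
    fun a b ↦ ⟨fun h ↦ trans (hf a) (Quotient.exact h), fun h ↦ ?_⟩⟩
  · rintro ⟨a⟩ ⟨a'⟩ h
    exact Quotient.sound ((equiv_iff (hf a) (hf a')).2 (Quotient.exact h))
  · rintro ⟨b⟩
    obtain ⟨a, ha⟩ := right b
    exact ⟨Quotient.mk s a, Quotient.sound ((equiv_iff (hf a) ha).1 (s.refl a))⟩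
  · exact Quotient.sound ((equiv_iff (hf a) h).1 (s.refl a))

theorem mainTheorem4
    {E : Type*} [NormedAddCommGroup E] [NormedSpace ℝ E] [FiniteDimensional ℝ E]
    {F : Type*} [NormedAddCommGroup F] [NormedSpace ℝ F] [FiniteDimensional ℝ F]
    {M : Type*} [TopologicalSpace M] [T2Space M] [CompactSpace M] [ConnectedSpace M]
    [ChartedSpace E M] [IsManifold 𝓘(ℝ, E) ∞ M]
    {N : Type v} [TopologicalSpace N] [T2Space N] [ConnectedSpace N]
    [ChartedSpace E N] [IsManifold 𝓘(ℝ, E) ∞ N]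
    (π : N → M) (τ : N → N) (hπ : IsDoubleCover E π τ)
    {G : Type w} [TopologicalSpace G] [ChartedSpace F G] [Group G] [LieGroup 𝓘(ℝ, F) ∞ G]
    (z : G) (hz : z ∈ Subgroup.center G)
    (x₀ : N) (c : LoopGroup M (π x₀)) (hc : c ∉ (hπ.onLoops x₀).range) :
    ∃ e : Quotient (FlatTwistedBundle.isoSetoid E F τ z) ≃
        Quotient (TwistedPair.conjSetoid (hπ.onLoops x₀) c z),
      ∀ (D : FlatTwistedBundle E F τ z) (p : TwistedPair (hπ.onLoops x₀) c z),
        e (Quotient.mk _ D) = Quotient.mk _ p ↔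
          ∃ q₀ : D.bundle.Total, IsHolonomy hπ D q₀ p := by
  have : LocallyPathConnectedSpace N := ChartedSpace.locallyPathConnectedSpace E N
  have : PathConnectedSpace N := pathConnectedSpace_iff_connectedSpace.2 inferInstance
  -- since `c` does not come from a loop in `N`, it comes from a path `b` from `x₀` to `τ x₀`
  obtain ⟨b, hb⟩ := hπ.exists_projClass_eq hc
  refine Quotient.exists_equiv_of_rel (FlatTwistedBundle.isoSetoid E F τ z)
    (TwistedPair.conjSetoid (hπ.onLoops x₀) c z)
    (fun D p ↦ ∃ q₀ : D.bundle.Total, IsHolonomy hπ D q₀ p) (fun D ↦ ?_)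
    (FlatTwistedBundle.exists_isHolonomy_eq hπ hb hz) ?_ ?_
  · obtain ⟨q₀, hq⟩ := PrincipalBundle.exists_proj_eq (P := D.bundle) x₀
    obtain ⟨p, hp⟩ := FlatTwistedBundle.exists_isHolonomy hπ hb hz hq
    exact ⟨p, q₀, hp⟩
  · rintro D D' p p' ⟨q₀, h⟩ ⟨q₀', h'⟩
    refine ⟨fun e ↦ ?_, fun e ↦ ?_⟩
    · obtain ⟨q₁, h₁⟩ := FlatTwistedBundle.Iso.exists_isHolonomy hπ hb e h
      exact FlatTwistedBundle.conj_of_isHolonomy hπ hb h₁ h'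
    · obtain ⟨q₁, h₁⟩ := FlatTwistedBundle.exists_isHolonomy_of_conj hπ hb h e
      exact FlatTwistedBundle.iso_of_isHolonomy hπ hb h₁ h'
  · rintro D p p' ⟨q₀, h⟩ e
    exact FlatTwistedBundle.exists_isHolonomy_of_conj hπ hb h e
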